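/- Let $\mathbb T=\mathbb R/2\pi\mathbb Z$ with the metric $|e^{ix}-e^{iy}|$ and the normalised Lebesgue measure $\frac{dx}{2\pi}$. For $\beta>0$ and $V:\mathbb T\to\mathbb R$ set $$d\mathbb P_N(x_1,\dots,x_N)=\frac1{Z_N}\prod_{i<j}|e^{ix_i}-e^{ix_j}|^{\frac{2\beta}{N}}\prod_{i=1}^N e^{-V(x_i)}\frac{dx_i}{2\pi},\qquad \hat\mu_N=\frac1N\sum_{i=1}^N\delta_{x_i},$$ where $Z_N$ is the normalising constant. For probability measures $\mu,\nu$ on $\mathbb T$ let $$F_\beta^V(\mu)=\beta\iint\log\Big|\sin\frac{x-y}2\Big|^{-1}\mu(dx)\,\mu(dy)+H(\mu\,|\,\mu_0^V),\qquad W_1(\mu,\nu)=\inf_{\pi\in\Pi(\mu,\nu)}\iint|e^{ix}-e^{iy}|\,\pi(dx,dy),$$ where $\mu_0^V$ is the probability measure proportional to $e^{-V(x)}\frac{dx}{2\pi}$, $H$ is the relative entropy ($+\infty$ if $\mu\not\ll\mu_0^V$), and $\Pi(\mu,\nu)$ is the set of couplings of $\mu$ and $\nu$. **Theorem (Concentration).**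 There is a function $C$ from the probability measures on $\mathbb T$ to $(0,\infty)$ such that the following holds. Let $\beta>0$ and let $V:\mathbb T\to\mathbb R$ be integrable with a weak derivative $V'\in L^2(\mathbb T)$. Then $F_\beta^V$ has a unique minimiser $\mu_\beta^V$ among the probability measures on $\mathbb T$ and, for every integer $N\ge 10$ and every $r>0$, $$\mathbb P_N\big(W_1(\hat\mu_N,\mu_\beta^V)>r\big)\le\exp\Big(-\beta\Big(\frac{1}{8\pi}Nr^2-5\log N-C(\mu_\beta^V)\Big)\Big).$$ Moreover, when $V=0$ one has, for every $\beta>0$, $C(\mu_\beta^0)=2\log 2+\frac32+16+\frac1\pi$. -/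

import Mathlib

open MeasureTheory Set
open scoped ENNReal ContDiff

namespace CircleGas

instance instFactTwoPiPos : Fact (0 < 2 * Real.pi) := ⟨Real.two_pi_pos⟩

/-- The torus `ℝ / 2πℤ`. -/
abbrev Torus : Type := AddCircle (2 * Real.pi)

/-- The normalised Lebesgue measure `dx / 2π` on the torus. -/
noncomputable abbrev unif : Measure Torus := AddCircle.haarAddCircle

/-- The reference metric `|e^{ix} - e^{iy}|` on the torus. -/
noncomputable def chord (x y : Torus) : ℝ :=
  ‖(AddCircle.toCircle x : ℂ) - (AddCircle.toCircle y : ℂ)‖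

theorem chord_coe (x y : ℝ) :
    chord (x : Torus) (y : Torus)
      = ‖Complex.exp (x * Complex.I) - Complex.exp (y * Complex.I)‖ := by
  have h : 2 * Real.pi / (2 * Real.pi) = 1 := div_self Real.two_pi_pos.ne'
  simp only [chord, AddCircle.toCircle_apply_mk, h, one_mul, Circle.coe_exp]

theorem chord_coe_eq_sin (x y : ℝ) :
    chord (x : Torus) (y : Torus) = 2 * |Real.sin ((x - y) / 2)| := by
  have hxy : Complex.exp (x * Complex.I) - Complex.exp (y * Complex.I)
      = Complex.exp (y * Complex.I)
        * (Complex.exp (Complex.I * ((x - y : ℝ) : ℂ)) - 1) := by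
    rw [mul_sub, ← Complex.exp_add, mul_one]
    congr 2
    push_cast
    ring
  rw [chord_coe, hxy, norm_mul, Complex.norm_exp_ofReal_mul_I, one_mul,
    Complex.norm_exp_I_mul_ofReal_sub_one, norm_mul, Real.norm_eq_abs, Real.norm_eq_abs, abs_two]

/-- `W` is a weak (distributional) derivative of `V` on the torus. The test functions are the
smooth functions `φ` on the torus, that is, those whose `2π`-periodic lift to `ℝ` is smooth, and
`ψ` is the derivative of `φ`. -/
def HasWeakDeriv (V W : Torus → ℝ) : Prop :=
  Integrable V unif ∧ Integrable W unif ∧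
    ∀ φ ψ : Torus → ℝ, ContDiff ℝ ∞ (fun x : ℝ => φ (x : Torus)) →
      (∀ x : ℝ, HasDerivAt (fun y : ℝ => φ (y : Torus)) (ψ (x : Torus)) x) →
      ∫ t, V t * ψ t ∂unif = -∫ t, W t * φ t ∂unif

/-- The unnormalised density
`∏_{i<j} |e^{i x_i} - e^{i x_j}|^{2β/N} ∏_i e^{-V(x_i)}` with respect to `(dx/2π)^{⊗N}`. -/
noncomputable def weight (N : ℕ) (β : ℝ) (V : Torus → ℝ) (x : Fin N → Torus) : ℝ :=
  (∏ i : Fin N, ∏ j ∈ Finset.Ioi i, chord (x i) (x j) ^ (2 * β / (N : ℝ)))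
    * ∏ i : Fin N, Real.exp (-V (x i))

/-- The partition function. -/
noncomputable def partitionFunction (N : ℕ) (β : ℝ) (V : Torus → ℝ) : ℝ≥0∞ :=
  ∫⁻ x, ENNReal.ofReal (weight N β V x) ∂(Measure.pi fun _ : Fin N => unif)

/-- The Gibbs law of the `N` particles on the torus. -/
noncomputable def gibbs (N : ℕ) (β : ℝ) (V : Torus → ℝ) : Measure (Fin N → Torus) :=
  (partitionFunction N β V)⁻¹ •
    (Measure.pi fun _ : Fin N => unif).withDensity
      (fun x => ENNReal.ofReal (weight N β V x))

/-- The empirical measure `N⁻¹ ∑ δ_{x_i}`. -/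
noncomputable def empirical (N : ℕ) (x : Fin N → Torus) : Measure Torus :=
  (N : ℝ≥0∞)⁻¹ • ∑ i : Fin N, Measure.dirac (x i)

/-- The kernel `log |sin ((x - y) / 2)|⁻¹`, equal to `+∞` on the diagonal; recall that
`|sin ((x - y) / 2)| = |e^{ix} - e^{iy}| / 2` (see `chord_coe_eq_sin`). -/
noncomputable def logKernel (x y : Torus) : ℝ≥0∞ :=
  open scoped Classical in
  if x = y then ∞ else ENNReal.ofReal (Real.log (chord x y / 2)⁻¹)

/-- The logarithmic energy of a measure. -/
noncomputable def logEnergy (μ : Measure Torus) : ℝ≥0∞ :=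
  ∫⁻ x, ∫⁻ y, logKernel x y ∂μ ∂μ

/-- The probability measure proportional to `e^{-V(x)} dx/2π`. -/
noncomputable def refMeasure (V : Torus → ℝ) : Measure Torus :=
  unif.tilted (fun x => -V x)

/-- The functional `F(μ) = β E(μ) + H(μ | μ₀)`, where `H` is the relative entropy. -/
noncomputable def freeEnergy (β : ℝ) (V : Torus → ℝ) (μ : ProbabilityMeasure Torus) : ℝ≥0∞ :=
  ENNReal.ofReal β * logEnergy (μ : Measure Torus)
    + InformationTheory.klDiv (μ : Measure Torus) (refMeasure V)

/-- `μ` is the equilibrium measure: the unique minimiser of the free energy among all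
probability measures on the torus. -/
def IsEquilibriumMeasure (β : ℝ) (V : Torus → ℝ) (μ : ProbabilityMeasure Torus) : Prop :=
  ∀ ν : ProbabilityMeasure Torus, ν ≠ μ → freeEnergy β V μ < freeEnergy β V ν

/-- The Wasserstein-Kantorovich distance of order one for the metric `|e^{ix} - e^{iy}|`:
the infimum of the transport cost over all couplings. -/
noncomputable def wasserstein (μ ν : Measure Torus) : ℝ≥0∞ :=
  ⨅ (π : Measure (Torus × Torus)) (_ : π.map Prod.fst = μ ∧ π.map Prod.snd = ν),
    ∫⁻ p, ENNReal.ofReal (chord p.1 p.2) ∂π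

end CircleGas

namespace CircleGas

/-! The equilibrium measure μ solves the Euler-Lagrange equation μ ∝ exp(-V - 2βU) dx/2π, with U the
potential of μ for the kernel k(t) = -log|e^{it} - 1|. Eliminating e^{-V} through it
(`withDensity_weight`), the Gibbs law has a density with respect to μ^{⊗N} proportional to
exp(-(2β/N) Σ_{i<j} k(x_i - x_j) + 2β Σ U(x_i)). The exponent is -βN times the off-diagonal energy
of the signed measure μ̂_N - μ, plus βN E(μ). Jensen's inequality bounds the normalisation below by
exp(β(N+1)E(μ)) (`exp_le_lintegral_relWeight`). What remains is deterministic: the off-diagonal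
energy controls W_1² (`le_of_lt_wasserstein`).

For that bound, cut the circle at a point and couple by quantiles: W_1 is at most the L¹ distance of
the distribution functions. Averaging over the cut and applying Parseval turns this into an H^{-1}
norm, Σ |moment difference|²/n² (`wasserstein_le_sqrt`). The logarithmic energy is the larger
H^{-1/2} norm, with weights 1/n, but it is infinite on point masses. The Abel kernel -log|1 -
ρe^{it}| = Σ ρ^n cos(nt)/n with ρ = 1 - 1/N² repairs this: after multiplication by N its diagonal
costs 2 log N, while the comparison of potentials costs 8M when μ ≤ M dx/2π. The resulting constant
8M + 2 + log 2 depends on μ alone.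

The Euler-Lagrange equation is solved for bounded V by a damped Picard iteration. The map from a
density to the Boltzmann density of its potential is decreasing and Lipschitz, so the damped map
contracts the logarithmic energy (`logEnergy_contraction`). A solution is the unique minimiser
because F(ν) - F(μ) = β E(ν - μ) + H(ν|μ) for ν of finite free energy, where the first term is
nonnegative and the second is positive unless ν = μ (`freeEnergy_lt`). A potential V with a weak
derivative agrees a.e. with a bounded function, namely a sawtooth convolution of the derivative plus
a constant (`HasWeakDeriv.exists_bounded`). -/

/-! ### The logarithmic kernel and its Abel regularisation -/

/-- The distance from `e^{it}` to `1`. -/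
noncomputable def chordNorm (t : Torus) : ℝ := ‖(AddCircle.toCircle t : ℂ) - 1‖

/-- The kernel `-log |e^{it} - 1|`. -/
noncomputable def logKer (t : Torus) : ℝ := -Real.log (chordNorm t)

/-- The Abel regularisation `-log |1 - ρ e^{it}|` of the logarithmic kernel. -/
noncomputable def abelKer (ρ : ℝ) (t : Torus) : ℝ :=
  -Real.log ‖1 - (ρ : ℂ) * (AddCircle.toCircle t : ℂ)‖

theorem chord_eq_chordNorm (x y : Torus) : chord x y = chordNorm (x - y) := by
  have h : (AddCircle.toCircle x : ℂ) - AddCircle.toCircle y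
      = AddCircle.toCircle y * ((AddCircle.toCircle (x - y) : ℂ) - 1) := by
    have := congrArg (fun z : Circle => (z : ℂ)) (AddCircle.toCircle_add y (x - y))
    simp only [add_sub_cancel, Circle.coe_mul] at this
    rw [this]; ring
  rw [chord, chordNorm, h, norm_mul, Circle.norm_coe, one_mul]

theorem continuous_toCircle_coe : Continuous fun t : Torus => (AddCircle.toCircle t : ℂ) :=
  continuous_subtype_val.comp AddCircle.continuous_toCircle

theorem continuous_chordNorm : Continuous chordNorm :=
  (continuous_toCircle_coe.sub continuous_const).norm

theorem chordNorm_nonneg (t : Torus) : 0 ≤ chordNorm t := norm_nonneg _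

theorem chordNorm_le_two (t : Torus) : chordNorm t ≤ 2 := by
  refine (norm_sub_le _ _).trans ?_
  rw [Circle.norm_coe, norm_one]; norm_num

theorem chordNorm_eq_zero {t : Torus} : chordNorm t = 0 ↔ t = 0 := by
  rw [chordNorm, norm_eq_zero, sub_eq_zero]
  constructor
  · intro h
    apply AddCircle.injective_toCircle Real.two_pi_pos.ne'
    ext
    simpa using h
  · rintro rfl; simp

theorem chordNorm_pos {t : Torus} (h : t ≠ 0) : 0 < chordNorm t :=
  (chordNorm_nonneg t).lt_of_ne fun h' => h (chordNorm_eq_zero.1 h'.symm)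

theorem chord_comm (x y : Torus) : chord x y = chord y x := norm_sub_rev _ _

theorem chordNorm_neg (t : Torus) : chordNorm (-t) = chordNorm t := by
  have := chord_comm 0 t
  rwa [chord_eq_chordNorm, chord_eq_chordNorm, zero_sub, sub_zero] at this

theorem logKer_neg (t : Torus) : logKer (-t) = logKer t := by rw [logKer, chordNorm_neg, logKer]

theorem measurable_logKer : Measurable logKer :=
  (Real.measurable_log.comp continuous_chordNorm.measurable).neg

/-- This identity makes the two kernels comparable: dropping (1 - ρ)² gives `abelKer_le`, and
estimating its relative size gives `logKer_le`. -/
theorem norm_one_sub_sq (ρ : ℝ) (t : Torus) :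
    ‖1 - (ρ : ℂ) * (AddCircle.toCircle t : ℂ)‖ ^ 2 = (1 - ρ) ^ 2 + ρ * chordNorm t ^ 2 := by
  have h : ((AddCircle.toCircle t : ℂ)).re ^ 2 + ((AddCircle.toCircle t : ℂ)).im ^ 2 = 1 := by
    have := Circle.normSq_coe (AddCircle.toCircle t)
    rw [Complex.normSq_apply] at this
    linarith
  rw [chordNorm, ← Complex.normSq_eq_norm_sq, ← Complex.normSq_eq_norm_sq, Complex.normSq_apply,
    Complex.normSq_apply]
  simp only [Complex.sub_re, Complex.sub_im, Complex.mul_re, Complex.mul_im, Complex.one_re,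
    Complex.one_im, Complex.ofReal_re, Complex.ofReal_im]
  linear_combination (ρ ^ 2 - ρ) * h

theorem one_sub_le_norm {ρ : ℝ} (h0 : 0 ≤ ρ) (t : Torus) :
    1 - ρ ≤ ‖1 - (ρ : ℂ) * (AddCircle.toCircle t : ℂ)‖ := by
  have := norm_sub_norm_le (1 : ℂ) ((ρ : ℂ) * (AddCircle.toCircle t : ℂ))
  rw [norm_mul, Circle.norm_coe, norm_one, Complex.norm_real, Real.norm_of_nonneg h0, mul_one]
    at this
  exact this

theorem abelKer_eq (ρ : ℝ) (t : Torus) :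
    abelKer ρ t = -(1 / 2) * Real.log ((1 - ρ) ^ 2 + ρ * chordNorm t ^ 2) := by
  rw [← norm_one_sub_sq, Real.log_pow, abelKer]; push_cast; ring

theorem abelKer_zero {ρ : ℝ} : abelKer ρ 0 = -Real.log (1 - ρ) := by
  have : chordNorm 0 = 0 := chordNorm_eq_zero.2 rfl
  rw [abelKer_eq, this, zero_pow two_ne_zero, mul_zero, add_zero, Real.log_pow]; push_cast; ring

theorem continuous_abelKer {ρ : ℝ} (h0 : 0 ≤ ρ) (h1 : ρ < 1) : Continuous (abelKer ρ) := by
  refine (Continuous.log ?_ fun t => ?_).neg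
  · exact (continuous_const.sub (continuous_const.mul continuous_toCircle_coe)).norm
  · have := one_sub_le_norm h0 t
    linarith

theorem abelKer_le {ρ : ℝ} (h0 : 0 < ρ) {t : Torus} (ht : t ≠ 0) :
    abelKer ρ t ≤ logKer t - 1 / 2 * Real.log ρ := by
  have hp := chordNorm_pos ht
  have h : Real.log (ρ * chordNorm t ^ 2) ≤ Real.log ((1 - ρ) ^ 2 + ρ * chordNorm t ^ 2) :=
    Real.log_le_log (by positivity) (by nlinarith [sq_nonneg (1 - ρ)])
  rw [Real.log_mul h0.ne' (by positivity), Real.log_pow] at h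
  rw [abelKer_eq, logKer]
  push_cast at h
  linarith

/-- With y = ((1 - ρ)/s)^{1/2}, the gap between the kernels is at most ½ log(1 + y⁴) ≤ 2 log(1 + y)
≤ 2y. The power 1/2 keeps the singularity in s integrable and makes the error of order 1/N when 1 -
ρ = 1/N². -/
theorem logKer_le {ρ : ℝ} (h0 : 0 < ρ) (h1 : ρ < 1) {t : Torus} (ht : t ≠ 0) :
    logKer t ≤ abelKer ρ t + 2 * Real.sqrt (1 - ρ) * chordNorm t ^ (-(1 / 2) : ℝ) := by
  have hp := chordNorm_pos ht
  set s := chordNorm t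
  have hq : 0 < (1 - ρ) ^ 2 + ρ * s ^ 2 := by positivity
  have hr : 0 < 1 - ρ := by linarith
  have h1 : Real.log (((1 - ρ) ^ 2 + ρ * s ^ 2) / s ^ 2) ≤ Real.log (1 + ((1 - ρ) / s) ^ 2) := by
    apply Real.log_le_log (by positivity)
    rw [div_le_iff₀ (by positivity), add_mul, div_pow, div_mul_cancel₀ _ (by positivity)]
    nlinarith [sq_nonneg s]
  have h2 : Real.log (1 + ((1 - ρ) / s) ^ 2) ≤ 4 * ((1 - ρ) / s) ^ (1 / 2 : ℝ) := by
    set y := ((1 - ρ) / s) ^ (1 / 2 : ℝ)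
    have hy : 0 ≤ y := by positivity
    have hy2 : ((1 - ρ) / s) ^ 2 = y ^ 4 := by
      rw [← Real.rpow_natCast y 4, ← Real.rpow_mul (by positivity)]
      norm_num
    have : Real.log (1 + y ^ 4) ≤ Real.log ((1 + y) ^ 4) := by
      apply Real.log_le_log (by positivity)
      nlinarith [pow_nonneg hy 2, pow_nonneg hy 3]
    rw [hy2]
    refine this.trans ?_
    rw [Real.log_pow]
    have := Real.log_le_sub_one_of_pos (show 0 < 1 + y by linarith)
    push_cast
    linarith
  have h3 : ((1 - ρ) / s) ^ (1 / 2 : ℝ) = Real.sqrt (1 - ρ) * s ^ (-(1 / 2) : ℝ) := by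
    rw [Real.div_rpow hr.le hp.le, Real.sqrt_eq_rpow, Real.rpow_neg hp.le, div_eq_mul_inv]
  rw [Real.log_div hq.ne' (by positivity), Real.log_pow] at h1
  rw [abelKer_eq, logKer]
  push_cast at h1
  change -Real.log s ≤ _
  rw [h3] at h2
  linarith

theorem neg_log_two_le_logKer (t : Torus) : -Real.log 2 ≤ logKer t := by
  rcases eq_or_ne t 0 with rfl | ht
  -- The convention log 0 = 0 gives the kernel the value 0, not +∞, at the origin.
  · rw [logKer, chordNorm_eq_zero.2 rfl, Real.log_zero]
    linarith [Real.log_nonneg (show (1 : ℝ) ≤ 2 by norm_num)]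
  · exact neg_le_neg (Real.log_le_log (chordNorm_pos ht) (chordNorm_le_two t))

theorem logKer_le_rpow (t : Torus) : logKer t ≤ 2 * chordNorm t ^ (-(1 / 2) : ℝ) := by
  rcases eq_or_ne t 0 with rfl | ht
  · rw [logKer, chordNorm_eq_zero.2 rfl, Real.log_zero, neg_zero]; positivity
  · have hp := chordNorm_pos ht
    have := Real.log_le_rpow_div (inv_nonneg.2 hp.le) (show (0 : ℝ) < 1 / 2 by norm_num)
    rw [Real.log_inv, Real.inv_rpow hp.le, ← Real.rpow_neg hp.le] at this
    rw [logKer]; linarith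

theorem abs_logKer_le (t : Torus) :
    |logKer t| ≤ 2 * chordNorm t ^ (-(1 / 2) : ℝ) + Real.log 2 := by
  have h1 := neg_log_two_le_logKer t
  have h2 := logKer_le_rpow t
  have h3 := Real.rpow_nonneg (chordNorm_nonneg t) (-(1 / 2))
  have h4 := Real.log_nonneg (show (1 : ℝ) ≤ 2 by norm_num)
  rw [abs_le]; constructor <;> linarith

/-! ### Integrability of the singularity -/

theorem chordNorm_coe (x : ℝ) : chordNorm (x : Torus) = 2 * |Real.sin (x / 2)| := by
  have := chord_coe_eq_sin x 0
  rwa [chord_eq_chordNorm, QuotientAddGroup.mk_zero, sub_zero, sub_zero] at this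

theorem lintegral_unif (f : Torus → ℝ≥0∞) (a : ℝ) :
    ∫⁻ t, f t ∂unif = ENNReal.ofReal (2 * Real.pi)⁻¹ * ∫⁻ x in Ioc a (a + 2 * Real.pi), f x := by
  have h := AddCircle.volume_eq_smul_haarAddCircle (T := 2 * Real.pi)
  rw [AddCircle.lintegral_preimage, h, lintegral_smul_measure, smul_eq_mul, ← mul_assoc,
    ← ENNReal.ofReal_mul (by positivity), inv_mul_cancel₀ Real.two_pi_pos.ne', ENNReal.ofReal_one,
    one_mul]

theorem lintegral_chordNorm_rpow :
    ∫⁻ t, ENNReal.ofReal (chordNorm t ^ (-(1 / 2) : ℝ)) ∂unif ≤ 2 := by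
  have hpi := Real.pi_pos
  rw [lintegral_unif _ (-Real.pi), show -Real.pi + 2 * Real.pi = Real.pi by ring]
  set c : ℝ := (2 / Real.pi) ^ (-(1 / 2) : ℝ)
  have hc : 0 ≤ c := by positivity
  have key : ∀ x : ℝ, x ∈ Ioc (-Real.pi) Real.pi → x ≠ 0 →
      chordNorm (x : Torus) ^ (-(1 / 2) : ℝ) ≤ c * |x| ^ (-(1 / 2) : ℝ) := by
    intro x hx hx0
    have hx' : 0 < |x| := abs_pos.2 hx0
    rw [← Real.mul_rpow (by positivity) hx'.le, chordNorm_coe]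
    apply Real.rpow_le_rpow_of_nonpos (by positivity) _ (by norm_num)
    have habs : |x| ≤ Real.pi := abs_le.2 ⟨hx.1.le, hx.2⟩
    -- Jordan's inequality sin y ≥ 2y/π on [0, π/2], which yields chordNorm x ≥ (2/π)|x|.
    have h1 := Real.mul_le_sin (x := |x| / 2) (by positivity) (by linarith)
    have h2 : |Real.sin (x / 2)| = Real.sin (|x| / 2) := by
      rcases le_total 0 x with h | h
      · rw [abs_of_nonneg h] at *
        exact abs_of_nonneg (Real.sin_nonneg_of_nonneg_of_le_pi (by linarith) (by linarith))
      · rw [abs_of_nonpos h] at *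
        rw [neg_div, Real.sin_neg]
        exact abs_of_nonpos (by
          have := Real.sin_nonneg_of_nonneg_of_le_pi (x := -x / 2) (by linarith) (by linarith)
          rw [neg_div, Real.sin_neg] at this; linarith)
    rw [h2]
    linarith
  have hI : ∫⁻ x in Ioc 0 Real.pi, ENNReal.ofReal (x ^ (-(1 / 2) : ℝ))
      = ENNReal.ofReal (2 * Real.pi ^ (1 / 2 : ℝ)) := by
    have hint := intervalIntegral.intervalIntegrable_rpow' (a := 0) (b := Real.pi)
      (r := -(1 / 2)) (by norm_num)
    rw [intervalIntegrable_iff_integrableOn_Ioc_of_le hpi.le] at hint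
    rw [← ofReal_integral_eq_lintegral_ofReal hint, ← intervalIntegral.integral_of_le hpi.le,
      integral_rpow (Or.inl (by norm_num))]
    · congr 1
      rw [show (-(1 / 2) + 1 : ℝ) = 1 / 2 by norm_num, Real.zero_rpow (by norm_num)]
      ring
    · filter_upwards [ae_restrict_mem measurableSet_Ioc] with x hx
      exact Real.rpow_nonneg hx.1.le _
  have hbound : ∫⁻ x in Ioc (-Real.pi) Real.pi, ENNReal.ofReal (chordNorm (x : Torus) ^ (-(1 / 2) : ℝ))
      ≤ ∫⁻ x in Ioc (-Real.pi) Real.pi, ENNReal.ofReal c * ENNReal.ofReal (|x| ^ (-(1 / 2) : ℝ)) := by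
    apply lintegral_mono_ae
    filter_upwards [ae_restrict_mem measurableSet_Ioc,
      ae_restrict_of_ae (Measure.ae_ne volume (0 : ℝ))] with x hx hx0
    rw [← ENNReal.ofReal_mul hc]
    exact ENNReal.ofReal_le_ofReal (key x hx hx0)
  have hsplit : ∫⁻ x in Ioc (-Real.pi) Real.pi, ENNReal.ofReal (|x| ^ (-(1 / 2) : ℝ))
      = 2 * ∫⁻ x in Ioc 0 Real.pi, ENNReal.ofReal (x ^ (-(1 / 2) : ℝ)) := by
    rw [← Ioc_union_Ioc_eq_Ioc (neg_nonpos.2 hpi.le) hpi.le, lintegral_union measurableSet_Ioc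
      (Set.disjoint_left.2 fun x hx hx' => absurd hx.2 (not_le.2 hx'.1)), two_mul]
    congr 1
    · have hneg := (Measure.measurePreserving_neg (volume : Measure ℝ)).setLIntegral_comp_preimage_emb
        (MeasurableEquiv.neg ℝ).measurableEmbedding (fun x => ENNReal.ofReal (|x| ^ (-(1 / 2) : ℝ)))
        (Ico 0 Real.pi)
      have hs : (fun x : ℝ => -x) ⁻¹' Ico 0 Real.pi = Ioc (-Real.pi) 0 := by simp
      rw [show ((Neg.neg : ℝ → ℝ) ⁻¹' Ico 0 Real.pi) = Ioc (-Real.pi) 0 from hs] at hneg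
      simp only [abs_neg] at hneg
      rw [hneg, setLIntegral_congr Ico_ae_eq_Ioc]
      exact setLIntegral_congr_fun measurableSet_Ioc fun x hx => by simp only [abs_of_pos hx.1]
    · exact setLIntegral_congr_fun measurableSet_Ioc fun x hx => by simp only [abs_of_pos hx.1]
  rw [lintegral_const_mul' _ _ ENNReal.ofReal_ne_top, hsplit, hI] at hbound
  refine (mul_le_mul_right hbound _).trans ?_
  rw [← ENNReal.ofReal_ofNat 2, ← ENNReal.ofReal_mul (by norm_num), ← ENNReal.ofReal_mul hc,
    ← ENNReal.ofReal_mul (by positivity)]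
  apply ENNReal.ofReal_le_ofReal
  have h1 : c * Real.pi ^ (1 / 2 : ℝ) ≤ Real.pi := by
    have : c = (Real.pi / 2) ^ (1 / 2 : ℝ) := by
      rw [show Real.pi / 2 = (2 / Real.pi)⁻¹ by rw [inv_div], Real.inv_rpow (by positivity),
        ← Real.rpow_neg (by positivity)]
    rw [this, ← Real.mul_rpow (by positivity) hpi.le]
    calc (Real.pi / 2 * Real.pi) ^ (1 / 2 : ℝ) ≤ (Real.pi ^ 2) ^ (1 / 2 : ℝ) := by
          apply Real.rpow_le_rpow (by positivity) (by nlinarith) (by norm_num)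
      _ = Real.pi := by rw [← Real.sqrt_eq_rpow, Real.sqrt_sq hpi.le]
  rw [inv_mul_le_iff₀ (by positivity)]
  nlinarith

/-! ### Trigonometric moments and the regularised energy -/

/-- The `n`-th trigonometric moment of a measure on the torus. -/
noncomputable def moment (μ : Measure Torus) (n : ℕ) : ℂ :=
  ∫ t, (AddCircle.toCircle t : ℂ) ^ n ∂μ

/-- The mutual energy of two measures for the Abel-regularised kernel. -/
noncomputable def abelEnergy (ρ : ℝ) (μ ν : Measure Torus) : ℝ :=
  ∫ p, abelKer ρ (p.1 - p.2) ∂(μ.prod ν)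

/-- Real part of the Taylor series of -log(1 - z) at z = ρe^{it}. The term n = 0 vanishes because
division by zero gives 0; the later series over n rely on the same convention. -/
theorem hasSum_abelKer {ρ : ℝ} (h0 : 0 ≤ ρ) (h1 : ρ < 1) (t : Torus) :
    HasSum (fun n : ℕ => ρ ^ n / n * ((AddCircle.toCircle t : ℂ) ^ n).re) (abelKer ρ t) := by
  have hz : ‖(ρ : ℂ) * (AddCircle.toCircle t : ℂ)‖ < 1 := by
    rwa [norm_mul, Circle.norm_coe, mul_one, Complex.norm_real, Real.norm_of_nonneg h0]
  have h := Complex.hasSum_re (Complex.hasSum_taylorSeries_neg_log hz)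
  rw [Complex.neg_re, Complex.log_re] at h
  convert! h using 2 with n
  rw [mul_pow, mul_div_right_comm, ← Complex.ofReal_natCast, ← Complex.ofReal_pow,
    ← Complex.ofReal_div, Complex.re_ofReal_mul]

theorem summable_pow_div {ρ : ℝ} (h0 : 0 ≤ ρ) (h1 : ρ < 1) :
    Summable fun n : ℕ => ρ ^ n / (n : ℝ) := by
  have h := (hasSum_abelKer h0 h1 0).summable
  simpa using h

theorem toCircle_sub_coe (x y : Torus) :
    (AddCircle.toCircle (x - y) : ℂ)
      = AddCircle.toCircle x * (starRingEnd ℂ) (AddCircle.toCircle y : ℂ) := by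
  rw [sub_eq_add_neg, AddCircle.toCircle_add, AddCircle.toCircle_neg, Circle.coe_mul,
    Circle.coe_inv_eq_conj]

theorem norm_toCircle_pow (t : Torus) (n : ℕ) : ‖(AddCircle.toCircle t : ℂ) ^ n‖ = 1 := by
  rw [norm_pow, Circle.norm_coe, one_pow]

theorem integral_toCircle_sub_pow (μ ν : Measure Torus) [IsFiniteMeasure μ] [IsFiniteMeasure ν]
    (n : ℕ) :
    ∫ p : Torus × Torus, ((AddCircle.toCircle (p.1 - p.2) : ℂ) ^ n).re ∂(μ.prod ν)
      = (moment μ n * (starRingEnd ℂ) (moment ν n)).re := by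
  have h : ∀ p : Torus × Torus, (AddCircle.toCircle (p.1 - p.2) : ℂ) ^ n
      = (AddCircle.toCircle p.1 : ℂ) ^ n * (starRingEnd ℂ) ((AddCircle.toCircle p.2 : ℂ) ^ n) := by
    intro p
    rw [toCircle_sub_coe, mul_pow, map_pow]
  have hint : Integrable (fun p : Torus × Torus => (AddCircle.toCircle (p.1 - p.2) : ℂ) ^ n)
      (μ.prod ν) :=
    .of_bound ((continuous_toCircle_coe.comp
      (continuous_fst.sub continuous_snd)).pow n).aestronglyMeasurable 1
      (.of_forall fun t => (norm_toCircle_pow _ n).le)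
  have h2 := integral_re (𝕜 := ℂ) hint
  simp only [RCLike.re_to_complex] at h2
  rw [h2]
  simp_rw [h]
  refine congrArg Complex.re ((integral_prod_mul (fun x : Torus => (AddCircle.toCircle x : ℂ) ^ n)
    (fun y : Torus => (starRingEnd ℂ) ((AddCircle.toCircle y : ℂ) ^ n))).trans ?_)
  rw [integral_conj, moment, moment]

theorem hasSum_abelEnergy {ρ : ℝ} (h0 : 0 ≤ ρ) (h1 : ρ < 1) (μ ν : Measure Torus)
    [IsFiniteMeasure μ] [IsFiniteMeasure ν] :
    HasSum (fun n : ℕ => ρ ^ n / n * (moment μ n * (starRingEnd ℂ) (moment ν n)).re)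
      (abelEnergy ρ μ ν) := by
  have hb : ∀ (n : ℕ) (p : Torus × Torus),
      ‖ρ ^ n / n * ((AddCircle.toCircle (p.1 - p.2) : ℂ) ^ n).re‖ ≤ ρ ^ n / n := by
    intro n p
    rw [norm_mul, Real.norm_of_nonneg (by positivity)]
    exact mul_le_of_le_one_right (by positivity)
      ((Complex.abs_re_le_norm _).trans (norm_toCircle_pow _ n).le)
  have hm : ∀ n : ℕ, Integrable (fun p : Torus × Torus =>
      ρ ^ n / n * ((AddCircle.toCircle (p.1 - p.2) : ℂ) ^ n).re) (μ.prod ν) := fun n =>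
    .of_bound (continuous_const.mul (Complex.continuous_re.comp ((continuous_toCircle_coe.comp
      (continuous_fst.sub continuous_snd)).pow n))).aestronglyMeasurable (ρ ^ n / n)
      (.of_forall (hb n))
  have hs : Summable fun n : ℕ => ∫ p : Torus × Torus,
      ‖ρ ^ n / n * ((AddCircle.toCircle (p.1 - p.2) : ℂ) ^ n).re‖ ∂(μ.prod ν) := by
    refine Summable.of_nonneg_of_le (fun n => integral_nonneg fun p => norm_nonneg _)
      (fun n => ?_) ((summable_pow_div h0 h1).mul_right ((μ.prod ν).real univ))
    have := integral_mono_of_nonneg (.of_forall fun p => norm_nonneg _)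
      (integrable_const (ρ ^ n / (n : ℝ))) (.of_forall (hb n)) (μ := μ.prod ν)
    rw [integral_const, smul_eq_mul] at this
    exact this.trans_eq (mul_comm _ _)
  have := hasSum_integral_of_summable_integral_norm hm hs
  simp_rw [integral_const_mul, integral_toCircle_sub_pow] at this
  convert! this using 1
  exact integral_congr_ae (.of_forall fun p => ((hasSum_abelKer h0 h1 _).tsum_eq).symm)

/-- Positive definiteness of the Abel kernel: the energy of μ - ν is a series of nonnegative terms,
a damped H^{-1/2} norm. -/
theorem hasSum_abelEnergy_sub {ρ : ℝ} (h0 : 0 ≤ ρ) (h1 : ρ < 1) (μ ν : Measure Torus)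
    [IsFiniteMeasure μ] [IsFiniteMeasure ν] :
    HasSum (fun n : ℕ => ρ ^ n / n * ‖moment μ n - moment ν n‖ ^ 2)
      (abelEnergy ρ μ μ - 2 * abelEnergy ρ μ ν + abelEnergy ρ ν ν) := by
  convert! ((hasSum_abelEnergy h0 h1 μ μ).sub ((hasSum_abelEnergy h0 h1 μ ν).mul_left 2)).add
    (hasSum_abelEnergy h0 h1 ν ν) using 2 with n
  rw [← Complex.normSq_eq_norm_sq, Complex.normSq_apply]
  simp only [Complex.sub_re, Complex.sub_im, Complex.mul_re, Complex.conj_re, Complex.conj_im]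
  ring

/-! ### Kernel integrals against bounded densities, and Fourier coefficients -/

theorem integrable_chordNorm_rpow :
    Integrable (fun t => chordNorm t ^ (-(1 / 2) : ℝ)) unif := by
  refine ⟨(continuous_chordNorm.measurable.pow_const _).aestronglyMeasurable, ?_⟩
  rw [hasFiniteIntegral_iff_ofReal (.of_forall fun t => Real.rpow_nonneg (chordNorm_nonneg t) _)]
  exact lintegral_chordNorm_rpow.trans_lt (by simp)

theorem lintegral_chordNorm_rpow_le {M : ℝ} {μ : Measure Torus}
    (hμ : μ ≤ ENNReal.ofReal M • unif) (x : Torus) :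
    ∫⁻ y, ENNReal.ofReal (chordNorm (x - y) ^ (-(1 / 2) : ℝ)) ∂μ ≤ ENNReal.ofReal (2 * M) := by
  refine (lintegral_mono' hμ le_rfl).trans ?_
  rw [lintegral_smul_measure, smul_eq_mul,
    lintegral_sub_left_eq_self (fun t => ENNReal.ofReal (chordNorm t ^ (-(1 / 2) : ℝ))) x,
    mul_comm 2 M, ENNReal.ofReal_mul' (by norm_num)]
  exact mul_le_mul_right (lintegral_chordNorm_rpow.trans (by simp)) _

theorem integrable_chordNorm_sub {M : ℝ} {μ : Measure Torus}
    (hμ : μ ≤ ENNReal.ofReal M • unif) (x : Torus) :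
    Integrable (fun y => chordNorm (x - y) ^ (-(1 / 2) : ℝ)) μ := by
  refine ⟨((continuous_chordNorm.comp
    (continuous_const.sub continuous_id)).measurable.pow_const _).aestronglyMeasurable, ?_⟩
  rw [hasFiniteIntegral_iff_ofReal (.of_forall fun t => Real.rpow_nonneg (chordNorm_nonneg _) _)]
  exact (lintegral_chordNorm_rpow_le hμ x).trans_lt ENNReal.ofReal_lt_top

theorem integral_chordNorm_sub_le {M : ℝ} (hM : 0 ≤ M) {μ : Measure Torus}
    (hμ : μ ≤ ENNReal.ofReal M • unif) (x : Torus) :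
    ∫ y, chordNorm (x - y) ^ (-(1 / 2) : ℝ) ∂μ ≤ 2 * M := by
  rw [integral_eq_lintegral_of_nonneg_ae
    (.of_forall fun t => Real.rpow_nonneg (chordNorm_nonneg _) _)
    (integrable_chordNorm_sub hμ x).1]
  exact ENNReal.toReal_le_of_le_ofReal (by positivity) (lintegral_chordNorm_rpow_le hμ x)

theorem integrable_logKer : Integrable logKer unif := by
  refine ((integrable_chordNorm_rpow.const_mul 2).add (integrable_const (Real.log 2))).mono'
    measurable_logKer.aestronglyMeasurable (.of_forall fun t => ?_)
  exact abs_logKer_le t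

theorem fourierCoeff_abelKer {ρ : ℝ} (h0 : 0 ≤ ρ) (h1 : ρ < 1) (k : ℤ) :
    ∫ t, fourier (-k) t * (abelKer ρ t : ℂ) ∂unif
      = ((ρ ^ k.natAbs / (2 * k.natAbs) : ℝ) : ℂ) := by
  have hre : ∀ (n : ℕ) (t : Torus), (((AddCircle.toCircle t : ℂ) ^ n).re : ℂ)
      = (fourier (n : ℤ) t + fourier (-(n : ℤ)) t) / 2 := by
    intro n t
    rw [Complex.re_eq_add_conj, fourier_neg, fourier_apply, natCast_zsmul,
      AddCircle.toCircle_nsmul, Circle.coe_pow]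
  have horth : ∀ m j : ℤ, ∫ t : Torus, fourier (-m) t * fourier j t ∂unif
      = if m = j then 1 else 0 := by
    intro m j
    have := congrFun (fourierCoeff_fourier (T := 2 * Real.pi) j) m
    rw [fourierCoeff, Pi.single_apply] at this
    exact this
  have hc : ∀ j : ℤ, Integrable (fun t : Torus => fourier (-k) t * fourier j t) unif := fun j =>
    ((fourier (-k)).continuous.mul (fourier j).continuous).integrable_of_hasCompactSupport
      (HasCompactSupport.of_compactSpace _)
  have hint : ∀ n : ℕ, ∫ t : Torus, fourier (-k) t *
      ((ρ ^ n / n * ((AddCircle.toCircle t : ℂ) ^ n).re : ℝ) : ℂ) ∂unif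
      = if n = k.natAbs then ((ρ ^ k.natAbs / (2 * k.natAbs) : ℝ) : ℂ) else 0 := by
    intro n
    have : ∀ t : Torus, fourier (-k) t *
      ((ρ ^ n / n * ((AddCircle.toCircle t : ℂ) ^ n).re : ℝ) : ℂ)
        = ((ρ ^ n / (2 * n) : ℝ) : ℂ) * (fourier (-k) t * fourier (n : ℤ) t)
          + ((ρ ^ n / (2 * n) : ℝ) : ℂ) * (fourier (-k) t * fourier (-(n : ℤ)) t) := by
      intro t
      rw [Complex.ofReal_mul, hre]; push_cast; ring
    simp_rw [this]
    rw [integral_add ((hc _).const_mul _) ((hc _).const_mul _), integral_const_mul,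
      integral_const_mul, horth, horth]
    rcases Nat.eq_zero_or_pos n with rfl | hn
    · rcases eq_or_ne k 0 with rfl | hk
      · simp
      · simp [hk, eq_comm]
    · split_ifs with a b c c b c c <;> first | omega | skip
      · subst c; simp
      · subst c; simp
      · simp
  have hs := hasSum_integral_of_summable_integral_norm
    (F := fun (n : ℕ) (t : Torus) => fourier (-k) t *
      ((ρ ^ n / n * ((AddCircle.toCircle t : ℂ) ^ n).re : ℝ) : ℂ)) (μ := unif) ?_ ?_
  · simp_rw [hint] at hs
    have h2 := hasSum_ite_eq k.natAbs (((ρ ^ k.natAbs / (2 * k.natAbs) : ℝ) : ℂ))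
    rw [← hs.unique h2]
    refine integral_congr_ae (.of_forall fun t => ?_)
    have := (hasSum_abelKer h0 h1 t)
    have h3 := ((Complex.hasSum_ofReal.2 this).mul_left (fourier (-k) t)).tsum_eq
    exact h3.symm
  · intro n
    exact Continuous.integrable_of_hasCompactSupport
      ((fourier (-k)).continuous.mul (Complex.continuous_ofReal.comp (continuous_const.mul
        (Complex.continuous_re.comp (continuous_toCircle_coe.pow n)))))
      (HasCompactSupport.of_compactSpace _)
  · refine Summable.of_nonneg_of_le (fun n => integral_nonneg fun p => norm_nonneg _)
      (fun n => ?_) (summable_pow_div h0 h1)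
    have := integral_mono_of_nonneg (μ := (unif : Measure Torus))
      (.of_forall fun p => norm_nonneg _) (integrable_const (ρ ^ n / (n : ℝ)))
      (.of_forall (fun t => ?_) : (fun t : Torus => ‖fourier (-k) t *
      ((ρ ^ n / n * ((AddCircle.toCircle t : ℂ) ^ n).re : ℝ) : ℂ)‖) ≤ᵐ[unif] _)
    · simpa using this
    · dsimp only
      rw [norm_mul, fourier_apply, Circle.norm_coe, one_mul, Complex.norm_real, norm_mul,
        Real.norm_of_nonneg (by positivity)]
      exact mul_le_of_le_one_right (by positivity)
        ((Complex.abs_re_le_norm _).trans (norm_toCircle_pow _ n).le)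

theorem abs_logKer_sub_abelKer_le {ρ : ℝ} (h0 : 0 < ρ) (h1 : ρ < 1) {t : Torus} (ht : t ≠ 0) :
    |logKer t - abelKer ρ t|
      ≤ -(1 / 2 * Real.log ρ) + 2 * Real.sqrt (1 - ρ) * chordNorm t ^ (-(1 / 2) : ℝ) := by
  have h2 := abelKer_le h0 ht
  have h3 := logKer_le h0 h1 ht
  have h4 : 0 ≤ 2 * Real.sqrt (1 - ρ) * chordNorm t ^ (-(1 / 2) : ℝ) :=
    mul_nonneg (by positivity) (Real.rpow_nonneg (chordNorm_nonneg t) _)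
  have h5 := Real.log_nonpos h0.le h1.le
  rw [abs_le]; constructor <;> linarith

theorem ae_ne_unif (a : Torus) : ∀ᵐ t ∂unif, t ≠ a := by
  rw [ae_iff]
  simp only [ne_eq, not_not, ofPred_eq_eq_singleton]
  have h := AddCircle.volume_eq_smul_haarAddCircle (T := 2 * Real.pi)
  have h2 : (volume : Measure Torus) {a} = 0 := by
    have := AddCircle.volume_closedBall (T := 2 * Real.pi) (x := a) 0
    simpa using this
  rw [h, Measure.smul_apply, smul_eq_mul] at h2
  exact (mul_eq_zero.1 h2).resolve_left (by simp [Real.pi_pos])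

/-- Obtained from the Abel kernel by letting ρ → 1, since the L¹ distance of the two kernels is at
most -½ log ρ + 4√(1 - ρ). At k = 0 the right side is 1/0 = 0: the logarithmic kernel has mean zero.
-/
theorem fourierCoeff_logKer (k : ℤ) :
    ∫ t, fourier (-k) t * (logKer t : ℂ) ∂unif = ((1 / (2 * k.natAbs) : ℝ) : ℂ) := by
  have hcont : Filter.Tendsto (fun ρ : ℝ => -(1 / 2 * Real.log ρ) + 2 * Real.sqrt (1 - ρ) * 2)
      (nhdsWithin 1 (Ioo 0 1)) (nhds 0) := by
    have : ContinuousAt (fun ρ : ℝ => -(1 / 2 * Real.log ρ) + 2 * Real.sqrt (1 - ρ) * 2) 1 := by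
      refine ContinuousAt.add (ContinuousAt.neg (continuousAt_const.mul
        (Real.continuousAt_log one_ne_zero))) ?_
      fun_prop
    have h := this.tendsto
    simp only [Real.log_one, mul_zero, neg_zero, sub_self, Real.sqrt_zero, zero_mul, add_zero] at h
    exact h.mono_left nhdsWithin_le_nhds
  have hne : (nhdsWithin (1 : ℝ) (Ioo 0 1)).NeBot := by
    rw [nhdsWithin_Ioo_eq_nhdsLT zero_lt_one]; infer_instance
  have hfin : Integrable (fun t : Torus => fourier (-k) t * (logKer t : ℂ)) unif :=
    integrable_logKer.ofReal.bdd_mul (fourier (-k)).continuous.aestronglyMeasurable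
      (c := 1) (.of_forall fun t => by rw [fourier_apply, Circle.norm_coe])
  have hfinA : ∀ ρ ∈ Ioo (0 : ℝ) 1,
      Integrable (fun t : Torus => fourier (-k) t * (abelKer ρ t : ℂ)) unif := fun ρ hρ =>
    ((fourier (-k)).continuous.mul (Complex.continuous_ofReal.comp
      (continuous_abelKer hρ.1.le hρ.2))).integrable_of_hasCompactSupport
      (HasCompactSupport.of_compactSpace _)
  have hlim : Filter.Tendsto (fun ρ : ℝ => ((ρ ^ k.natAbs / (2 * k.natAbs) : ℝ) : ℂ))
      (nhdsWithin 1 (Ioo 0 1)) (nhds (∫ t, fourier (-k) t * (logKer t : ℂ) ∂unif)) := by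
    rw [tendsto_iff_norm_sub_tendsto_zero]
    refine squeeze_zero' (.of_forall fun _ => norm_nonneg _) ?_ hcont
    filter_upwards [self_mem_nhdsWithin] with ρ hρ
    rw [← fourierCoeff_abelKer hρ.1.le hρ.2, ← integral_sub (hfinA ρ hρ) hfin]
    refine (norm_integral_le_of_norm_le (g := fun t => -(1 / 2 * Real.log ρ)
      + 2 * Real.sqrt (1 - ρ) * chordNorm t ^ (-(1 / 2) : ℝ))
      ((integrable_const _).add (integrable_chordNorm_rpow.const_mul _)) ?_).trans ?_
    · filter_upwards [ae_ne_unif 0] with t ht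
      rw [← mul_sub, norm_mul, fourier_apply, Circle.norm_coe, one_mul, ← Complex.ofReal_sub,
        Complex.norm_real, Real.norm_eq_abs, abs_sub_comm]
      exact abs_logKer_sub_abelKer_le hρ.1 hρ.2 ht
    · rw [integral_add (integrable_const _) (integrable_chordNorm_rpow.const_mul _),
        integral_const_mul]
      have h2 : ∫ t, chordNorm t ^ (-(1 / 2) : ℝ) ∂unif ≤ 2 := by
        have := integral_chordNorm_sub_le (M := 1) zero_le_one (μ := unif) (by simp) 0
        simp only [zero_sub, chordNorm_neg, mul_one] at this
        exact this
      simp only [integral_const, probReal_univ, smul_eq_mul, one_mul]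
      gcongr
  have hlim2 : Filter.Tendsto (fun ρ : ℝ => ((ρ ^ k.natAbs / (2 * k.natAbs) : ℝ) : ℂ))
      (nhdsWithin 1 (Ioo 0 1)) (nhds ((1 / (2 * k.natAbs) : ℝ) : ℂ)) := by
    have : Continuous (fun ρ : ℝ => ((ρ ^ k.natAbs / (2 * k.natAbs) : ℝ) : ℂ)) := by fun_prop
    have h := (this.tendsto 1).mono_left (nhdsWithin_le_nhds (s := Ioo 0 1))
    rwa [one_pow] at h
  exact tendsto_nhds_unique hlim hlim2

/-! ### Quantile coupling on the line -/

/-- The quantile function of a probability measure on the line. -/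
noncomputable def quantile (m : Measure ℝ) (u : ℝ) : ℝ := sInf {x | u ≤ ProbabilityTheory.cdf m x}

/-- Restricting u to (0, 1) makes the defining set nonempty and bounded below; right continuity of
the distribution function makes the infimum attained. -/
theorem quantile_le_iff (m : Measure ℝ) {u : ℝ} (hu : u ∈ Ioo (0 : ℝ) 1) (x : ℝ) :
    quantile m u ≤ x ↔ u ≤ ProbabilityTheory.cdf m x := by
  set F := ProbabilityTheory.cdf m
  have hne : {x | u ≤ F x}.Nonempty :=
    ((ProbabilityTheory.tendsto_cdf_atTop m).eventually (eventually_ge_nhds hu.2)).exists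
  obtain ⟨b, hb⟩ :=
    ((ProbabilityTheory.tendsto_cdf_atBot m).eventually (eventually_lt_nhds hu.1)).exists
  have hbdd : BddBelow {x | u ≤ F x} := by
    refine ⟨b, fun y hy => ?_⟩
    by_contra h
    exact absurd (F.mono (not_le.1 h).le) (not_le.2 (lt_of_lt_of_le hb hy))
  constructor
  · intro h
    have hgt : ∀ y, x < y → u ≤ F y := by
      intro y hy
      obtain ⟨z, hz, hzy⟩ := (csInf_lt_iff hbdd hne).1 (lt_of_le_of_lt h hy)
      exact le_trans hz (F.mono hzy.le)
    have hc := (F.right_continuous x).mono (Ioi_subset_Ici_self)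
    refine ge_of_tendsto hc.tendsto ?_
    filter_upwards [self_mem_nhdsWithin] with y hy using hgt y hy
  · intro h
    exact csInf_le hbdd h

theorem aemeasurable_quantile (m : Measure ℝ) :
    AEMeasurable (quantile m) (volume.restrict (Ioo 0 1)) := by
  refine aemeasurable_restrict_of_monotoneOn measurableSet_Ioo fun u hu v hv huv => ?_
  rw [quantile_le_iff m hu]
  exact huv.trans ((quantile_le_iff m hv _).1 le_rfl)

theorem map_quantile (m : Measure ℝ) [IsProbabilityMeasure m] :
    (volume.restrict (Ioo (0 : ℝ) 1)).map (quantile m) = m := by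
  have : IsFiniteMeasure (volume.restrict (Ioo (0 : ℝ) 1)) := ⟨by simp⟩
  have : IsFiniteMeasure ((volume.restrict (Ioo (0 : ℝ) 1)).map (quantile m)) :=
    Measure.isFiniteMeasure_map _ _
  refine Measure.ext_of_Iic _ _ fun x => ?_
  set F := ProbabilityTheory.cdf m
  rw [Measure.map_apply_of_aemeasurable (aemeasurable_quantile m) measurableSet_Iic,
    ← ProbabilityTheory.ofReal_cdf, Measure.restrict_apply' measurableSet_Ioo]
  have hset : quantile m ⁻¹' Iic x ∩ Ioo 0 1 = Iic (F x) ∩ Ioo 0 1 := by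
    ext u
    simp only [mem_inter_iff, mem_preimage, mem_Iic]
    exact ⟨fun h => ⟨(quantile_le_iff m h.2 x).1 h.1, h.2⟩,
      fun h => ⟨(quantile_le_iff m h.2 x).2 h.1, h.2⟩⟩
  rw [hset]
  apply le_antisymm
  · refine (measure_mono (t := Ioc 0 (F x)) fun u hu => ⟨hu.2.1, hu.1⟩).trans ?_
    rw [Real.volume_Ioc, sub_zero]
  · have : Ioo 0 (F x) ⊆ Iic (F x) ∩ Ioo 0 1 := fun u hu =>
      ⟨hu.2.le, hu.1, hu.2.trans_le (ProbabilityTheory.cdf_le_one m x)⟩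
    refine le_trans ?_ (measure_mono this)
    rw [Real.volume_Ioo, sub_zero]

/-- Both sides measure the region between the graphs of the two distribution functions, sliced
horizontally on the left and vertically on the right; Tonelli exchanges the slicings. -/
theorem lintegral_abs_quantile_sub_le (m n : Measure ℝ) [IsProbabilityMeasure m]
    [IsProbabilityMeasure n] :
    ∫⁻ u in Ioo (0 : ℝ) 1, ENNReal.ofReal |quantile m u - quantile n u|
      ≤ ∫⁻ x, ENNReal.ofReal |m.real (Iic x) - n.real (Iic x)| := by
  simp_rw [← ProbabilityTheory.cdf_eq_real]
  set F := ProbabilityTheory.cdf m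
  set G := ProbabilityTheory.cdf n
  set A : Set (ℝ × ℝ) := {p | min (F p.2) (G p.2) < p.1 ∧ p.1 ≤ max (F p.2) (G p.2)}
  have hF : Measurable F := F.mono.measurable
  have hG : Measurable G := G.mono.measurable
  have hA : MeasurableSet A := by
    refine (measurableSet_lt ?_ measurable_fst).inter (measurableSet_le measurable_fst ?_)
    · exact (hF.comp measurable_snd).min (hG.comp measurable_snd)
    · exact (hF.comp measurable_snd).max (hG.comp measurable_snd)
  have h1 : ∫⁻ u in Ioo (0 : ℝ) 1, ENNReal.ofReal |quantile m u - quantile n u|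
      = ∫⁻ u in Ioo (0 : ℝ) 1, ∫⁻ x, A.indicator 1 (u, x) := by
    refine setLIntegral_congr_fun measurableSet_Ioo fun u hu => ?_
    have : ∀ x, A.indicator (1 : ℝ × ℝ → ℝ≥0∞) (u, x)
        = (Ico (min (quantile m u) (quantile n u)) (max (quantile m u) (quantile n u))).indicator
          1 x := by
      intro x
      have hmem : (u, x) ∈ A ↔
          x ∈ Ico (min (quantile m u) (quantile n u)) (max (quantile m u) (quantile n u)) := by
        have e1 := quantile_le_iff m hu x
        have e2 := quantile_le_iff n hu x
        simp only [A, mem_ofPred_eq, mem_Ico, min_lt_iff, le_max_iff, min_le_iff, lt_max_iff]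
        rw [e1, e2, ← not_le, ← not_le, ← not_le, ← not_le, e1, e2]
        tauto
      by_cases h : (u, x) ∈ A
      · rw [indicator_of_mem h, indicator_of_mem (hmem.1 h)]; rfl
      · rw [indicator_of_notMem h, indicator_of_notMem (fun h' => h (hmem.2 h'))]
    simp_rw [this]
    rw [lintegral_indicator_one measurableSet_Ico, Real.volume_Ico, max_sub_min_eq_abs']
  rw [h1, lintegral_lintegral_swap
    (f := fun u x : ℝ => A.indicator (1 : ℝ × ℝ → ℝ≥0∞) (u, x))
    ((measurable_one.indicator hA).aemeasurable)]
  refine lintegral_mono fun x => ?_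
  have : ∀ u, A.indicator (1 : ℝ × ℝ → ℝ≥0∞) (u, x)
      = (Ioc (min (F x) (G x)) (max (F x) (G x))).indicator 1 u := fun u => rfl
  simp_rw [this]
  rw [lintegral_indicator_one measurableSet_Ioc]
  refine (Measure.restrict_apply_le _ _).trans ?_
  rw [Real.volume_Ioc, max_sub_min_eq_abs']

/-! ### Transport on the circle and the sawtooth potential -/

/-- The representative in `(0, 2π]` of a point of the torus. -/
noncomputable def saw (t : Torus) : ℝ := AddCircle.equivIoc (2 * Real.pi) 0 t

theorem measurable_saw : Measurable saw :=
  measurable_subtype_coe.comp (AddCircle.measurableEquivIoc (2 * Real.pi) 0).measurable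

theorem saw_mem (t : Torus) : saw t ∈ Ioc 0 (2 * Real.pi) := by
  have := (AddCircle.equivIoc (2 * Real.pi) 0 t).2
  exact ⟨this.1, this.2.trans_eq (zero_add _)⟩

theorem coe_saw (t : Torus) : ((saw t : ℝ) : Torus) = t := AddCircle.coe_equivIoc

theorem saw_coe {x : ℝ} (hx : x ∈ Ioc 0 (2 * Real.pi)) : saw (x : Torus) = x :=
  AddCircle.equivIoc_coe_of_mem (by rwa [zero_add])

/-- Moving the cut by y lowers the sawtooth by y, up to a jump 2π on the arc passed over. After
integration this jump becomes a distribution function. -/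
theorem saw_sub {y : ℝ} (hy : y ∈ Ioc 0 (2 * Real.pi)) (t : Torus) :
    saw (t - y) = saw t - y + 2 * Real.pi * (if saw t ≤ y then 1 else 0) := by
  have h := saw_mem t
  split_ifs with hle
  · rw [mul_one, ← saw_coe (x := saw t - y + 2 * Real.pi)]
    · congr 1
      rw [AddCircle.coe_add, AddCircle.coe_sub, coe_saw, AddCircle.coe_period, add_zero]
    · constructor <;> linarith [h.1, h.2, hy.1, hy.2]
  · rw [mul_zero, add_zero, ← saw_coe (x := saw t - y)]
    · rw [AddCircle.coe_sub, coe_saw]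
    · constructor <;> linarith [h.1, h.2, hy.1, hy.2]

theorem chord_coe_le (x y : ℝ) : chord (x : Torus) (y : Torus) ≤ |x - y| := by
  rw [chord_coe_eq_sin]
  have := Real.abs_sin_le_abs (x := (x - y) / 2)
  rw [abs_div, abs_two] at this
  linarith

theorem chord_add_right (x y a : Torus) : chord (x + a) (y + a) = chord x y := by
  rw [chord_eq_chordNorm, chord_eq_chordNorm, add_sub_add_right_eq_sub]

theorem continuous_chord : Continuous fun p : Torus × Torus => chord p.1 p.2 := by
  simp_rw [chord_eq_chordNorm]
  exact continuous_chordNorm.comp (continuous_fst.sub continuous_snd)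

/-- Cut the circle at a, couple the two images on the line by their quantiles, and wrap back; a
chord is no longer than the corresponding segment. -/
theorem wasserstein_le_lintegral_cdf (μ ν : Measure Torus) [IsProbabilityMeasure μ]
    [IsProbabilityMeasure ν] (a : Torus) :
    wasserstein μ ν ≤ ∫⁻ x, ENNReal.ofReal
      |μ.real {t | saw (t - a) ≤ x} - ν.real {t | saw (t - a) ≤ x}| := by
  set f : Torus → ℝ := fun t => saw (t - a)
  have hf : Measurable f := measurable_saw.comp (measurable_id.sub_const a)
  set e : ℝ → Torus := fun x => (x : Torus) + a
  have he : Measurable e := AddCircle.measurable_mk'.add_const a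
  have hef : ∀ μ : Measure Torus, (μ.map f).map e = μ := by
    intro μ
    rw [Measure.map_map he hf]
    have : e ∘ f = id := by
      funext t
      simp only [e, f, Function.comp_apply, coe_saw, sub_add_cancel, id]
    rw [this, Measure.map_id]
  have : IsProbabilityMeasure (μ.map f) := Measure.isProbabilityMeasure_map hf.aemeasurable
  have : IsProbabilityMeasure (ν.map f) := Measure.isProbabilityMeasure_map hf.aemeasurable
  set m := μ.map f
  set n := ν.map f
  have hqm := aemeasurable_quantile m
  have hqn := aemeasurable_quantile n
  have hpair : AEMeasurable (fun u => (e (quantile m u), e (quantile n u)))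
      (volume.restrict (Ioo (0 : ℝ) 1)) := (he.comp_aemeasurable hqm).prodMk (he.comp_aemeasurable hqn)
  set π := (volume.restrict (Ioo (0 : ℝ) 1)).map (fun u => (e (quantile m u), e (quantile n u)))
  have hπ : π.map Prod.fst = μ ∧ π.map Prod.snd = ν := by
    constructor
    · rw [AEMeasurable.map_map_of_aemeasurable measurable_fst.aemeasurable hpair]
      refine Eq.trans ?_ (hef μ)
      rw [← map_quantile (μ.map f)]
      exact (AEMeasurable.map_map_of_aemeasurable he.aemeasurable hqm).symm
    · rw [AEMeasurable.map_map_of_aemeasurable measurable_snd.aemeasurable hpair]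
      refine Eq.trans ?_ (hef ν)
      rw [← map_quantile (ν.map f)]
      exact (AEMeasurable.map_map_of_aemeasurable he.aemeasurable hqn).symm
  refine (iInf₂_le π hπ).trans ?_
  rw [lintegral_map' continuous_chord.measurable.ennreal_ofReal.aemeasurable hpair]
  have h1 : ∀ u, ENNReal.ofReal (chord (e (quantile m u)) (e (quantile n u)))
      ≤ ENNReal.ofReal |quantile m u - quantile n u| := fun u => by
    rw [chord_add_right]
    exact ENNReal.ofReal_le_ofReal (chord_coe_le _ _)
  refine (lintegral_mono h1).trans ((lintegral_abs_quantile_sub_le m n).trans_eq ?_)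
  refine lintegral_congr fun x => ?_
  rw [map_measureReal_apply hf measurableSet_Iic, map_measureReal_apply hf measurableSet_Iic]
  rfl

/-- The difference of the sawtooth potentials of two measures. -/
noncomputable def sawDiff (μ ν : Measure Torus) (a : Torus) : ℝ :=
  ∫ t, saw (t - a) ∂μ - ∫ t, saw (t - a) ∂ν

theorem integrable_saw_sub (μ : Measure Torus) [IsFiniteMeasure μ] (a : Torus) :
    Integrable (fun t => saw (t - a)) μ :=
  .of_bound (measurable_saw.comp (measurable_id.sub_const a)).aestronglyMeasurable (2 * Real.pi)
    (.of_forall fun t => by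
      rw [Real.norm_of_nonneg (saw_mem _).1.le]; exact (saw_mem _).2)

theorem integral_saw_sub_add (μ : Measure Torus) [IsProbabilityMeasure μ] (a : Torus) {y : ℝ}
    (hy : y ∈ Ioc 0 (2 * Real.pi)) :
    ∫ t, saw (t - (y + a)) ∂μ
      = ∫ t, saw (t - a) ∂μ - y + 2 * Real.pi * μ.real {t | saw (t - a) ≤ y} := by
  have h : ∀ t, saw (t - (y + a)) = saw (t - a) - y
      + 2 * Real.pi * ({t | saw (t - a) ≤ y}.indicator (fun _ => (1 : ℝ)) t) := by
    intro t
    rw [show t - ((y : Torus) + a) = t - a - (y : Torus) by abel, saw_sub hy (t - a)]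
    simp only [indicator_apply, mem_ofPred_eq]
  have hA : MeasurableSet {t | saw (t - a) ≤ y} :=
    measurableSet_le (measurable_saw.comp (measurable_id.sub_const a)) measurable_const
  have hi : Integrable (fun t => saw (t - a) - y) μ :=
    (integrable_saw_sub μ a).sub (integrable_const y)
  simp_rw [h]
  rw [integral_add hi ((((integrable_const (1 : ℝ)).indicator hA)).const_mul _),
    integral_sub (integrable_saw_sub μ a) (integrable_const y), integral_const_mul,
    integral_indicator_const _ hA, integral_const, probReal_univ]
  simp

/-- By `integral_saw_sub_add`, an increment of `sawDiff` from the cut a is 2π times the difference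
of the distribution functions; the linear terms cancel since both masses are 1. The factor 2π
absorbs the normalisation of `unif`. -/
theorem wasserstein_le_lintegral_sawDiff (μ ν : Measure Torus) [IsProbabilityMeasure μ]
    [IsProbabilityMeasure ν] (a : Torus) :
    wasserstein μ ν ≤ ∫⁻ t, ENNReal.ofReal |sawDiff μ ν t - sawDiff μ ν a| ∂unif := by
  have htr := lintegral_add_right_eq_self (μ := (unif : Measure Torus))
    (fun t => ENNReal.ofReal |sawDiff μ ν t - sawDiff μ ν a|) a
  rw [← htr, lintegral_unif _ 0, zero_add, ← lintegral_const_mul' _ _ ENNReal.ofReal_ne_top]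
  refine (wasserstein_le_lintegral_cdf μ ν a).trans ?_
  have hpi := Real.pi_pos
  rw [← lintegral_indicator measurableSet_Ioc]
  refine lintegral_mono fun x => ?_
  by_cases hx : x ∈ Ioc 0 (2 * Real.pi)
  · rw [indicator_of_mem hx, ← ENNReal.ofReal_mul (by positivity)]
    apply ENNReal.ofReal_le_ofReal
    have h1 := integral_saw_sub_add μ a hx
    have h2 := integral_saw_sub_add ν a hx
    have h3 : sawDiff μ ν (x + a) - sawDiff μ ν a
        = 2 * Real.pi * (μ.real {t | saw (t - a) ≤ x} - ν.real {t | saw (t - a) ≤ x}) := by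
      rw [sawDiff, h1, h2, sawDiff]; ring
    rw [h3, abs_mul, abs_of_pos Real.two_pi_pos, inv_mul_cancel_left₀ Real.two_pi_pos.ne']
  -- Outside (0, 2π] both distribution functions are 0 or both are 1.
  · rw [indicator_of_notMem hx]
    have : {t : Torus | saw (t - a) ≤ x} = ∅ ∨ {t : Torus | saw (t - a) ≤ x} = univ := by
      rcases le_or_gt x 0 with h | h
      · left
        exact eq_empty_of_forall_notMem fun t ht => absurd (saw_mem (t - a)).1
          (not_lt.2 (le_trans ht h))
      · right
        refine eq_univ_of_forall fun t => (saw_mem (t - a)).2.trans ?_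
        by_contra h'
        exact hx ⟨h, (not_le.1 h').le⟩
    rcases this with h | h <;> simp [h]

/-! ### Parseval and the negative Sobolev bound -/

theorem norm_fourier_apply (k : ℤ) (t : Torus) : ‖fourier k t‖ = 1 := by
  rw [fourier_apply, Circle.norm_coe]

theorem integrable_sub_mul {f w : Torus → ℝ} (hf : Measurable f) (hfi : Integrable f unif)
    {μ : Measure Torus} [IsFiniteMeasure μ] (hw : Integrable w μ) :
    Integrable (fun p : Torus × Torus => f (p.2 - p.1) * w p.2) (unif.prod μ) := by
  have hmeas : AEStronglyMeasurable (fun p : Torus × Torus => f (p.2 - p.1) * w p.2)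
      (unif.prod μ) := by
    have h1 : AEStronglyMeasurable (fun p : Torus × Torus => f (p.2 - p.1)) (unif.prod μ) :=
      (hf.comp (measurable_snd.sub measurable_fst)).aestronglyMeasurable
    exact h1.mul hw.1.comp_snd
  have hslice : ∀ t, Integrable (fun a => f (t - a) * w t) unif := fun t =>
    (hfi.comp_sub_left t).mul_const _
  refine (integrable_prod_iff' hmeas).2 ⟨Filter.Eventually.of_forall hslice, ?_⟩
  have : ∀ t, ∫ a, ‖f (t - a) * w t‖ ∂unif = (∫ a, ‖f a‖ ∂unif) * ‖w t‖ := by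
    intro t
    simp_rw [norm_mul]
    rw [integral_mul_const, integral_sub_left_eq_self (fun a => ‖f a‖)]
  simp_rw [this]
  exact hw.norm.const_mul _

/-- The convolution theorem, for the reflected kernel, which is why f enters through its coefficient
at -k. It serves the sawtooth against a measure, the logarithmic kernel against a density, and the
sawtooth against a weak derivative. -/
theorem fourierCoeff_sub_mul {f w : Torus → ℝ} (hf : Measurable f) (hfi : Integrable f unif)
    {μ : Measure Torus} [IsFiniteMeasure μ] (hw : Integrable w μ) (k : ℤ) :
    ∫ a, fourier (-k) a * ((∫ t, f (t - a) * w t ∂μ : ℝ) : ℂ) ∂unif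
      = (∫ b, fourier k b * (f b : ℂ) ∂unif) * ∫ t, fourier (-k) t * (w t : ℂ) ∂μ := by
  have h1 : ∀ a, fourier (-k) a * ((∫ t, f (t - a) * w t ∂μ : ℝ) : ℂ)
      = ∫ t, fourier (-k) a * ((f (t - a) * w t : ℝ) : ℂ) ∂μ := by
    intro a
    rw [integral_const_mul, integral_complex_ofReal]
  have hint : Integrable (Function.uncurry fun a t : Torus =>
      fourier (-k) a * ((f (t - a) * w t : ℝ) : ℂ)) (unif.prod μ) := by
    refine (integrable_sub_mul hf hfi hw).ofReal.bdd_mul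
      ((fourier (-k)).continuous.comp continuous_fst).aestronglyMeasurable
      (c := 1) (.of_forall fun p => (norm_fourier_apply _ _).le)
  simp_rw [h1]
  rw [integral_integral_swap hint, ← integral_const_mul]
  refine integral_congr_ae (.of_forall fun t => ?_)
  dsimp only
  have h2 : ∀ a, fourier (-k) a * ((f (t - a) * w t : ℝ) : ℂ)
      = (fun b => fourier k b * (f b : ℂ) * (fourier (-k) t * (w t : ℂ))) (t - a) := by
    intro a
    have : fourier (-k) a = fourier k (t - a) * fourier (-k) t := by
      rw [fourier_apply, fourier_apply, fourier_apply, ← Circle.coe_mul, ← AddCircle.toCircle_add]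
      congr 2
      rw [smul_sub, neg_smul, neg_smul]
      abel
    rw [this]
    push_cast
    ring
  simp_rw [h2]
  rw [integral_sub_left_eq_self (fun b => fourier k b * (f b : ℂ) * (fourier (-k) t * (w t : ℂ))),
    integral_mul_const]

theorem hasSum_sq_fourier {f : Torus → ℝ} (hf : MemLp f 2 unif) :
    HasSum (fun k : ℤ => ‖∫ t, fourier (-k) t * (f t : ℂ) ∂unif‖ ^ 2) (∫ t, f t ^ 2 ∂unif) := by
  have hf' : MemLp (fun t => (f t : ℂ)) 2 unif := hf.ofReal
  set g : Lp ℂ 2 (unif : Measure Torus) := hf'.toLp _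
  have h := hasSum_sq_fourierCoeff (T := 2 * Real.pi) g
  have e1 : ∀ k, fourierCoeff g k
      = ∫ t, fourier (-k) t * (f t : ℂ) ∂unif := by
    intro k
    rw [fourierCoeff_congr_ae hf'.coeFn_toLp]
    rfl
  have e2 : ∫ t, ‖g t‖ ^ 2 ∂unif = ∫ t, f t ^ 2 ∂unif := by
    refine integral_congr_ae ?_
    filter_upwards [hf'.coeFn_toLp] with t ht
    rw [ht]
    simp
  rw [e2] at h
  simpa only [e1] using h

theorem integrable_saw : Integrable saw unif := by
  simpa using integrable_saw_sub unif 0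

theorem integral_fourier_saw {k : ℤ} (hk : k ≠ 0) :
    ∫ t, fourier (-k) t * (saw t : ℂ) ∂unif = Complex.I / k := by
  have hpi := Real.pi_pos
  have hlt : (0 : ℝ) < 0 + 2 * Real.pi := by linarith
  have h1 : ∫ t, fourier (-k) t * (saw t : ℂ) ∂unif
      = fourierCoeff (AddCircle.liftIoc (2 * Real.pi) 0 (fun x : ℝ => (x : ℂ))) k := by
    rw [fourierCoeff]
    refine integral_congr_ae (.of_forall fun t => ?_)
    rfl
  rw [h1, fourierCoeff_liftIoc_eq,
    fourierCoeffOn_of_hasDerivAt (f := fun x : ℝ => (x : ℂ)) _ hk (fun x _ => Complex.ofRealCLM.hasDerivAt (x := x))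
    intervalIntegrable_const]
  -- After one integration by parts only a coefficient of the constant 1 is left; a second one shows
  -- that it vanishes.
  have h2 := fourierCoeffOn_of_hasDerivAt (a := (0 : ℝ)) (b := 0 + 2 * Real.pi) hlt hk
    (f := fun _ => Complex.ofRealCLM 1)
    (f' := fun _ => 0) (fun x _ => hasDerivAt_const _ _) intervalIntegrable_const
  have h3 : fourierCoeffOn hlt (fun _ : ℝ => (0 : ℂ)) k = 0 := by
    rw [fourierCoeffOn_eq_integral]; simp
  rw [h3, mul_zero, sub_self, mul_zero, sub_zero, mul_zero] at h2
  rw [h2]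
  have hkc : (k : ℂ) ≠ 0 := by exact_mod_cast hk
  have hpc : (Real.pi : ℂ) ≠ 0 := by exact_mod_cast hpi.ne'
  rw [QuotientAddGroup.mk_zero, fourier_eval_zero]
  push_cast
  field_simp
  rw [Complex.I_sq]
  ring

theorem measurable_integral_saw (μ : Measure Torus) [IsFiniteMeasure μ] :
    Measurable fun a => ∫ t, saw (t - a) ∂μ := by
  have : StronglyMeasurable (Function.uncurry fun a t : Torus => saw (t - a)) :=
    (measurable_saw.comp (measurable_snd.sub measurable_fst)).stronglyMeasurable
  exact this.integral_prod_right.measurable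

theorem measurable_sawDiff (μ ν : Measure Torus) [IsFiniteMeasure μ] [IsFiniteMeasure ν] :
    Measurable (sawDiff μ ν) := (measurable_integral_saw μ).sub (measurable_integral_saw ν)

theorem abs_sawDiff_le (μ ν : Measure Torus) [IsProbabilityMeasure μ] [IsProbabilityMeasure ν]
    (a : Torus) : |sawDiff μ ν a| ≤ 2 * Real.pi := by
  have h : ∀ μ : Measure Torus, IsProbabilityMeasure μ →
      ∫ t, saw (t - a) ∂μ ∈ Icc 0 (2 * Real.pi) := by
    intro μ hμ
    refine ⟨integral_nonneg fun t => (saw_mem _).1.le, ?_⟩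
    have := integral_mono (integrable_saw_sub μ a) (integrable_const (2 * Real.pi))
      (fun t => (saw_mem _).2)
    simpa using this
  have h1 := h μ inferInstance
  have h2 := h ν inferInstance
  rw [sawDiff, abs_le]
  constructor <;> linarith [h1.1, h1.2, h2.1, h2.2]

theorem norm_integral_fourier_sub (μ ν : Measure Torus) [IsFiniteMeasure μ] [IsFiniteMeasure ν]
    (k : ℤ) :
    ‖∫ t, fourier (-k) t ∂μ - ∫ t, fourier (-k) t ∂ν‖
      = ‖moment μ k.natAbs - moment ν k.natAbs‖ := by
  have hpow : ∀ (n : ℕ) (t : Torus), fourier (n : ℤ) t = (AddCircle.toCircle t : ℂ) ^ n := by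
    intro n t
    rw [fourier_apply, natCast_zsmul, AddCircle.toCircle_nsmul, Circle.coe_pow]
  obtain ⟨n, rfl | rfl⟩ := k.eq_nat_or_neg
  · have : ∀ t : Torus, fourier (-(n : ℤ)) t
        = (starRingEnd ℂ) ((AddCircle.toCircle t : ℂ) ^ n) := by
      intro t; rw [fourier_neg, hpow]
    simp_rw [this]
    rw [integral_conj, integral_conj, ← map_sub, RCLike.norm_conj, Int.natAbs_natCast]
    rfl
  · simp_rw [neg_neg, hpow, Int.natAbs_neg, Int.natAbs_natCast]
    rfl

theorem norm_fourier_sawDiff (μ ν : Measure Torus) [IsProbabilityMeasure μ]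
    [IsProbabilityMeasure ν] {k : ℤ} (hk : k ≠ 0) :
    ‖∫ t, fourier (-k) t * (sawDiff μ ν t : ℂ) ∂unif‖ ^ 2
      = ‖moment μ k.natAbs - moment ν k.natAbs‖ ^ 2 / (k.natAbs : ℝ) ^ 2 := by
  have hint : ∀ μ : Measure Torus, IsFiniteMeasure μ → Integrable (fun a => fourier (-k) a *
      ((∫ t, saw (t - a) ∂μ : ℝ) : ℂ)) unif := by
    intro μ _
    have : Integrable (fun a => ∫ t, saw (t - a) ∂μ) unif := by
      have h := (integrable_sub_mul measurable_saw integrable_saw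
        (integrable_const (μ := μ) (1 : ℝ))).integral_prod_left
      simpa using h
    exact this.ofReal.bdd_mul (fourier (-k)).continuous.aestronglyMeasurable (c := 1)
      (.of_forall fun t => (norm_fourier_apply _ _).le)
  have hco : ∀ μ : Measure Torus, IsFiniteMeasure μ → ∫ a, fourier (-k) a *
      ((∫ t, saw (t - a) ∂μ : ℝ) : ℂ) ∂unif = -(Complex.I / k) * ∫ t, fourier (-k) t ∂μ := by
    intro μ _
    have h := fourierCoeff_sub_mul measurable_saw integrable_saw
      (integrable_const (μ := μ) (1 : ℝ)) k
    have h2 := integral_fourier_saw (neg_ne_zero.2 hk)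
    rw [neg_neg] at h2
    rw [h2] at h
    simp only [mul_one, Complex.ofReal_one] at h
    rw [h]
    push_cast
    rw [div_neg]
  have h : ∫ t, fourier (-k) t * (sawDiff μ ν t : ℂ) ∂unif
      = -(Complex.I / k) * (∫ t, fourier (-k) t ∂μ - ∫ t, fourier (-k) t ∂ν) := by
    rw [mul_sub, ← hco μ inferInstance, ← hco ν inferInstance,
      ← integral_sub (hint μ inferInstance) (hint ν inferInstance)]
    refine integral_congr_ae (.of_forall fun t => ?_)
    dsimp only
    rw [sawDiff]; push_cast; ring
  rw [h, norm_mul, norm_integral_fourier_sub, norm_neg, norm_div, Complex.norm_I, mul_pow,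
    Complex.norm_intCast, div_pow, one_pow, Nat.cast_natAbs, Int.cast_abs]
  ring

theorem memLp_sawDiff (μ ν : Measure Torus) [IsProbabilityMeasure μ] [IsProbabilityMeasure ν] :
    MemLp (sawDiff μ ν) 2 unif :=
  .of_bound (measurable_sawDiff μ ν).aestronglyMeasurable (2 * Real.pi)
    (.of_forall fun a => abs_sawDiff_le μ ν a)

/-- Parseval for `sawDiff`, whose coefficients are the moment differences divided by k up to a
unimodular factor. The frequencies ±n are paired, and removing k = 0 leaves the variance. -/
theorem hasSum_moment_sub_div (μ ν : Measure Torus) [IsProbabilityMeasure μ]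
    [IsProbabilityMeasure ν] :
    HasSum (fun n : ℕ => 2 * (‖moment μ n - moment ν n‖ ^ 2 / (n : ℝ) ^ 2))
      (∫ t, sawDiff μ ν t ^ 2 ∂unif - (∫ t, sawDiff μ ν t ∂unif) ^ 2) := by
  have h0 := (hasSum_sq_fourier (memLp_sawDiff μ ν)).nat_add_neg
  set f : ℤ → ℝ := fun k => ‖∫ t, fourier (-k) t * (sawDiff μ ν t : ℂ) ∂unif‖ ^ 2
  have hf0 : f 0 = (∫ t, sawDiff μ ν t ∂unif) ^ 2 := by
    simp only [f, neg_zero, fourier_zero, one_mul]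
    rw [integral_complex_ofReal, Complex.norm_real, Real.norm_eq_abs, sq_abs]
  change HasSum (fun n : ℕ => f n + f (-n)) (∫ t, sawDiff μ ν t ^ 2 ∂unif + f 0) at h0
  have h1 := h0.sub (hasSum_ite_eq (0 : ℕ) (2 * f 0))
  have e : ∫ t, sawDiff μ ν t ^ 2 ∂unif - (∫ t, sawDiff μ ν t ∂unif) ^ 2
      = ∫ t, sawDiff μ ν t ^ 2 ∂unif + f 0 - 2 * f 0 := by rw [hf0]; ring
  rw [e]
  convert! h1 using 2 with n
  rcases Nat.eq_zero_or_pos n with rfl | hn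
  · simp only [Nat.cast_zero, neg_zero, if_true]
    rw [zero_pow two_ne_zero, div_zero]
    ring
  · rw [if_neg hn.ne', sub_zero, two_mul]
    have hn' : (n : ℤ) ≠ 0 := by exact_mod_cast hn.ne'
    congr 1
    · exact (norm_fourier_sawDiff μ ν hn').symm
    · have := norm_fourier_sawDiff μ ν (neg_ne_zero.2 hn')
      rw [Int.natAbs_neg] at this
      exact this.symm

theorem sq_integral_abs_le {α : Type*} [MeasurableSpace α] {μ : Measure α}
    [IsProbabilityMeasure μ] {f : α → ℝ} (hf : MemLp f 2 μ) :
    (∫ x, |f x| ∂μ) ^ 2 ≤ ∫ x, f x ^ 2 ∂μ := by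
  set c := ∫ x, |f x| ∂μ
  have hi : Integrable (fun x => |f x|) μ := (hf.integrable one_le_two).abs
  have h := integral_mono (hi.const_mul (2 * c)) (hf.integrable_sq.add (integrable_const (c ^ 2)))
    (fun x => show 2 * c * |f x| ≤ f x ^ 2 + c ^ 2 by
      nlinarith [sq_nonneg (|f x| - c), sq_abs (f x)])
  rw [integral_const_mul] at h
  have h2 : ∫ x, (f x ^ 2 + c ^ 2) ∂μ = ∫ x, f x ^ 2 ∂μ + c ^ 2 := by
    rw [integral_add hf.integrable_sq (integrable_const _)]; simp
  have h3 : 2 * c * c ≤ ∫ x, f x ^ 2 ∂μ + c ^ 2 := h.trans_eq h2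
  linarith

/-- The transport distance is controlled by the negative Sobolev norm of order one. -/
theorem wasserstein_le_sqrt (μ ν : Measure Torus) [IsProbabilityMeasure μ]
    [IsProbabilityMeasure ν] :
    wasserstein μ ν ≤ ENNReal.ofReal
      (Real.sqrt (4 * ∑' n : ℕ, ‖moment μ n - moment ν n‖ ^ 2 / (n : ℝ) ^ 2)) := by
  set h := sawDiff μ ν
  have hm : Measurable h := measurable_sawDiff μ ν
  set F : Torus × Torus → ℝ := fun p => h p.2 - h p.1
  have hFm : Measurable F := (hm.comp measurable_snd).sub (hm.comp measurable_fst)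
  have hF : MemLp F 2 ((unif : Measure Torus).prod unif) :=
    .of_bound hFm.aestronglyMeasurable
      (4 * Real.pi) (.of_forall fun p => by
        have h1 := abs_sawDiff_le μ ν p.1
        have h2 := abs_sawDiff_le μ ν p.2
        refine (abs_sub _ _).trans ?_
        linarith)
  -- The bound holds for every cut point a, hence also for its average over a.
  have h1 : wasserstein μ ν ≤ ENNReal.ofReal (∫ p, |F p| ∂((unif : Measure Torus).prod unif)) := by
    rw [ofReal_integral_eq_lintegral_ofReal (hF.integrable one_le_two).abs
      (.of_forall fun p => abs_nonneg _), lintegral_prod _ hFm.abs.ennreal_ofReal.aemeasurable]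
    have h2 := lintegral_mono (μ := (unif : Measure Torus))
      (fun a => wasserstein_le_lintegral_sawDiff μ ν a)
    rwa [lintegral_const, measure_univ, mul_one] at h2
  -- By Cauchy-Schwarz it suffices to compute ∬ (h(t) - h(a))², which is twice the variance of h,
  -- hence 4 Σ.
  refine h1.trans (ENNReal.ofReal_le_ofReal (Real.le_sqrt_of_sq_le ?_))
  refine (sq_integral_abs_le hF).trans_eq ?_
  have hs := (hasSum_moment_sub_div μ ν).tsum_eq
  rw [tsum_mul_left] at hs
  have hL := memLp_sawDiff μ ν
  have hi : Integrable h unif := hL.integrable one_le_two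
  have hi2 : Integrable (fun t => h t ^ 2) unif := hL.integrable_sq
  have e : ∀ p : Torus × Torus, F p ^ 2 = h p.2 ^ 2 + h p.1 ^ 2 - 2 * (h p.1 * h p.2) := by
    intro p; simp only [F]; ring
  simp_rw [e]
  have hadd : Integrable (fun p : Torus × Torus => h p.2 ^ 2 + h p.1 ^ 2)
      ((unif : Measure Torus).prod unif) := (hi2.comp_snd unif).add (hi2.comp_fst unif)
  rw [integral_sub hadd ((hi.mul_prod hi).const_mul 2),
    integral_add (hi2.comp_snd unif) (hi2.comp_fst unif), integral_const_mul, integral_prod_mul,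
    integral_fun_fst (fun t => h t ^ 2), integral_fun_snd (fun t => h t ^ 2)]
  simp only [probReal_univ, one_smul]
  linarith

/-! ### Potentials of measures with bounded density -/

/-- The logarithmic potential of a measure. -/
noncomputable def potential (μ : Measure Torus) (x : Torus) : ℝ := ∫ y, logKer (x - y) ∂μ

/-- The energy of a measure for the kernel `logKer`, as an iterated integral. -/
noncomputable def potentialEnergy (μ : Measure Torus) : ℝ := ∫ x, potential μ x ∂μ

section Potential

variable {M : ℝ} {μ : Measure Torus} (hμ : μ ≤ ENNReal.ofReal M • unif)

include hμ

theorem ae_ne_of_le (x : Torus) : ∀ᵐ y ∂μ, y ≠ x :=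
  ((Measure.absolutelyContinuous_of_le hμ).trans Measure.smul_absolutelyContinuous).ae_le
    (ae_ne_unif x)

theorem integrable_logKer_sub [IsFiniteMeasure μ] (x : Torus) :
    Integrable (fun y => logKer (x - y)) μ := by
  refine (((integrable_chordNorm_sub hμ x).const_mul 2).add
    (integrable_const (Real.log 2))).mono'
    (measurable_logKer.comp (measurable_const.sub measurable_id)).aestronglyMeasurable
    (.of_forall fun t => ?_)
  exact abs_logKer_le _

omit hμ in
theorem measurable_potential [IsFiniteMeasure μ] : Measurable (potential μ) := by
  have : StronglyMeasurable (Function.uncurry fun x y : Torus => logKer (x - y)) :=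
    (measurable_logKer.comp (measurable_fst.sub measurable_snd)).stronglyMeasurable
  exact this.integral_prod_right.measurable

theorem abs_potential_le (hM : 0 ≤ M) [IsProbabilityMeasure μ] (x : Torus) :
    |potential μ x| ≤ 4 * M + Real.log 2 := by
  have hi := (integrable_chordNorm_sub hμ x).const_mul 2
  refine (norm_integral_le_of_norm_le (f := fun y => logKer (x - y))
    (hi.add (integrable_const (Real.log 2)))
    (.of_forall fun t => abs_logKer_le (x - t))).trans ?_
  have h2 : ∫ y, (2 * chordNorm (x - y) ^ (-(1 / 2) : ℝ) + Real.log 2) ∂μ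
      = 2 * ∫ y, chordNorm (x - y) ^ (-(1 / 2) : ℝ) ∂μ + Real.log 2 := by
    rw [integral_add hi (integrable_const _), integral_const_mul]; simp
  refine h2.le.trans ?_
  have := integral_chordNorm_sub_le hM hμ x
  linarith

theorem neg_log_two_le_potential [IsProbabilityMeasure μ] (x : Torus) :
    -Real.log 2 ≤ potential μ x := by
  have := integral_mono (integrable_const (-Real.log 2)) (integrable_logKer_sub hμ x)
    (fun y => neg_log_two_le_logKer _)
  rwa [integral_const, probReal_univ, one_smul] at this

theorem integrable_potential (hM : 0 ≤ M) [IsProbabilityMeasure μ] (ν : Measure Torus)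
    [IsFiniteMeasure ν] : Integrable (potential μ) ν :=
  .of_bound measurable_potential.aestronglyMeasurable (4 * M + Real.log 2)
    (.of_forall fun x => abs_potential_le hμ hM x)

theorem neg_log_two_le_potentialEnergy (hM : 0 ≤ M) [IsProbabilityMeasure μ] :
    -Real.log 2 ≤ potentialEnergy μ := by
  have := integral_mono (integrable_const (-Real.log 2)) (integrable_potential hμ hM μ)
    (fun y => neg_log_two_le_potential hμ y)
  rwa [integral_const, probReal_univ, one_smul] at this

omit hμ in
theorem integrable_abelKer_sub {ρ : ℝ} (h0 : 0 ≤ ρ) (h1 : ρ < 1) [IsFiniteMeasure μ]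
    (x : Torus) : Integrable (fun y => abelKer ρ (x - y)) μ :=
  ((continuous_abelKer h0 h1).comp (continuous_const.sub
    continuous_id)).integrable_of_hasCompactSupport (HasCompactSupport.of_compactSpace _)

/-- The singular error of `logKer_le` is integrated against μ; the density bound gives 2√(1 - ρ) ·
2M. -/
theorem potential_le_abel {ρ : ℝ} (h0 : 0 < ρ) (h1 : ρ < 1) (hM : 0 ≤ M) [IsFiniteMeasure μ]
    (x : Torus) :
    potential μ x ≤ ∫ y, abelKer ρ (x - y) ∂μ + 4 * M * Real.sqrt (1 - ρ) := by
  have hi1 := integrable_abelKer_sub (μ := μ) h0.le h1 x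
  have hi2 := (integrable_chordNorm_sub hμ x).const_mul (2 * Real.sqrt (1 - ρ))
  have h : potential μ x ≤ ∫ y, (abelKer ρ (x - y)
      + 2 * Real.sqrt (1 - ρ) * chordNorm (x - y) ^ (-(1 / 2) : ℝ)) ∂μ := by
    refine integral_mono_ae (integrable_logKer_sub hμ x) (hi1.add hi2) ?_
    filter_upwards [ae_ne_of_le hμ x] with y hy
    exact logKer_le h0 h1 (sub_ne_zero.2 hy.symm)
  rw [integral_add hi1 hi2, integral_const_mul] at h
  have := integral_chordNorm_sub_le hM hμ x
  have hs := Real.sqrt_nonneg (1 - ρ)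
  nlinarith

theorem abel_le_potential {ρ : ℝ} (h0 : 0 < ρ) (h1 : ρ < 1) [IsProbabilityMeasure μ]
    (x : Torus) :
    ∫ y, abelKer ρ (x - y) ∂μ ≤ potential μ x - 1 / 2 * Real.log ρ := by
  have h : ∫ y, abelKer ρ (x - y) ∂μ ≤ ∫ y, (logKer (x - y) - 1 / 2 * Real.log ρ) ∂μ := by
    refine integral_mono_ae (integrable_abelKer_sub h0.le h1 x)
      ((integrable_logKer_sub hμ x).sub (integrable_const _)) ?_
    filter_upwards [ae_ne_of_le hμ x] with y hy
    exact abelKer_le h0 (sub_ne_zero.2 hy.symm)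
  rw [integral_sub (integrable_logKer_sub hμ x) (integrable_const _), integral_const,
    probReal_univ, one_smul] at h
  exact h

omit hμ in
theorem integrable_abelKer_prod {ρ : ℝ} (h0 : 0 ≤ ρ) (h1 : ρ < 1) (μ ν : Measure Torus)
    [IsFiniteMeasure μ] [IsFiniteMeasure ν] :
    Integrable (fun p : Torus × Torus => abelKer ρ (p.1 - p.2)) (μ.prod ν) :=
  ((continuous_abelKer h0 h1).comp (continuous_fst.sub
    continuous_snd)).integrable_of_hasCompactSupport (HasCompactSupport.of_compactSpace _)

omit hμ in
theorem abelEnergy_eq {ρ : ℝ} (h0 : 0 ≤ ρ) (h1 : ρ < 1) (μ ν : Measure Torus)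
    [IsFiniteMeasure μ] [IsFiniteMeasure ν] :
    abelEnergy ρ μ ν = ∫ x, ∫ y, abelKer ρ (x - y) ∂ν ∂μ :=
  integral_prod _ (integrable_abelKer_prod h0 h1 μ ν)

theorem abelEnergy_le_potentialEnergy {ρ : ℝ} (h0 : 0 < ρ) (h1 : ρ < 1) (hM : 0 ≤ M)
    [IsProbabilityMeasure μ] :
    abelEnergy ρ μ μ ≤ potentialEnergy μ - 1 / 2 * Real.log ρ := by
  rw [abelEnergy_eq h0.le h1]
  have h := integral_mono (integrable_abelKer_prod h0.le h1 μ μ).integral_prod_left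
    ((integrable_potential hμ hM μ).sub (integrable_const (1 / 2 * Real.log ρ)))
    (fun x => abel_le_potential hμ h0 h1 x)
  rw [integral_sub' (integrable_potential hμ hM μ) (integrable_const _), integral_const,
    probReal_univ, one_smul] at h
  exact h

theorem integral_potential_le {ρ : ℝ} (h0 : 0 < ρ) (h1 : ρ < 1) (hM : 0 ≤ M)
    [IsProbabilityMeasure μ] (ν : Measure Torus) [IsProbabilityMeasure ν] :
    ∫ x, potential μ x ∂ν ≤ abelEnergy ρ ν μ + 4 * M * Real.sqrt (1 - ρ) := by
  rw [abelEnergy_eq h0.le h1]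
  have hi := (integrable_abelKer_prod h0.le h1 ν μ).integral_prod_left
  have h := integral_mono (integrable_potential hμ hM ν)
    (hi.add (integrable_const (4 * M * Real.sqrt (1 - ρ))))
    (fun x => potential_le_abel hμ h0 h1 hM x)
  rw [integral_add' hi (integrable_const _), integral_const,
    probReal_univ, one_smul] at h
  exact h

end Potential

/-! ### Regularised energy controls transport -/

theorem norm_moment_le (μ : Measure Torus) [IsProbabilityMeasure μ] (n : ℕ) :
    ‖moment μ n‖ ≤ 1 := by
  have := norm_integral_le_of_norm_le_const (μ := μ) (f := fun t : Torus =>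
    (AddCircle.toCircle t : ℂ) ^ n) (.of_forall fun t => (norm_toCircle_pow t n).le)
  rwa [probReal_univ, mul_one] at this

/-- Frequencies are split at K = ⌊N²/2⌋. Below it Bernoulli's inequality gives ρ^n ≥ 1/2, so 1/n² ≤
1/n ≤ 2ρ^n/n. Above it the squared moment differences are at most 4 and the tail Σ 4/n² is at most
4/K ≤ 4/N. -/
theorem tsum_moment_sub_le {N : ℕ} (hN : 3 ≤ N) (μ ν : Measure Torus) [IsProbabilityMeasure μ]
    [IsProbabilityMeasure ν] {ρ : ℝ} (hρ : ρ = 1 - 1 / (N : ℝ) ^ 2) :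
    ∑' n : ℕ, ‖moment μ n - moment ν n‖ ^ 2 / (n : ℝ) ^ 2
      ≤ 2 * (abelEnergy ρ μ μ - 2 * abelEnergy ρ μ ν + abelEnergy ρ ν ν) + 4 / N := by
  have hNr : (3 : ℝ) ≤ N := by exact_mod_cast hN
  have hinv : 1 / (N : ℝ) ^ 2 ≤ 1 / 9 := one_div_le_one_div_of_le (by norm_num) (by nlinarith)
  have hinv0 : 0 < 1 / (N : ℝ) ^ 2 := by positivity
  have h0 : 0 ≤ ρ := by rw [hρ]; linarith
  have h1 : ρ < 1 := by rw [hρ]; linarith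
  have hA := hasSum_abelEnergy_sub h0 h1 μ ν
  set A := abelEnergy ρ μ μ - 2 * abelEnergy ρ μ ν + abelEnergy ρ ν ν
  set d : ℕ → ℝ := fun n => ‖moment μ n - moment ν n‖ ^ 2
  have hd0 : ∀ n, 0 ≤ d n := fun n => sq_nonneg _
  have hd4 : ∀ n, d n ≤ 4 := by
    intro n
    have h := (norm_sub_le (moment μ n) (moment ν n)).trans
      (add_le_add (norm_moment_le μ n) (norm_moment_le ν n))
    have := norm_nonneg (moment μ n - moment ν n)
    simp only [d]; nlinarith
  set K := N ^ 2 / 2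
  have hNK : N ≤ K := by
    rw [Nat.le_div_iff_mul_le two_pos, pow_two]
    exact Nat.mul_le_mul_left N (by omega)
  have hK2 : 2 * (K : ℝ) ≤ (N : ℝ) ^ 2 := by
    exact_mod_cast Nat.mul_div_le (N ^ 2) 2
  have hterm : ∀ n : ℕ, d n / (n : ℝ) ^ 2
      ≤ 2 * (ρ ^ n / n * d n) + if n ≤ K then 0 else 4 * ((n : ℝ) ^ 2)⁻¹ := by
    intro n
    rcases Nat.eq_zero_or_pos n with rfl | hn
    · simp
    have hn1 : (1 : ℝ) ≤ n := by exact_mod_cast hn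
    split_ifs with hnK
    · have hb := one_add_mul_le_pow (a := -(1 / (N : ℝ) ^ 2)) (by linarith) n
      have hn2 : (n : ℝ) * (1 / (N : ℝ) ^ 2) ≤ 1 / 2 := by
        rw [mul_one_div, div_le_iff₀ (by positivity)]
        have : (n : ℝ) ≤ K := by exact_mod_cast hnK
        linarith
      have hp : 1 / 2 ≤ ρ ^ n := by
        rw [hρ, sub_eq_add_neg]; linarith
      have : 1 / (n : ℝ) ^ 2 ≤ 2 * (ρ ^ n / n) := by
        rw [← mul_div_assoc, div_le_div_iff₀ (by positivity) (by positivity)]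
        nlinarith
      have h3 := mul_le_mul_of_nonneg_right this (hd0 n)
      rw [one_div_mul_eq_div] at h3
      linarith
    · have h3 : d n / (n : ℝ) ^ 2 ≤ 4 * ((n : ℝ) ^ 2)⁻¹ := by
        rw [div_eq_mul_inv]
        exact mul_le_mul_of_nonneg_right (hd4 n) (by positivity)
      have : 0 ≤ 2 * (ρ ^ n / n * d n) :=
        mul_nonneg two_pos.le (mul_nonneg (by positivity) (hd0 n))
      linarith
  refine Real.tsum_le_of_sum_range_le (fun n => div_nonneg (hd0 n) (sq_nonneg _)) fun m => ?_
  refine (Finset.sum_le_sum fun n _ => hterm n).trans ?_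
  rw [Finset.sum_add_distrib, ← Finset.mul_sum]
  refine add_le_add (mul_le_mul_of_nonneg_left ?_ two_pos.le) ?_
  · exact sum_le_hasSum _ (fun n _ => mul_nonneg (by positivity) (hd0 n)) hA
  · have hK0 : K ≠ 0 := by omega
    have h2 : ∑ n ∈ Finset.range m, (if n ≤ K then (0 : ℝ) else 4 * ((n : ℝ) ^ 2)⁻¹)
        ≤ ∑ n ∈ Finset.Ioc K (max K m), 4 * ((n : ℝ) ^ 2)⁻¹ := by
      have e : ∀ n, (if n ≤ K then (0 : ℝ) else 4 * ((n : ℝ) ^ 2)⁻¹)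
          = if ¬ n ≤ K then 4 * ((n : ℝ) ^ 2)⁻¹ else 0 := fun n => by split_ifs <;> rfl
      simp_rw [e]
      rw [← Finset.sum_filter]
      refine Finset.sum_le_sum_of_subset_of_nonneg (fun n hn => ?_) fun n _ _ => by positivity
      simp only [Finset.mem_filter, Finset.mem_range] at hn
      rw [Finset.mem_Ioc]
      exact ⟨not_le.1 hn.2, hn.1.le.trans (le_max_right _ _)⟩
    refine h2.trans ?_
    rw [← Finset.mul_sum]
    have h3 := sum_Ioc_inv_sq_le_sub (α := ℝ) hK0 (le_max_left K m)
    have h4 : ((K : ℝ))⁻¹ ≤ (N : ℝ)⁻¹ := by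
      apply inv_anti₀ (by linarith); exact_mod_cast hNK
    have h5 : (0 : ℝ) ≤ ((max K m : ℕ) : ℝ)⁻¹ := by positivity
    rw [div_eq_mul_inv]
    linarith

/-- The interaction energy of a configuration. -/
noncomputable def pairSum {N : ℕ} (x : Fin N → Torus) : ℝ :=
  ∑ i : Fin N, ∑ j ∈ Finset.Ioi i, logKer (x i - x j)

theorem isProbabilityMeasure_empirical {N : ℕ} (hN : N ≠ 0) (x : Fin N → Torus) :
    IsProbabilityMeasure (empirical N x) := by
  constructor
  simp only [empirical, Measure.smul_apply, Measure.coe_finsetSum, Finset.sum_apply, measure_univ,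
    Finset.sum_const, Finset.card_univ, Fintype.card_fin, nsmul_eq_mul, mul_one, smul_eq_mul]
  exact ENNReal.inv_mul_cancel (by exact_mod_cast hN) (ENNReal.natCast_ne_top N)

theorem integral_empirical {N : ℕ} (x : Fin N → Torus) (f : Torus → ℝ) :
    ∫ t, f t ∂(empirical N x) = (N : ℝ)⁻¹ * ∑ i, f (x i) := by
  rw [empirical, integral_smul_measure, integral_finsetSum_measure]
  · simp only [integral_dirac, ENNReal.toReal_inv, ENNReal.toReal_natCast, smul_eq_mul]
  · intro i _
    exact integrable_dirac (by simp)

/-- The N diagonal terms, finite after regularisation, give -log(1 - ρ)/N. Off the diagonal the Abel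
kernel is below the logarithmic one up to -½ log ρ, and there are at most N² such terms. -/
theorem abelEnergy_empirical_le {N : ℕ} (hN : N ≠ 0) {x : Fin N → Torus}
    (hx : Function.Injective x) {ρ : ℝ} (h0 : 0 < ρ) (h1 : ρ < 1) :
    abelEnergy ρ (empirical N x) (empirical N x)
      ≤ -Real.log (1 - ρ) / N + 2 / (N : ℝ) ^ 2 * pairSum x - 1 / 2 * Real.log ρ := by
  have := isProbabilityMeasure_empirical hN x
  have hc := continuous_abelKer h0.le h1
  have hNr : (0 : ℝ) < N := by exact_mod_cast Nat.pos_of_ne_zero hN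
  have hl := Real.log_nonpos h0.le h1.le
  have e1 : abelEnergy ρ (empirical N x) (empirical N x)
      = (N : ℝ)⁻¹ * ∑ i, ((N : ℝ)⁻¹ * ∑ j, abelKer ρ (x i - x j)) := by
    rw [abelEnergy_eq h0.le h1]
    have : ∀ y, ∫ z, abelKer ρ (y - z) ∂(empirical N x)
        = (N : ℝ)⁻¹ * ∑ j, abelKer ρ (y - x j) := fun y =>
      integral_empirical x _
    simp_rw [this]
    rw [integral_empirical x]
  have e2 : ∀ i, ∑ j, abelKer ρ (x i - x j)
      = abelKer ρ 0 + ∑ j ∈ {i}ᶜ, abelKer ρ (x i - x j) := by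
    intro i
    rw [← Finset.sum_add_sum_compl {i}, Finset.sum_singleton, sub_self]
  have hsymm : ∀ t, abelKer ρ (-t) = abelKer ρ t := fun t => by
    rw [abelKer_eq, abelKer_eq, chordNorm_neg]
  have e3 : ∑ i, ∑ j ∈ {i}ᶜ, abelKer ρ (x i - x j)
      = ∑ i, ∑ j ∈ Finset.Ioi i, (abelKer ρ (x i - x j) + abelKer ρ (x j - x i)) := by
    rw [Finset.sum_sum_Ioi_add_eq_sum_sum_off_diag (fun j i => abelKer ρ (x i - x j))]
  have e4 : ∑ i, ∑ j ∈ Finset.Ioi i, (abelKer ρ (x i - x j) + abelKer ρ (x j - x i))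
      ≤ 2 * pairSum x - (N : ℝ) ^ 2 * (1 / 2 * Real.log ρ) := by
    have h3 : ∀ i : Fin N, ∀ j ∈ Finset.Ioi i,
        abelKer ρ (x i - x j) + abelKer ρ (x j - x i)
          ≤ 2 * logKer (x i - x j) - Real.log ρ := by
      intro i j hj
      have hne : x i - x j ≠ 0 := sub_ne_zero.2 fun h => (Finset.mem_Ioi.1 hj).ne (hx h)
      rw [← neg_sub (x i) (x j), hsymm]
      have := abelKer_le h0 hne
      linarith
    refine (Finset.sum_le_sum fun i _ => Finset.sum_le_sum (h3 i)).trans ?_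
    simp_rw [Finset.sum_sub_distrib, ← Finset.mul_sum]
    rw [← pairSum]
    have hcard : ∑ i : Fin N, ∑ j ∈ Finset.Ioi i, (2 : ℝ) ≤ (N : ℝ) ^ 2 := by
      have := Finset.sum_sum_Ioi_add_eq_sum_sum_off_diag (fun _ _ : Fin N => (1 : ℝ))
      rw [one_add_one_eq_two] at this
      rw [this]
      calc ∑ i : Fin N, ∑ j ∈ ({i}ᶜ : Finset (Fin N)), (1 : ℝ)
          ≤ ∑ i : Fin N, ∑ j : Fin N, (1 : ℝ) := Finset.sum_le_sum fun i _ =>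
            Finset.sum_le_sum_of_subset_of_nonneg (Finset.subset_univ _) fun _ _ _ => zero_le_one
        _ = (N : ℝ) ^ 2 := by simp [pow_two]
    have : ∑ i : Fin N, ∑ j ∈ Finset.Ioi i, Real.log ρ
        = (∑ i : Fin N, ∑ j ∈ Finset.Ioi i, (2 : ℝ)) * (1 / 2 * Real.log ρ) := by
      rw [Finset.sum_mul]
      refine Finset.sum_congr rfl fun i _ => ?_
      rw [Finset.sum_mul]
      refine Finset.sum_congr rfl fun j _ => by ring
    rw [this]
    nlinarith
  rw [e1, ← Finset.mul_sum]
  simp_rw [e2]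
  rw [Finset.sum_add_distrib, e3, abelKer_zero, Finset.sum_const, Finset.card_univ,
    Fintype.card_fin, nsmul_eq_mul, ← mul_assoc]
  calc (N : ℝ)⁻¹ * (N : ℝ)⁻¹ * (N * -Real.log (1 - ρ)
        + ∑ i, ∑ j ∈ Finset.Ioi i, (abelKer ρ (x i - x j) + abelKer ρ (x j - x i)))
      ≤ (N : ℝ)⁻¹ * (N : ℝ)⁻¹ * (N * -Real.log (1 - ρ)
        + (2 * pairSum x - (N : ℝ) ^ 2 * (1 / 2 * Real.log ρ))) := by gcongr
    _ = _ := by field_simp; ring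

/-- Deterministic control of the transport distance by the renormalised interaction energy. -/
theorem le_of_lt_wasserstein {N : ℕ} (hN : 3 ≤ N) {M : ℝ} (hM : 0 ≤ M) {μ : Measure Torus}
    [IsProbabilityMeasure μ] (hμ : μ ≤ ENNReal.ofReal M • unif) {x : Fin N → Torus}
    (hx : Function.Injective x) {r : ℝ} (hr : 0 < r)
    (h : ENNReal.ofReal r < wasserstein (empirical N x) μ) :
    1 / (8 * Real.pi) * N * r ^ 2
      ≤ 2 / N * pairSum x - 2 * ∑ i, potential μ (x i) + N * potentialEnergy μ
        + 2 * Real.log N + 8 * M + 2 := by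
  have hN0 : N ≠ 0 := by omega
  have := isProbabilityMeasure_empirical hN0 x
  have hNr : (3 : ℝ) ≤ N := by exact_mod_cast hN
  have hinv : 1 / (N : ℝ) ^ 2 ≤ 1 / 9 := one_div_le_one_div_of_le (by norm_num) (by nlinarith)
  have hinv0 : 0 < 1 / (N : ℝ) ^ 2 := by positivity
  -- This scale gives -log(1 - ρ) = 2 log N on the diagonal and √(1 - ρ) = 1/N, so that N times the
  -- error 2 · 4M√(1 - ρ) is 8M.
  obtain ⟨ρ, hρ⟩ : ∃ ρ : ℝ, ρ = 1 - 1 / (N : ℝ) ^ 2 := ⟨_, rfl⟩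
  have h0 : 0 < ρ := by rw [hρ]; linarith
  have h1 : ρ < 1 := by rw [hρ]; linarith
  have hS := tsum_moment_sub_le hN (empirical N x) μ hρ
  have hA0 := (hasSum_abelEnergy_sub h0.le h1 (empirical N x) μ).nonneg
    fun n => mul_nonneg (by positivity) (sq_nonneg _)
  have hE1 := abelEnergy_empirical_le hN0 hx h0 h1
  have hE2 := integral_potential_le hμ h0 h1 hM (empirical N x)
  have hE3 := abelEnergy_le_potentialEnergy hμ h0 h1 hM
  rw [integral_empirical x] at hE2
  set A := abelEnergy ρ (empirical N x) (empirical N x) - 2 * abelEnergy ρ (empirical N x) μ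
    + abelEnergy ρ μ μ
  set S := ∑' n : ℕ, ‖moment (empirical N x) n - moment μ n‖ ^ 2 / (n : ℝ) ^ 2
  have hrS : r ^ 2 < 4 * S := by
    have h2 := h.trans_le (wasserstein_le_sqrt _ _)
    rw [ENNReal.ofReal_lt_ofReal_iff_of_nonneg hr.le] at h2
    exact (Real.lt_sqrt hr.le).1 h2
  have hlog : -Real.log ρ ≤ 2 / (N : ℝ) ^ 2 := by
    have h3 := Real.one_sub_inv_le_log_of_pos h0
    have h4 : ρ⁻¹ - 1 ≤ 2 / (N : ℝ) ^ 2 := by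
      have : ρ⁻¹ ≤ 1 + 2 * (1 / (N : ℝ) ^ 2) := by
        rw [inv_le_iff_one_le_mul₀ h0, hρ]
        nlinarith
      rw [mul_one_div] at this
      linarith
    linarith
  have hsq : Real.sqrt (1 - ρ) = 1 / N := by
    rw [hρ, sub_sub_cancel, ← one_div_pow, Real.sqrt_sq (by positivity)]
  have hl1 : -Real.log (1 - ρ) = 2 * Real.log N := by
    rw [hρ, sub_sub_cancel, one_div, Real.log_inv, Real.log_pow]; push_cast; ring
  rw [hsq] at hE2
  rw [hl1] at hE1
  have hpi := Real.pi_gt_three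
  -- From r² ≤ 4S ≤ 8A + 16/N. Dividing by 8π leaves NA/π + 2/π, and π > 3 together with A ≥ 0
  -- bounds this by NA + 1.
  have hstep : 1 / (8 * Real.pi) * N * r ^ 2 ≤ N * A + 1 := by
    have h5 : r ^ 2 ≤ 8 * A + 16 / N := by
      have : 4 * (4 / (N : ℝ)) = 16 / N := by ring
      linarith
    have h6 : (N : ℝ) * r ^ 2 ≤ 8 * (N * A) + 16 := by
      have := mul_le_mul_of_nonneg_left h5 (show (0 : ℝ) ≤ N by positivity)
      have h7 : (N : ℝ) * (8 * A + 16 / N) = 8 * (N * A) + 16 := by field_simp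
      linarith
    have h8 : 0 ≤ (N : ℝ) * A := by positivity
    rw [mul_assoc, one_div_mul_eq_div, div_le_iff₀ (by positivity)]
    nlinarith
  have hAle : A ≤ 2 * Real.log N / N + 2 / (N : ℝ) ^ 2 * pairSum x
      - 2 * ((N : ℝ)⁻¹ * ∑ i, potential μ (x i)) + 8 * M * (1 / N) + potentialEnergy μ
      + 2 / (N : ℝ) ^ 2 := by
    simp only [A]; linarith
  have hNA := mul_le_mul_of_nonneg_left hAle (show (0 : ℝ) ≤ N by positivity)
  have hfin : (N : ℝ) * (2 * Real.log N / N + 2 / (N : ℝ) ^ 2 * pairSum x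
      - 2 * ((N : ℝ)⁻¹ * ∑ i, potential μ (x i)) + 8 * M * (1 / N) + potentialEnergy μ
      + 2 / (N : ℝ) ^ 2) = 2 * Real.log N + 2 / N * pairSum x - 2 * ∑ i, potential μ (x i)
        + 8 * M + N * potentialEnergy μ + 2 / N := by field_simp
  have h9 : 2 / (N : ℝ) ≤ 1 := by rw [div_le_one (by positivity)]; linarith
  linarith

/-! ### Product measures -/

theorem pi_withDensity_ofReal {N : ℕ} {α : Type*} [MeasurableSpace α] {μ : Measure α}
    [SigmaFinite μ] {d : α → ℝ} (hd0 : ∀ x, 0 ≤ d x) (hd : Integrable d μ)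
    [SigmaFinite (μ.withDensity fun x => ENNReal.ofReal (d x))] :
    (Measure.pi fun _ : Fin N => μ).withDensity (fun x => ENNReal.ofReal (∏ i, d (x i)))
      = Measure.pi fun _ : Fin N => μ.withDensity fun x => ENNReal.ofReal (d x) := by
  symm
  refine Measure.pi_eq fun s hs => ?_
  rw [withDensity_apply _ (MeasurableSet.univ_pi hs), Measure.restrict_pi_pi,
    ← ofReal_integral_eq_lintegral_ofReal (Integrable.fintype_prod fun i => hd.restrict)
      (.of_forall fun x => Finset.prod_nonneg fun i _ => hd0 _),
    integral_fintype_prod_eq_prod (fun _ => d),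
    ENNReal.ofReal_prod_of_nonneg fun i _ => integral_nonneg hd0]
  refine Finset.prod_congr rfl fun i _ => ?_
  rw [withDensity_apply _ (hs i), ofReal_integral_eq_lintegral_ofReal hd.restrict
    (.of_forall hd0)]

theorem ofReal_integral_le_lintegral {α : Type*} [MeasurableSpace α] {μ : Measure α} {f : α → ℝ}
    (hf : Integrable f μ) : ENNReal.ofReal (∫ x, f x ∂μ) ≤ ∫⁻ x, ENNReal.ofReal (f x) ∂μ := by
  rw [integral_eq_lintegral_pos_part_sub_lintegral_neg_part hf]
  exact (ENNReal.ofReal_le_ofReal (sub_le_self _ ENNReal.toReal_nonneg)).trans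
    ENNReal.ofReal_toReal_le

theorem measurePreserving_pair {N : ℕ} {α : Type*} [MeasurableSpace α] (μ : Measure α)
    [IsProbabilityMeasure μ] {i j : Fin N} (hij : i ≠ j) :
    MeasurePreserving (fun x : Fin N → α => (x i, x j)) (Measure.pi fun _ => μ) (μ.prod μ) := by
  have hind : ProbabilityTheory.IndepFun (fun x : Fin N → α => x i) (fun x => x j)
      (Measure.pi fun _ => μ) :=
    (ProbabilityTheory.iIndepFun_pi (X := fun _ : Fin N => (id : α → α)) (μ := fun _ => μ)
      fun _ => aemeasurable_id).indepFun hij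
  refine ⟨(measurable_pi_apply i).prodMk (measurable_pi_apply j), ?_⟩
  rw [(ProbabilityTheory.indepFun_iff_map_prod_eq_prod_map_map
    (measurable_pi_apply i).aemeasurable (measurable_pi_apply j).aemeasurable).1 hind,
    (measurePreserving_eval (fun _ : Fin N => μ) i).map_eq,
    (measurePreserving_eval (fun _ : Fin N => μ) j).map_eq]

section Product

variable {M : ℝ} {μ : Measure Torus} (hμ : μ ≤ ENNReal.ofReal M • unif)

include hμ

theorem integrable_logKer_prod (hM : 0 ≤ M) [IsProbabilityMeasure μ] (ν : Measure Torus)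
    [IsFiniteMeasure ν] :
    Integrable (fun p : Torus × Torus => logKer (p.1 - p.2)) (ν.prod μ) := by
  have hmeas : Measurable (fun p : Torus × Torus => logKer (p.1 - p.2)) :=
    measurable_logKer.comp (measurable_fst.sub measurable_snd)
  refine (integrable_prod_iff hmeas.aestronglyMeasurable).2
    ⟨.of_forall fun x => integrable_logKer_sub hμ x, ?_⟩
  refine .of_bound (hmeas.norm.stronglyMeasurable.integral_prod_right.aestronglyMeasurable)
    (4 * M + Real.log 2) (.of_forall fun x => ?_)
  rw [Real.norm_of_nonneg (integral_nonneg fun y => norm_nonneg _)]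
  have hi := (integrable_chordNorm_sub hμ x).const_mul 2
  refine (integral_mono (integrable_logKer_sub hμ x).norm
    (hi.add (integrable_const (Real.log 2))) fun y => abs_logKer_le (x - y)).trans ?_
  rw [integral_add' hi (integrable_const _), integral_const_mul, integral_const, probReal_univ,
    one_smul]
  have := integral_chordNorm_sub_le hM hμ x
  linarith

theorem integral_logKer_prod (hM : 0 ≤ M) [IsProbabilityMeasure μ] (ν : Measure Torus)
    [IsFiniteMeasure ν] :
    ∫ p : Torus × Torus, logKer (p.1 - p.2) ∂(ν.prod μ) = ∫ x, potential μ x ∂ν :=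
  integral_prod _ (integrable_logKer_prod hμ hM ν)

theorem ae_prod_ne [IsProbabilityMeasure μ] (ν : Measure Torus) [IsFiniteMeasure ν] :
    ∀ᵐ p ∂(ν.prod μ), p.1 ≠ p.2 := by
  have hs : MeasurableSet {p : Torus × Torus | p.1 ≠ p.2} :=
    (measurableSet_eq_fun measurable_fst measurable_snd).compl
  exact (Measure.ae_prod_iff_ae_ae hs).2
    (.of_forall fun x => (ae_ne_of_le hμ x).mono fun y hy => hy.symm)

/-- Configurations with collisions are negligible, so the exponential form of the density may be
used under the product measure. -/
theorem ae_injective [IsProbabilityMeasure μ] (N : ℕ) :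
    ∀ᵐ x ∂(Measure.pi fun _ : Fin N => μ), Function.Injective x := by
  have h : ∀ i j : Fin N, i ≠ j → ∀ᵐ x ∂(Measure.pi fun _ : Fin N => μ), x i ≠ x j :=
    fun i j hij => (measurePreserving_pair μ hij).quasiMeasurePreserving.ae
      (ae_prod_ne hμ μ)
  have h2 : ∀ᵐ x ∂(Measure.pi fun _ : Fin N => μ), ∀ i j : Fin N, i ≠ j → x i ≠ x j := by
    rw [ae_all_iff]; intro i; rw [ae_all_iff]; intro j
    by_cases hij : i = j
    · exact .of_forall fun x h => absurd hij h
    · exact (h i j hij).mono fun x hx _ => hx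
  filter_upwards [h2] with x hx i j hij
  by_contra hne
  exact hx i j hne hij

end Product

theorem sum_sum_Ioi_one (N : ℕ) :
    ∑ i : Fin N, ∑ _j ∈ Finset.Ioi i, (1 : ℝ) = N * (N - 1) / 2 := by
  have h := Finset.sum_sum_Ioi_add_eq_sum_sum_off_diag (fun _ _ : Fin N => (1 / 2 : ℝ))
  rw [add_halves] at h
  rw [h]
  simp only [Finset.sum_const, Finset.card_compl, Finset.card_singleton, Fintype.card_fin,
    Finset.card_univ, nsmul_eq_mul]
  rcases Nat.eq_zero_or_pos N with rfl | hN
  · simp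
  · rw [Nat.cast_sub hN]; push_cast; ring

/-! ### The Gibbs law relative to the equilibrium product measure -/

/-- The density of the Gibbs measure with respect to the product of equilibrium measures,
up to normalisation. -/
noncomputable def relWeight (N : ℕ) (β : ℝ) (U : Torus → ℝ) (x : Fin N → Torus) : ℝ :=
  (∏ i : Fin N, ∏ j ∈ Finset.Ioi i, chord (x i) (x j) ^ (2 * β / (N : ℝ)))
    * ∏ i : Fin N, Real.exp (2 * β * U (x i))

theorem measurable_relWeight (N : ℕ) (β : ℝ) {U : Torus → ℝ} (hU : Measurable U) :
    Measurable (relWeight N β U) := by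
  refine Measurable.mul (Finset.measurable_fun_prod _ fun i _ => Finset.measurable_fun_prod _
    fun j _ => ?_) (Finset.measurable_fun_prod _ fun i _ => ?_)
  · have hp : Measurable fun x : Fin N → Torus => (x i, x j) :=
      (measurable_pi_apply i).prodMk (measurable_pi_apply j)
    exact (continuous_chord.measurable.comp hp).pow_const _
  · exact Real.measurable_exp.comp ((hU.comp (measurable_pi_apply i)).const_mul _)

theorem relWeight_of_injective {N : ℕ} (β : ℝ) (U : Torus → ℝ) {x : Fin N → Torus}
    (hx : Function.Injective x) :
    relWeight N β U x
      = Real.exp (-(2 * β / N) * pairSum x + 2 * β * ∑ i, U (x i)) := by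
  rw [relWeight, Real.exp_add, Finset.mul_sum Finset.univ (fun i => U (x i)), Real.exp_sum,
    pairSum, Finset.mul_sum, Real.exp_sum]
  congr 1
  refine Finset.prod_congr rfl fun i _ => ?_
  rw [Finset.mul_sum, Real.exp_sum]
  refine Finset.prod_congr rfl fun j hj => ?_
  have hne : x i - x j ≠ 0 := sub_ne_zero.2 fun h => (Finset.mem_Ioi.1 hj).ne (hx h)
  rw [chord_eq_chordNorm, Real.rpow_def_of_pos (chordNorm_pos hne), logKer]
  congr 1
  ring

/-- Collisions are treated apart because `logKer 0 = 0` spoils the exponential formula there. The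
product itself vanishes, as the exponent 2β/N is positive. -/
theorem relWeight_of_not_injective {N : ℕ} {β : ℝ} (hβ : 0 < β) (U : Torus → ℝ)
    {x : Fin N → Torus} (hx : ¬ Function.Injective x) : relWeight N β U x = 0 := by
  have key : ∀ i j : Fin N, i < j → x i = x j → relWeight N β U x = 0 := by
    intro i j hlt heq
    have hN : (0 : ℝ) < N := by exact_mod_cast i.pos
    have hz : chord (x i) (x j) ^ (2 * β / (N : ℝ)) = 0 := by
      rw [heq, chord_eq_chordNorm, sub_self, chordNorm_eq_zero.2 rfl,
        Real.zero_rpow (by positivity)]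
    rw [relWeight, Finset.prod_eq_zero (Finset.mem_univ i)
      (Finset.prod_eq_zero (Finset.mem_Ioi.2 hlt) hz), zero_mul]
  simp only [Function.Injective, not_forall] at hx
  obtain ⟨i, j, heq, hne⟩ := hx
  rcases lt_or_gt_of_ne hne with h | h
  · exact key i j h heq
  · exact key j i h heq.symm

section Gibbs

variable {M : ℝ} {μ : Measure Torus} (hμ : μ ≤ ENNReal.ofReal M • unif)

include hμ in
-- Jensen's inequality in tangent-line form, e^ℓ ≥ e^m(1 + ℓ - m) with m the mean of the exponent ℓ;
-- only ℓ itself has to be integrable. The N(N-1)/2 pairs contribute -β(N-1)E and the potentials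
-- 2βNE, so m = β(N+1)E.
theorem exp_le_lintegral_relWeight (hM : 0 ≤ M) [IsProbabilityMeasure μ] {N : ℕ} (hN : N ≠ 0)
    (β : ℝ) :
    ENNReal.ofReal (Real.exp (β * (N + 1) * potentialEnergy μ))
      ≤ ∫⁻ x, ENNReal.ofReal (relWeight N β (potential μ) x) ∂(Measure.pi fun _ : Fin N => μ) := by
  set P : Measure (Fin N → Torus) := Measure.pi fun _ : Fin N => μ
  have hNr : (N : ℝ) ≠ 0 := by exact_mod_cast hN
  have hpair : ∀ i j : Fin N, j ∈ Finset.Ioi i →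
      Integrable (fun x : Fin N → Torus => logKer (x i - x j)) P ∧
      ∫ x, logKer (x i - x j) ∂P = potentialEnergy μ := by
    intro i j hj
    have hmp := measurePreserving_pair μ (Finset.mem_Ioi.1 hj).ne
    have hi := integrable_logKer_prod hμ hM μ
    refine ⟨hmp.integrable_comp_of_integrable hi, ?_⟩
    have h1 := integral_logKer_prod hμ hM μ
    rw [← hmp.map_eq, integral_map hmp.measurable.aemeasurable (by
      rw [hmp.map_eq]; exact hi.1)] at h1
    exact h1
  have hsingle : ∀ i : Fin N, Integrable (fun x : Fin N → Torus => potential μ (x i)) P ∧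
      ∫ x, potential μ (x i) ∂P = potentialEnergy μ := by
    intro i
    have hmp := measurePreserving_eval (fun _ : Fin N => μ) i
    have hi := integrable_potential hμ hM μ
    refine ⟨hmp.integrable_comp_of_integrable hi, ?_⟩
    have h1 := integral_map (μ := P) (f := potential μ) hmp.measurable.aemeasurable
      (by rw [hmp.map_eq]; exact hi.1)
    rw [hmp.map_eq] at h1
    exact h1.symm
  have hps : Integrable (fun x : Fin N → Torus => pairSum x) P :=
    integrable_finsetSum _ fun i _ => integrable_finsetSum _ fun j hj => (hpair i j hj).1
  have hus : Integrable (fun x : Fin N → Torus => ∑ i, potential μ (x i)) P :=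
    integrable_finsetSum _ fun i _ => (hsingle i).1
  have hpI : ∫ x, pairSum x ∂P = N * (N - 1) / 2 * potentialEnergy μ := by
    rw [← sum_sum_Ioi_one, Finset.sum_mul]
    simp only [pairSum]
    rw [integral_finsetSum _ fun i _ => integrable_finsetSum _ fun j hj => (hpair i j hj).1]
    refine Finset.sum_congr rfl fun i _ => ?_
    rw [integral_finsetSum _ fun j hj => (hpair i j hj).1, Finset.sum_mul]
    exact Finset.sum_congr rfl fun j hj => by rw [(hpair i j hj).2, one_mul]
  have huI : ∫ x, ∑ i, potential μ (x i) ∂P = N * potentialEnergy μ := by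
    rw [integral_finsetSum _ fun i _ => (hsingle i).1]
    simp [(hsingle _).2]
  set ℓ : (Fin N → Torus) → ℝ := fun x =>
    -(2 * β / N) * pairSum x + 2 * β * ∑ i, potential μ (x i)
  have hℓ : Integrable ℓ P := (hps.const_mul _).add (hus.const_mul _)
  obtain ⟨m, hm⟩ : ∃ m, m = β * (N + 1) * potentialEnergy μ := ⟨_, rfl⟩
  have hℓI : ∫ x, ℓ x ∂P = m := by
    simp only [ℓ]
    rw [integral_add (hps.const_mul _) (hus.const_mul _), integral_const_mul, integral_const_mul,
      hpI, huI, hm]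
    field_simp
    ring
  have hlow : Integrable (fun x => Real.exp m * (1 + ℓ x - m)) P :=
    (((integrable_const 1).add hℓ).sub (integrable_const m)).const_mul _
  have hlowI : ∫ x, Real.exp m * (1 + ℓ x - m) ∂P = Real.exp m := by
    have h1 : Integrable (fun x => 1 + ℓ x) P := (integrable_const 1).add hℓ
    rw [integral_const_mul, integral_sub h1 (integrable_const m),
      integral_add (integrable_const 1) hℓ, hℓI]
    simp
  rw [← hm, ← hlowI]
  refine (ofReal_integral_le_lintegral hlow).trans (lintegral_mono_ae ?_)
  filter_upwards [ae_injective hμ N] with x hx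
  apply ENNReal.ofReal_le_ofReal
  rw [relWeight_of_injective β _ hx]
  change Real.exp m * (1 + ℓ x - m) ≤ Real.exp (ℓ x)
  have h2 := Real.add_one_le_exp (ℓ x - m)
  have h3 : Real.exp (ℓ x) = Real.exp m * Real.exp (ℓ x - m) := by rw [← Real.exp_add]; congr 1; ring
  rw [h3]
  exact mul_le_mul_of_nonneg_left (by linarith) (Real.exp_pos _).le

/-- With d the density of μ and z its normalisation, the equation reads e^{-V} = z d e^{2βU}.
Multiplying over the particles gives z^N, a factor that cancels in the Gibbs law. -/
theorem withDensity_weight {β : ℝ} {V : Torus → ℝ} (hV : Measurable V) [IsProbabilityMeasure μ]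
    (hEL : μ = unif.tilted fun x => -V x - 2 * β * potential μ x) (N : ℕ)
    {s : Set (Fin N → Torus)} (hs : MeasurableSet s) :
    ∫⁻ x in s, ENNReal.ofReal (weight N β V x) ∂(Measure.pi fun _ : Fin N => unif)
      = ENNReal.ofReal ((∫ x, Real.exp (-V x - 2 * β * potential μ x) ∂unif) ^ N)
        * ∫⁻ x in s, ENNReal.ofReal (relWeight N β (potential μ) x)
            ∂(Measure.pi fun _ : Fin N => μ) := by
  set f : Torus → ℝ := fun x => -V x - 2 * β * potential μ x
  set z := ∫ x, Real.exp (f x) ∂unif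
  have hU : Measurable (potential μ) := measurable_potential
  have hf : Measurable f := hV.neg.sub (hU.const_mul _)
  -- Tilting by a non-integrable exponential gives the zero measure by convention, which is excluded
  -- as μ is a probability measure.
  have hfi : Integrable (fun x => Real.exp (f x)) unif := by
    by_contra h
    rw [tilted_of_not_integrable h] at hEL
    exact IsProbabilityMeasure.ne_zero μ hEL
  have hz : 0 < z := integral_exp_pos hfi
  set d : Torus → ℝ := fun x => Real.exp (f x) / z
  have hd : Measurable d := (Real.measurable_exp.comp hf).div_const _
  have hμd : μ = unif.withDensity fun x => ENNReal.ofReal (d x) := hEL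
  have hprob : IsProbabilityMeasure (unif.withDensity fun x => ENNReal.ofReal (d x)) := by
    rw [← hμd]; infer_instance
  have hP : (Measure.pi fun _ : Fin N => μ)
      = (Measure.pi fun _ : Fin N => unif).withDensity fun x => ENNReal.ofReal (∏ i, d (x i)) := by
    rw [pi_withDensity_ofReal (fun x => by positivity) (hfi.div_const z)]
    exact congrArg (fun ν : Measure Torus => Measure.pi fun _ : Fin N => ν) hμd
  have hdm : Measurable fun x : Fin N → Torus => ENNReal.ofReal (∏ i, d (x i)) :=
    (Finset.measurable_fun_prod _ fun i _ => hd.comp (measurable_pi_apply i)).ennreal_ofReal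
  rw [hP, restrict_withDensity hs,
    lintegral_withDensity_eq_lintegral_mul _ hdm
      (measurable_relWeight N β hU).ennreal_ofReal,
    ← lintegral_const_mul' _ _ ENNReal.ofReal_ne_top]
  refine lintegral_congr fun x => ?_
  rw [Pi.mul_apply, ← ENNReal.ofReal_mul (Finset.prod_nonneg fun i _ => by positivity),
    ← ENNReal.ofReal_mul (by positivity)]
  congr 1
  have h1 : ∀ i, Real.exp (-V (x i)) = z * d (x i) * Real.exp (2 * β * potential μ (x i)) := by
    intro i
    simp only [d]
    rw [mul_div_cancel₀ _ hz.ne', ← Real.exp_add]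
    congr 1
    simp only [f]; ring
  simp_rw [weight, relWeight, h1, Finset.prod_mul_distrib]
  rw [Finset.prod_const, Finset.card_univ, Fintype.card_fin]
  ring

include hμ in
/-- The concentration inequality for the Gibbs measure around a solution of the
Euler-Lagrange equation. -/
theorem gibbs_wasserstein_le (hM : 0 ≤ M) [IsProbabilityMeasure μ] {β : ℝ} (hβ : 0 < β)
    {V : Torus → ℝ} (hV : Measurable V)
    (hEL : μ = unif.tilted fun x => -V x - 2 * β * potential μ x) {N : ℕ} (hN : 3 ≤ N) {r : ℝ}
    (hr : 0 < r) :
    gibbs N β V {x | ENNReal.ofReal r < wasserstein (empirical N x) μ}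
      ≤ ENNReal.ofReal (Real.exp (-β * (1 / (8 * Real.pi) * N * r ^ 2 - 5 * Real.log N
        - (8 * M + 2 + Real.log 2)))) := by
  set z := ∫ x, Real.exp (-V x - 2 * β * potential μ x) ∂unif with hzdef
  have hz : 0 < z := by
    refine integral_exp_pos ?_
    by_contra h
    have h0 := hEL
    rw [tilted_of_not_integrable h] at h0
    exact IsProbabilityMeasure.ne_zero μ h0
  have hN1 : (1 : ℝ) ≤ N := by exact_mod_cast (by omega : 1 ≤ N)
  have hlogN := Real.log_nonneg hN1
  set E := potentialEnergy μ
  have hE : -Real.log 2 ≤ E := neg_log_two_le_potentialEnergy hμ hM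
  -- K bounds the relative weight on the deviation event, and J is the Jensen lower bound for its
  -- integral.
  set K := Real.exp (-β * (1 / (8 * Real.pi) * N * r ^ 2 - N * E - 2 * Real.log N - 8 * M - 2))
  set J := Real.exp (β * (N + 1) * E)
  -- A measurable set containing the event, so measurability of the event itself is not required.
  set s : Set (Fin N → Torus) := {x | relWeight N β (potential μ) x ≤ K}
  have hs : MeasurableSet s :=
    measurableSet_le (measurable_relWeight N β measurable_potential) measurable_const
  have hsub : {x | ENNReal.ofReal r < wasserstein (empirical N x) μ} ⊆ s := by
    intro x hx
    by_cases hinj : Function.Injective x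
    · change relWeight N β (potential μ) x ≤ K
      rw [relWeight_of_injective β _ hinj]
      apply Real.exp_le_exp.2
      have h1 := mul_le_mul_of_nonneg_left (le_of_lt_wasserstein hN hM hμ hinj hr hx) hβ.le
      have h2 : 2 * β / (N : ℝ) * pairSum x = β * (2 / N * pairSum x) := by ring
      rw [neg_mul, h2]
      nlinarith
    · change relWeight N β (potential μ) x ≤ K
      rw [relWeight_of_not_injective hβ _ hinj]
      exact (Real.exp_pos _).le
  have hpart : ENNReal.ofReal (z ^ N * J) ≤ partitionFunction N β V := by
    have h1 := withDensity_weight hV hEL N MeasurableSet.univ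
    rw [setLIntegral_univ, setLIntegral_univ] at h1
    rw [partitionFunction, h1, ENNReal.ofReal_mul (by positivity)]
    exact mul_le_mul_right (exp_le_lintegral_relWeight hμ hM (by omega) β) _
  have hnum : ∫⁻ x in s, ENNReal.ofReal (weight N β V x) ∂(Measure.pi fun _ : Fin N => unif)
      ≤ ENNReal.ofReal (z ^ N * K) := by
    rw [withDensity_weight hV hEL N hs, ENNReal.ofReal_mul (by positivity)]
    refine mul_le_mul_right ?_ _
    calc ∫⁻ x in s, ENNReal.ofReal (relWeight N β (potential μ) x) ∂(Measure.pi fun _ : Fin N => μ)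
        ≤ ∫⁻ x in s, ENNReal.ofReal K ∂(Measure.pi fun _ : Fin N => μ) :=
          setLIntegral_mono' hs fun x hx => ENNReal.ofReal_le_ofReal hx
      _ ≤ ENNReal.ofReal K := by
          rw [setLIntegral_const]
          exact (mul_le_mul_right prob_le_one _).trans_eq (mul_one _)
  have hJ : 0 < z ^ N * J := by positivity
  calc gibbs N β V {x | ENNReal.ofReal r < wasserstein (empirical N x) μ}
      ≤ gibbs N β V s := measure_mono hsub
    _ = (partitionFunction N β V)⁻¹ * ∫⁻ x in s, ENNReal.ofReal (weight N β V x)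
          ∂(Measure.pi fun _ : Fin N => unif) := by
        rw [gibbs, Measure.smul_apply, smul_eq_mul, withDensity_apply _ hs]
    _ ≤ (ENNReal.ofReal (z ^ N * J))⁻¹ * ENNReal.ofReal (z ^ N * K) :=
        mul_le_mul' (ENNReal.inv_le_inv.2 hpart) hnum
    _ = ENNReal.ofReal (K / J) := by
        rw [← ENNReal.ofReal_inv_of_pos hJ, ← ENNReal.ofReal_mul (by positivity)]
        congr 1
        field_simp
    _ ≤ _ := by
        apply ENNReal.ofReal_le_ofReal
        simp only [K, J]
        rw [← Real.exp_sub]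
        apply Real.exp_le_exp.2
        -- In K/J the energies N E and (N+1)E leave a single E ≥ -log 2. The logarithmic cost is 2
        -- log N, which log N ≥ 0 relaxes to 5 log N.
        have h3 : β * (-Real.log 2) ≤ β * E := mul_le_mul_of_nonneg_left hE hβ.le
        have h4 : 0 ≤ β * Real.log N := by positivity
        linarith

end Gibbs

/-! ### Uniqueness of the minimiser of the free energy -/

theorem measurable_logKernel : Measurable fun p : Torus × Torus => logKernel p.1 p.2 := by
  unfold logKernel
  refine Measurable.ite (measurableSet_eq_fun measurable_fst measurable_snd) measurable_const ?_
  exact (Real.measurable_log.comp (continuous_chord.measurable.div_const 2).inv).ennreal_ofReal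

theorem logKernel_of_ne {x y : Torus} (h : x ≠ y) :
    logKernel x y = ENNReal.ofReal (logKer (x - y) + Real.log 2) := by
  rw [logKernel, if_neg h, chord_eq_chordNorm, Real.log_inv,
    Real.log_div (chordNorm_pos (sub_ne_zero.2 h)).ne' two_ne_zero, logKer]
  congr 1; ring

theorem logEnergy_eq_prod (ν : Measure Torus) [SFinite ν] :
    logEnergy ν = ∫⁻ p, logKernel p.1 p.2 ∂(ν.prod ν) :=
  (lintegral_prod _ measurable_logKernel.aemeasurable).symm

theorem logEnergy_eq_ofReal {ν : Measure Torus} [IsProbabilityMeasure ν]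
    (hne : ∀ᵐ p ∂(ν.prod ν), p.1 ≠ p.2)
    (hi : Integrable (fun p : Torus × Torus => logKer (p.1 - p.2)) (ν.prod ν)) :
    logEnergy ν = ENNReal.ofReal (∫ p : Torus × Torus, logKer (p.1 - p.2) ∂(ν.prod ν)
      + Real.log 2) := by
  have h1 : ∫ p : Torus × Torus, (logKer (p.1 - p.2) + Real.log 2) ∂(ν.prod ν)
      = ∫ p : Torus × Torus, logKer (p.1 - p.2) ∂(ν.prod ν) + Real.log 2 := by
    rw [integral_add hi (integrable_const _)]; simp
  have hi2 : Integrable (fun p : Torus × Torus => logKer (p.1 - p.2) + Real.log 2) (ν.prod ν) :=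
    hi.add (integrable_const _)
  rw [← h1, ofReal_integral_eq_lintegral_ofReal hi2
    (.of_forall fun p => by
      have := neg_log_two_le_logKer (p.1 - p.2)
      change 0 ≤ logKer (p.1 - p.2) + Real.log 2
      linarith), logEnergy_eq_prod]
  exact lintegral_congr_ae (hne.mono fun p hp => logKernel_of_ne hp)

/-- The kernel is +∞ on the diagonal and nonnegative elsewhere, so finite energy forces a null
diagonal and integrability. -/
theorem of_logEnergy_ne_top {ν : Measure Torus} [IsProbabilityMeasure ν]
    (h : logEnergy ν ≠ ⊤) :
    (∀ᵐ p ∂(ν.prod ν), p.1 ≠ p.2) ∧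
      Integrable (fun p : Torus × Torus => logKer (p.1 - p.2)) (ν.prod ν) := by
  rw [logEnergy_eq_prod] at h
  have hne : ∀ᵐ p ∂(ν.prod ν), p.1 ≠ p.2 := by
    filter_upwards [ae_lt_top measurable_logKernel h] with p hp heq
    rw [logKernel, if_pos heq] at hp
    exact lt_irrefl _ hp
  refine ⟨hne, ?_⟩
  have hi2 : Integrable (fun p : Torus × Torus => logKer (p.1 - p.2) + Real.log 2)
      (ν.prod ν) := by
    refine ⟨((measurable_logKer.comp
      (measurable_fst.sub measurable_snd)).add_const _).aestronglyMeasurable, ?_⟩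
    rw [hasFiniteIntegral_iff_ofReal (.of_forall fun p => by
      have := neg_log_two_le_logKer (p.1 - p.2)
      change 0 ≤ logKer (p.1 - p.2) + Real.log 2
      linarith)]
    rw [← lintegral_congr_ae (hne.mono fun p hp => logKernel_of_ne hp)]
    exact h.lt_top
  have h3 : Integrable (fun p : Torus × Torus => logKer (p.1 - p.2) + Real.log 2 - Real.log 2)
      (ν.prod ν) := hi2.sub (integrable_const _)
  simpa using h3

theorem abelEnergy_le_of_integrable {ν : Measure Torus} [IsProbabilityMeasure ν]
    (hne : ∀ᵐ p ∂(ν.prod ν), p.1 ≠ p.2)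
    (hi : Integrable (fun p : Torus × Torus => logKer (p.1 - p.2)) (ν.prod ν))
    {ρ : ℝ} (h0 : 0 < ρ) (h1 : ρ < 1) :
    abelEnergy ρ ν ν
      ≤ ∫ p : Torus × Torus, logKer (p.1 - p.2) ∂(ν.prod ν) - 1 / 2 * Real.log ρ := by
  have h := integral_mono_ae (integrable_abelKer_prod h0.le h1 ν ν)
    (hi.sub (integrable_const (1 / 2 * Real.log ρ)))
    (hne.mono fun p hp => abelKer_le h0 (sub_ne_zero.2 hp))
  rw [integral_sub' hi (integrable_const _), integral_const, probReal_univ, one_smul] at h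
  exact h

section Equilibrium

variable {M : ℝ} {μ : Measure Torus} (hμ : μ ≤ ENNReal.ofReal M • unif)

include hμ

/-- Positivity of the energy of ν - μ, inherited from the Abel kernel as ρ → 1. Only μ needs a
bounded density, since the self-energy of ν is compared from one side. -/
theorem energy_sub_nonneg (hM : 0 ≤ M) [IsProbabilityMeasure μ] {ν : Measure Torus}
    [IsProbabilityMeasure ν] (hne : ∀ᵐ p ∂(ν.prod ν), p.1 ≠ p.2)
    (hi : Integrable (fun p : Torus × Torus => logKer (p.1 - p.2)) (ν.prod ν)) :
    0 ≤ ∫ p : Torus × Torus, logKer (p.1 - p.2) ∂(ν.prod ν) - 2 * ∫ x, potential μ x ∂ν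
      + potentialEnergy μ := by
  set X := ∫ p : Torus × Torus, logKer (p.1 - p.2) ∂(ν.prod ν) - 2 * ∫ x, potential μ x ∂ν
      + potentialEnergy μ
  have hcont : Filter.Tendsto (fun ρ : ℝ => X + (-Real.log ρ + 8 * M * Real.sqrt (1 - ρ)))
      (nhdsWithin 1 (Ioo 0 1)) (nhds X) := by
    have : ContinuousAt (fun ρ : ℝ => X + (-Real.log ρ + 8 * M * Real.sqrt (1 - ρ))) 1 := by
      refine continuousAt_const.add (ContinuousAt.add (ContinuousAt.neg
        (Real.continuousAt_log one_ne_zero)) ?_)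
      fun_prop
    have h := this.tendsto
    simp only [Real.log_one, mul_zero, neg_zero, sub_self, Real.sqrt_zero, add_zero] at h
    exact h.mono_left nhdsWithin_le_nhds
  have hbot : (nhdsWithin (1 : ℝ) (Ioo 0 1)).NeBot := by
    rw [nhdsWithin_Ioo_eq_nhdsLT zero_lt_one]; infer_instance
  refine ge_of_tendsto hcont ?_
  filter_upwards [self_mem_nhdsWithin] with ρ hρ
  have hA0 := (hasSum_abelEnergy_sub hρ.1.le hρ.2 ν μ).nonneg
    fun n => mul_nonneg (div_nonneg (pow_nonneg hρ.1.le _) (Nat.cast_nonneg _)) (sq_nonneg _)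
  have hE1 := abelEnergy_le_of_integrable hne hi hρ.1 hρ.2
  have hE2 := integral_potential_le hμ hρ.1 hρ.2 hM ν
  have hE3 := abelEnergy_le_potentialEnergy hμ hρ.1 hρ.2 hM
  simp only [X]
  linarith

theorem integrable_exp_potential (hM : 0 ≤ M) [IsProbabilityMeasure μ] (c : ℝ)
    (ν : Measure Torus) [IsFiniteMeasure ν] :
    Integrable (fun x => Real.exp (c * potential μ x)) ν := by
  refine .of_bound (Real.measurable_exp.comp
    (measurable_potential.const_mul c)).aestronglyMeasurable
    (Real.exp (|c| * (4 * M + Real.log 2))) (.of_forall fun x => ?_)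
  rw [Real.norm_of_nonneg (Real.exp_pos _).le]
  apply Real.exp_le_exp.2
  refine (le_abs_self _).trans ?_
  rw [abs_mul]
  exact mul_le_mul_of_nonneg_left (abs_potential_le hμ hM x) (abs_nonneg _)

/-- A solution of the Euler-Lagrange equation is the unique minimiser of the free energy. -/
theorem freeEnergy_lt (hM : 0 ≤ M) [IsProbabilityMeasure μ] {β : ℝ} (hβ : 0 < β)
    {V : Torus → ℝ} (hVi : Integrable (fun x => Real.exp (-V x)) unif)
    (hEL : μ = unif.tilted fun x => -V x - 2 * β * potential μ x)
    {ν : Measure Torus} [IsProbabilityMeasure ν] (hνμ : ν ≠ μ) :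
    ENNReal.ofReal β * logEnergy μ + InformationTheory.klDiv μ (refMeasure V)
      < ENNReal.ofReal β * logEnergy ν + InformationTheory.klDiv ν (refMeasure V) := by
  set μ₀ := refMeasure V with hμ₀
  have hp0 : IsProbabilityMeasure μ₀ := isProbabilityMeasure_tilted hVi
  set g : Torus → ℝ := fun x => -(2 * β) * potential μ x
  have hgi : ∀ ν : Measure Torus, IsFiniteMeasure ν → Integrable g ν := fun ν _ =>
    (integrable_potential hμ hM ν).const_mul _
  have hge : Integrable (fun x => Real.exp (g x)) μ₀ := integrable_exp_potential hμ hM _ _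
  have hμt : μ = μ₀.tilted g := by
    rw [hμ₀, refMeasure, tilted_tilted hVi]
    refine hEL.trans (congrArg _ ?_)
    funext x
    simp only [g, Pi.add_apply]; ring
  have hμ₀μ : μ₀ ≪ μ := by
    conv_rhs => rw [hμt]
    exact absolutelyContinuous_tilted hge
  have hμμ₀ : μ ≪ μ₀ := by
    conv_lhs => rw [hμt]
    exact tilted_absolutelyContinuous _ _
  have hLμ : Integrable (llr μ μ₀) μ := by
    have h := llr_tilted_right hμμ₀ hge
    rw [← hμt] at h
    have h2 : llr μ μ₀ =ᵐ[μ] fun x => g x - Real.log (∫ z, Real.exp (g z) ∂μ₀) := by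
      filter_upwards [h, llr_self μ] with x hx hx0
      rw [hx0] at hx
      simp only [Pi.zero_apply] at hx
      linarith
    exact (integrable_congr h2).2 ((hgi μ inferInstance).sub (integrable_const _))
  -- As μ is the reference measure tilted by g = -2βU, changing the base of the entropy from μ₀ to μ
  -- costs ∫ g dν and a constant.
  have hkl : ∀ ν : Measure Torus, IsProbabilityMeasure ν → ν ≪ μ₀ → Integrable (llr ν μ₀) ν →
      (InformationTheory.klDiv ν μ₀).toReal = (InformationTheory.klDiv ν μ).toReal
        + ∫ x, g x ∂ν - Real.log (∫ z, Real.exp (g z) ∂μ₀) := by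
    intro ν _ hac hint
    have h1 := integral_llr_tilted_right hac (hgi ν inferInstance) hge hint
    rw [← hμt] at h1
    rw [InformationTheory.toReal_klDiv_of_measure_eq hac (by simp),
      InformationTheory.toReal_klDiv_of_measure_eq (hac.trans hμ₀μ) (by simp), h1]
    ring
  have hEμ := logEnergy_eq_ofReal (ae_prod_ne hμ μ) (integrable_logKer_prod hμ hM μ)
  rw [integral_logKer_prod hμ hM μ] at hEμ
  change logEnergy μ = ENNReal.ofReal (potentialEnergy μ + Real.log 2) at hEμ
  have hKμ : InformationTheory.klDiv μ μ₀ ≠ ⊤ := InformationTheory.klDiv_ne_top hμμ₀ hLμ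
  have hFμ : ENNReal.ofReal β * logEnergy μ + InformationTheory.klDiv μ μ₀ ≠ ⊤ := by
    rw [hEμ]
    exact ENNReal.add_ne_top.2 ⟨ENNReal.mul_ne_top ENNReal.ofReal_ne_top ENNReal.ofReal_ne_top,
      hKμ⟩
  by_cases hFν : ENNReal.ofReal β * logEnergy ν + InformationTheory.klDiv ν μ₀ = ⊤
  · rw [hFν]; exact hFμ.lt_top
  obtain ⟨hν1, hν2⟩ := ENNReal.add_ne_top.1 hFν
  have hβ' : ENNReal.ofReal β ≠ 0 := by simpa using hβ
  have hEν : logEnergy ν ≠ ⊤ := fun h => hν1 (by rw [h, ENNReal.mul_top hβ'])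
  obtain ⟨hne, hi⟩ := of_logEnergy_ne_top hEν
  obtain ⟨hac, hint⟩ := InformationTheory.klDiv_ne_top_iff.1 hν2
  have hpos := energy_sub_nonneg hμ hM hne hi
  have hEν2 := logEnergy_eq_ofReal hne hi
  have hKν : 0 < (InformationTheory.klDiv ν μ).toReal := by
    refine ENNReal.toReal_pos (fun h => hνμ (InformationTheory.klDiv_eq_zero_iff.1 h)) ?_
    have h1 := integrable_llr_tilted_right hac (hgi ν inferInstance) hint hge
    rw [← hμt] at h1
    exact InformationTheory.klDiv_ne_top (hac.trans hμ₀μ) h1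
  have h1 := hkl ν inferInstance hac hint
  have h2 := hkl μ inferInstance hμμ₀ hLμ
  rw [InformationTheory.klDiv_self, ENNReal.toReal_zero] at h2
  simp only [g] at h1 h2
  rw [integral_const_mul] at h1 h2
  have hEμ0 : 0 ≤ potentialEnergy μ + Real.log 2 := by
    have := neg_log_two_le_potentialEnergy hμ hM; linarith
  have hEν0 : 0 ≤ ∫ p : Torus × Torus, logKer (p.1 - p.2) ∂(ν.prod ν) + Real.log 2 := by
    have := integral_mono (integrable_const (-Real.log 2)) hi (fun p => neg_log_two_le_logKer _)
    rw [integral_const, probReal_univ, one_smul] at this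
    linarith
  rw [← ENNReal.toReal_lt_toReal hFμ hFν, ENNReal.toReal_add (ENNReal.add_ne_top.1 hFμ).1 hKμ,
    ENNReal.toReal_add hν1 hν2, ENNReal.toReal_mul, ENNReal.toReal_mul, hEμ, hEν2,
    ENNReal.toReal_ofReal hβ.le, ENNReal.toReal_ofReal hEμ0, ENNReal.toReal_ofReal hEν0, h1, h2]
  have h3 : ∫ x, potential μ x ∂μ = potentialEnergy μ := rfl
  rw [h3]
  -- After cancellation the difference of the free energies is β E(ν - μ) + H(ν|μ); strictness comes
  -- from `hKν`.
  have h4 := mul_nonneg hβ.le hpos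
  linarith

end Equilibrium

/-! ### Convolution with the logarithmic kernel as a positive operator -/

/-- Bounded measurable functions on the torus. -/
def IsBddMeas (f : Torus → ℝ) : Prop := Measurable f ∧ ∃ B : ℝ, ∀ x, |f x| ≤ B

namespace IsBddMeas

variable {f g : Torus → ℝ}

theorem add (hf : IsBddMeas f) (hg : IsBddMeas g) : IsBddMeas fun x => f x + g x := by
  obtain ⟨hf, A, hA⟩ := hf
  obtain ⟨hg, B, hB⟩ := hg
  exact ⟨hf.add hg, A + B, fun x => (abs_add_le _ _).trans (add_le_add (hA x) (hB x))⟩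

theorem sub (hf : IsBddMeas f) (hg : IsBddMeas g) : IsBddMeas fun x => f x - g x := by
  obtain ⟨hf, A, hA⟩ := hf
  obtain ⟨hg, B, hB⟩ := hg
  exact ⟨hf.sub hg, A + B, fun x => (abs_sub _ _).trans (add_le_add (hA x) (hB x))⟩

theorem mul (hf : IsBddMeas f) (hg : IsBddMeas g) : IsBddMeas fun x => f x * g x := by
  obtain ⟨hf, A, hA⟩ := hf
  obtain ⟨hg, B, hB⟩ := hg
  refine ⟨hf.mul hg, A * B, fun x => ?_⟩
  rw [abs_mul]
  exact mul_le_mul (hA x) (hB x) (abs_nonneg _) ((abs_nonneg _).trans (hA x))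

theorem const_mul (hf : IsBddMeas f) (c : ℝ) : IsBddMeas fun x => c * f x :=
  mul ⟨measurable_const, |c|, fun _ => le_rfl⟩ hf

theorem memLp (hf : IsBddMeas f) {p : ℝ≥0∞} : MemLp f p unif := by
  obtain ⟨hf, A, hA⟩ := hf
  exact .of_bound hf.aestronglyMeasurable A (.of_forall hA)

theorem integrable (hf : IsBddMeas f) : Integrable f unif := hf.memLp.integrable le_rfl

end IsBddMeas

theorem integral_abs_logKer_sub_le (x : Torus) :
    Integrable (fun y => logKer (x - y)) unif ∧ ∫ y, |logKer (x - y)| ∂unif ≤ 4 + Real.log 2 := by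
  have hμ : (unif : Measure Torus) ≤ ENNReal.ofReal 1 • unif := by simp
  refine ⟨integrable_logKer_sub hμ x, ?_⟩
  have hi := (integrable_chordNorm_sub hμ x).const_mul 2
  refine (integral_mono (integrable_logKer_sub hμ x).norm
    (hi.add (integrable_const (Real.log 2))) fun y => abs_logKer_le (x - y)).trans ?_
  rw [integral_add' hi (integrable_const _), integral_const_mul, integral_const, probReal_univ,
    one_smul]
  have := integral_chordNorm_sub_le zero_le_one hμ x
  linarith

/-- Convolution with the logarithmic kernel. -/
noncomputable def logConv (f : Torus → ℝ) (x : Torus) : ℝ := ∫ y, logKer (x - y) * f y ∂unif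

section LogConv

variable {f g : Torus → ℝ}

theorem integrable_logKer_mul (hf : IsBddMeas f) (x : Torus) :
    Integrable (fun y => logKer (x - y) * f y) unif := by
  obtain ⟨hf, B, hB⟩ := hf
  exact (integral_abs_logKer_sub_le x).1.mul_bdd (c := B) hf.aestronglyMeasurable (.of_forall hB)

theorem IsBddMeas.logConv (hf : IsBddMeas f) : IsBddMeas (logConv f) := by
  obtain ⟨hfm, B, hB⟩ := hf
  constructor
  · have : StronglyMeasurable (Function.uncurry fun x y : Torus => logKer (x - y) * f y) :=
      ((measurable_logKer.comp (measurable_fst.sub measurable_snd)).mul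
        (hfm.comp measurable_snd)).stronglyMeasurable
    exact this.integral_prod_right.measurable
  · refine ⟨(4 + Real.log 2) * B, fun x => ?_⟩
    have hB0 : 0 ≤ B := (abs_nonneg _).trans (hB 0)
    obtain ⟨h1, h2⟩ := integral_abs_logKer_sub_le x
    refine (norm_integral_le_of_norm_le (f := fun y => logKer (x - y) * f y)
      (h1.abs.mul_const B) (.of_forall fun y => ?_)).trans ?_
    · rw [norm_mul]
      exact mul_le_mul_of_nonneg_left (hB y) (abs_nonneg _)
    · rw [integral_mul_const]
      exact mul_le_mul_of_nonneg_right h2 hB0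

theorem logConv_lin (hf : IsBddMeas f) (hg : IsBddMeas g) (a b : ℝ) (x : Torus) :
    logConv (fun y => a * f y + b * g y) x = a * logConv f x + b * logConv g x := by
  simp only [logConv]
  rw [← integral_const_mul, ← integral_const_mul, ← integral_add
    ((integrable_logKer_mul hf x).const_mul a) ((integrable_logKer_mul hg x).const_mul b)]
  refine integral_congr_ae (.of_forall fun y => ?_)
  dsimp only; ring

theorem integral_mul_logConv_comm (hf : IsBddMeas f) (hg : IsBddMeas g) :
    ∫ x, f x * logConv g x ∂unif = ∫ x, g x * logConv f x ∂unif := by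
  have hμ : (unif : Measure Torus) ≤ ENNReal.ofReal 1 • unif := by simp
  obtain ⟨hfm, A, hA⟩ := hf
  obtain ⟨hgm, B, hB⟩ := hg
  have hi : Integrable (fun p : Torus × Torus => logKer (p.1 - p.2) * (f p.1 * g p.2))
      ((unif : Measure Torus).prod unif) := by
    refine (integrable_logKer_prod hμ zero_le_one unif).mul_bdd (c := A * B)
      ((hfm.comp measurable_fst).mul (hgm.comp measurable_snd)).aestronglyMeasurable
      (.of_forall fun p => ?_)
    rw [norm_mul]
    exact mul_le_mul (hA _) (hB _) (abs_nonneg _) ((abs_nonneg _).trans (hA p.1))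
  have h1 : ∫ x, f x * logConv g x ∂unif
      = ∫ x, ∫ y, logKer (x - y) * (f x * g y) ∂unif ∂unif := by
    refine integral_congr_ae (.of_forall fun x => ?_)
    simp only [logConv]
    rw [← integral_const_mul]
    refine integral_congr_ae (.of_forall fun y => ?_)
    dsimp only; ring
  rw [h1, integral_integral_swap hi]
  refine integral_congr_ae (.of_forall fun y => ?_)
  simp only [logConv]
  rw [← integral_const_mul]
  refine integral_congr_ae (.of_forall fun x => ?_)
  dsimp only
  rw [← neg_sub, logKer_neg]; ring

theorem fourier_logConv (hf : IsBddMeas f) (k : ℤ) :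
    ∫ t, fourier (-k) t * (logConv f t : ℂ) ∂unif
      = ((1 / (2 * k.natAbs) : ℝ) : ℂ) * ∫ t, fourier (-k) t * (f t : ℂ) ∂unif := by
  have h := fourierCoeff_sub_mul measurable_logKer integrable_logKer hf.integrable k
  have h2 := fourierCoeff_logKer (-k)
  rw [neg_neg, Int.natAbs_neg] at h2
  rw [← h2, ← h]
  refine integral_congr_ae (.of_forall fun t => ?_)
  dsimp only
  congr 2
  refine integral_congr_ae (.of_forall fun y => ?_)
  dsimp only
  rw [← neg_sub, logKer_neg]

theorem hasSum_sq_logConv (hf : IsBddMeas f) :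
    HasSum (fun k : ℤ => (1 / (2 * k.natAbs) : ℝ) ^ 2
      * ‖∫ t, fourier (-k) t * (f t : ℂ) ∂unif‖ ^ 2) (∫ t, logConv f t ^ 2 ∂unif) := by
  convert! hasSum_sq_fourier (hf.logConv.memLp) using 2 with k
  rw [fourier_logConv hf, norm_mul, mul_pow, Complex.norm_real, Real.norm_eq_abs, sq_abs]

/-- By polarisation: 4 f·Gf = (f + Gf)² - (f - Gf)², and G multiplies the k-th coefficient by c =
1/(2|k|), with (1 + c)² - (1 - c)² = 4c. -/
theorem hasSum_mul_logConv (hf : IsBddMeas f) :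
    HasSum (fun k : ℤ => (1 / (2 * k.natAbs) : ℝ)
      * ‖∫ t, fourier (-k) t * (f t : ℂ) ∂unif‖ ^ 2) (∫ t, f t * logConv f t ∂unif) := by
  have hG := hf.logConv
  have h1 := hasSum_sq_fourier (hf.add hG).memLp
  have h2 := hasSum_sq_fourier (hf.sub hG).memLp
  have hcoef : ∀ k : ℤ, ∀ f : Torus → ℝ, IsBddMeas f →
      Integrable (fun t => fourier (-k) t * (f t : ℂ)) unif := fun k f hf =>
    hf.integrable.ofReal.bdd_mul (fourier (-k)).continuous.aestronglyMeasurable (c := 1)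
      (.of_forall fun t => (norm_fourier_apply _ _).le)
  have h3 := (h1.sub h2).mul_left (1 / 4)
  convert! h3 using 2 with k
  · have e1 : ∫ t, fourier (-k) t * ((f t + logConv f t : ℝ) : ℂ) ∂unif
        = ((1 + 1 / (2 * k.natAbs) : ℝ) : ℂ) * ∫ t, fourier (-k) t * (f t : ℂ) ∂unif := by
      rw [Complex.ofReal_add, add_mul, ← fourier_logConv hf, Complex.ofReal_one, one_mul,
        ← integral_add (hcoef k _ hf) (hcoef k _ hG)]
      refine integral_congr_ae (.of_forall fun t => ?_)
      dsimp only; push_cast; ring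
    have e2 : ∫ t, fourier (-k) t * ((f t - logConv f t : ℝ) : ℂ) ∂unif
        = ((1 - 1 / (2 * k.natAbs) : ℝ) : ℂ) * ∫ t, fourier (-k) t * (f t : ℂ) ∂unif := by
      rw [Complex.ofReal_sub, sub_mul, ← fourier_logConv hf, Complex.ofReal_one, one_mul,
        ← integral_sub (hcoef k _ hf) (hcoef k _ hG)]
      refine integral_congr_ae (.of_forall fun t => ?_)
      dsimp only; push_cast; ring
    rw [e1, e2, norm_mul, norm_mul, mul_pow, mul_pow, Complex.norm_real, Complex.norm_real,
      Real.norm_eq_abs, Real.norm_eq_abs, sq_abs, sq_abs]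
    ring
  · rw [← integral_sub (hf.add hG).memLp.integrable_sq (hf.sub hG).memLp.integrable_sq,
      ← integral_const_mul]
    refine integral_congr_ae (.of_forall fun t => ?_)
    dsimp only; ring

theorem one_div_two_natAbs_mem (k : ℤ) : (1 / (2 * k.natAbs) : ℝ) ∈ Icc (0 : ℝ) 1 := by
  refine ⟨by positivity, ?_⟩
  rcases Nat.eq_zero_or_pos k.natAbs with h | h
  · rw [h]; simp
  · have : (1 : ℝ) ≤ k.natAbs := by exact_mod_cast h
    rw [div_le_one (by positivity)]
    linarith

/-- The Fourier multipliers of `logConv` lie in [0, 1], so G² ≤ G ≤ 1 as quadratic forms. This and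
`mul_logConv_le` are the two halves. -/
theorem sq_logConv_le (hf : IsBddMeas f) :
    ∫ t, logConv f t ^ 2 ∂unif ≤ ∫ t, f t * logConv f t ∂unif := by
  refine hasSum_le (fun k => ?_) (hasSum_sq_logConv hf) (hasSum_mul_logConv hf)
  obtain ⟨h0, h1⟩ := one_div_two_natAbs_mem k
  exact mul_le_mul_of_nonneg_right (by rw [pow_two]; exact mul_le_of_le_one_left h0 h1)
    (sq_nonneg _)

theorem mul_logConv_le (hf : IsBddMeas f) :
    ∫ t, f t * logConv f t ∂unif ≤ ∫ t, f t ^ 2 ∂unif := by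
  refine hasSum_le (fun k => ?_) (hasSum_mul_logConv hf) (hasSum_sq_fourier hf.memLp)
  exact mul_le_of_le_one_left (sq_nonneg _) (one_div_two_natAbs_mem k).2

theorem integral_logConv (hf : IsBddMeas f) : ∫ t, logConv f t ∂unif = 0 := by
  have h := fourier_logConv hf 0
  simp only [neg_zero, fourier_zero, one_mul, Int.natAbs_zero, Nat.cast_zero, mul_zero, div_zero,
    Complex.ofReal_zero, zero_mul] at h
  rw [integral_complex_ofReal] at h
  exact_mod_cast h

theorem neg_log_two_le_logConv (hf : IsBddMeas f) (h0 : ∀ x, 0 ≤ f x)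
    (h1 : ∫ x, f x ∂unif = 1) (x : Torus) : -Real.log 2 ≤ logConv f x := by
  have h := integral_mono (hf.integrable.const_mul (-Real.log 2)) (integrable_logKer_mul hf x)
    (fun y => mul_le_mul_of_nonneg_right (neg_log_two_le_logKer (x - y)) (h0 y))
  rwa [integral_const_mul, h1, mul_one] at h

end LogConv

/-! ### The Boltzmann map: bounds, Lipschitz estimate, monotonicity -/

/-- The Boltzmann weight `e^{-V-2βu}`. -/
noncomputable def boltzmann (β : ℝ) (V u : Torus → ℝ) (x : Torus) : ℝ :=
  Real.exp (-V x - 2 * β * u x)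

/-- The normalised Boltzmann weight. -/
noncomputable def gibbsDensity (β : ℝ) (V u : Torus → ℝ) (x : Torus) : ℝ :=
  boltzmann β V u x / ∫ y, boltzmann β V u y ∂unif

section Boltzmann

variable {β C : ℝ} (hβ : 0 < β) {V : Torus → ℝ} (hV : Measurable V) (hC : ∀ x, |V x| ≤ C)
  {u v : Torus → ℝ}

include hβ hC in
theorem boltzmann_exponent_le {x : Torus} (h : -Real.log 2 ≤ u x) :
    -V x - 2 * β * u x ≤ C + 2 * β * Real.log 2 := by
  have h1 := (abs_le.1 (hC x)).1
  nlinarith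

include hβ hC in
theorem boltzmann_le {x : Torus} (h : -Real.log 2 ≤ u x) :
    boltzmann β V u x ≤ Real.exp (C + 2 * β * Real.log 2) :=
  Real.exp_le_exp.2 (boltzmann_exponent_le hβ hC h)

include hV in
theorem measurable_boltzmann (hu : Measurable u) : Measurable (boltzmann β V u) :=
  Real.measurable_exp.comp (hV.neg.sub (hu.const_mul _))

include hβ hV hC in
theorem isBddMeas_boltzmann (hu : Measurable u) (h : ∀ x, -Real.log 2 ≤ u x) :
    IsBddMeas (boltzmann β V u) :=
  ⟨measurable_boltzmann hV hu, Real.exp (C + 2 * β * Real.log 2), fun x =>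
    (abs_of_pos (Real.exp_pos _)).trans_le (boltzmann_le hβ hC (h x))⟩

include hβ hV hC in
-- Since u has mean zero, e^{-2βu} ≥ 1 - 2βu integrates to at least 1. Together with u ≥ -log 2 this
-- bounds the normalised density uniformly over admissible u.
theorem exp_neg_le_integral_boltzmann (hu : IsBddMeas u) (h : ∀ x, -Real.log 2 ≤ u x)
    (h0 : ∫ x, u x ∂unif = 0) : Real.exp (-C) ≤ ∫ x, boltzmann β V u x ∂unif := by
  have hi : Integrable (fun x => 1 - 2 * β * u x) unif :=
    (integrable_const 1).sub (hu.integrable.const_mul _)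
  have h1 := integral_mono (hi.const_mul (Real.exp (-C)))
    (isBddMeas_boltzmann hβ hV hC hu.1 h).integrable (fun x => by
      have h2 := Real.add_one_le_exp (-(2 * β * u x))
      have h3 : Real.exp (-C) ≤ Real.exp (-V x) :=
        Real.exp_le_exp.2 (neg_le_neg (abs_le.1 (hC x)).2)
      change Real.exp (-C) * (1 - 2 * β * u x) ≤ Real.exp (-V x - 2 * β * u x)
      rw [sub_eq_add_neg (-V x), Real.exp_add]
      calc Real.exp (-C) * (1 - 2 * β * u x) ≤ Real.exp (-C) * Real.exp (-(2 * β * u x)) :=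
            mul_le_mul_of_nonneg_left (by linarith) (Real.exp_pos _).le
        _ ≤ _ := mul_le_mul_of_nonneg_right h3 (Real.exp_pos _).le)
  rw [integral_const_mul, integral_sub (integrable_const 1) (hu.integrable.const_mul _),
    integral_const_mul, h0] at h1
  simpa using h1

/-- Bounded probability densities. -/
structure IsBddDensity (M : ℝ) (f : Torus → ℝ) : Prop where
  measurable : Measurable f
  nonneg : ∀ x, 0 ≤ f x
  le : ∀ x, f x ≤ M
  integral_eq : ∫ x, f x ∂unif = 1

theorem IsBddDensity.isBddMeas {M : ℝ} {f : Torus → ℝ} (h : IsBddDensity M f) : IsBddMeas f :=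
  ⟨h.measurable, M, fun x => by rw [abs_of_nonneg (h.nonneg x)]; exact h.le x⟩

include hβ hV hC in
theorem isBddDensity_gibbsDensity (hu : Measurable u) (h : ∀ x, -Real.log 2 ≤ u x)
    (hz : Real.exp (-C) ≤ ∫ x, boltzmann β V u x ∂unif) :
    IsBddDensity (Real.exp (C + 2 * β * Real.log 2) * Real.exp C) (gibbsDensity β V u) := by
  have hz0 := (Real.exp_pos _).trans_le hz
  refine ⟨(measurable_boltzmann hV hu).div_const _,
    fun x => div_nonneg (Real.exp_pos _).le hz0.le, fun x => ?_, ?_⟩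
  · rw [gibbsDensity, div_le_iff₀ hz0]
    calc boltzmann β V u x ≤ Real.exp (C + 2 * β * Real.log 2) := boltzmann_le hβ hC (h x)
      _ = Real.exp (C + 2 * β * Real.log 2) * Real.exp C * Real.exp (-C) := by
          rw [mul_assoc (Real.exp (C + 2 * β * Real.log 2)), ← Real.exp_add C, add_neg_cancel,
            Real.exp_zero, mul_one]
      _ ≤ _ := mul_le_mul_of_nonneg_left hz (by positivity)
  · simp only [gibbsDensity]
    rw [integral_div, div_self hz0.ne']

/-- Potentials with the lower bound and the mean of those of probability densities. -/
structure IsAdmissible (u : Torus → ℝ) : Prop where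
  isBddMeas : IsBddMeas u
  neg_log_two_le : ∀ x, -Real.log 2 ≤ u x
  integral_eq : ∫ x, u x ∂unif = 0

theorem IsBddDensity.isAdmissible {M : ℝ} {f : Torus → ℝ} (h : IsBddDensity M f) :
    IsAdmissible (logConv f) :=
  ⟨h.isBddMeas.logConv, neg_log_two_le_logConv h.isBddMeas h.nonneg h.integral_eq,
    integral_logConv h.isBddMeas⟩

include hβ hV hC in
theorem IsAdmissible.isBddDensity (hu : IsAdmissible u) :
    IsBddDensity (Real.exp (C + 2 * β * Real.log 2) * Real.exp C) (gibbsDensity β V u) :=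
  isBddDensity_gibbsDensity hβ hV hC hu.isBddMeas.1 hu.neg_log_two_le
    (exp_neg_le_integral_boltzmann hβ hV hC hu.isBddMeas hu.neg_log_two_le hu.integral_eq)

theorem abs_exp_sub_exp_le {a s t : ℝ} (hs : s ≤ a) (ht : t ≤ a) :
    |Real.exp s - Real.exp t| ≤ Real.exp a * |s - t| := by
  wlog hst : t ≤ s generalizing s t
  · rw [abs_sub_comm, abs_sub_comm s]
    exact this ht hs (not_le.1 hst).le
  rw [abs_of_nonneg (sub_nonneg.2 (Real.exp_le_exp.2 hst)), abs_of_nonneg (sub_nonneg.2 hst)]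
  have h1 := Real.add_one_le_exp (t - s)
  have h2 : Real.exp t = Real.exp s * Real.exp (t - s) := by rw [← Real.exp_add]; congr 1; ring
  have h3 : Real.exp s ≤ Real.exp a := Real.exp_le_exp.2 hs
  calc Real.exp s - Real.exp t ≤ Real.exp s * (s - t) := by
        rw [h2]; nlinarith [Real.exp_pos s]
    _ ≤ _ := mul_le_mul_of_nonneg_right h3 (sub_nonneg.2 hst)

include hβ hV hC in
-- The exponents are uniformly bounded above, so the exponential is Lipschitz on their range; the
-- change of the normalisation is controlled by ∫ |u - v|, hence by the L² norm.
theorem exists_lipschitz_gibbsDensity :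
    ∃ L : ℝ, 0 < L ∧ ∀ u v, IsAdmissible u → IsAdmissible v →
      ∫ x, (gibbsDensity β V u x - gibbsDensity β V v x) ^ 2 ∂unif
        ≤ L * ∫ x, (u x - v x) ^ 2 ∂unif := by
  set a := C + 2 * β * Real.log 2
  set M := Real.exp a * Real.exp C
  set A := Real.exp C * (Real.exp a * (2 * β))
  have hA : 0 < A := by positivity
  have hM : 0 < M := by positivity
  refine ⟨2 * (A ^ 2 + (M * A) ^ 2), by positivity, fun u v hu hv => ?_⟩
  have hbu := isBddMeas_boltzmann hβ hV hC hu.isBddMeas.1 hu.neg_log_two_le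
  have hbv := isBddMeas_boltzmann hβ hV hC hv.isBddMeas.1 hv.neg_log_two_le
  have hzu := exp_neg_le_integral_boltzmann hβ hV hC hu.isBddMeas hu.neg_log_two_le hu.integral_eq
  have hzv := exp_neg_le_integral_boltzmann hβ hV hC hv.isBddMeas hv.neg_log_two_le hv.integral_eq
  have hNu := hu.isBddDensity hβ hV hC
  have hNv := hv.isBddDensity hβ hV hC
  set zu := ∫ x, boltzmann β V u x ∂unif with hzudef
  set zv := ∫ x, boltzmann β V v x ∂unif with hzvdef
  have hzu0 : 0 < zu := (Real.exp_pos _).trans_le hzu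
  have hzv0 : 0 < zv := (Real.exp_pos _).trans_le hzv
  have hw : IsBddMeas fun x => u x - v x := hu.isBddMeas.sub hv.isBddMeas
  have hpt : ∀ x, |boltzmann β V u x - boltzmann β V v x|
      ≤ Real.exp a * (2 * β) * |u x - v x| := by
    intro x
    refine (abs_exp_sub_exp_le (boltzmann_exponent_le hβ hC (hu.neg_log_two_le x))
      (boltzmann_exponent_le hβ hC (hv.neg_log_two_le x))).trans_eq ?_
    rw [show -V x - 2 * β * u x - (-V x - 2 * β * v x) = -(2 * β) * (u x - v x) by ring, abs_mul,
      abs_neg, abs_of_pos (by positivity : 0 < 2 * β)]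
    ring
  set I := ∫ x, |u x - v x| ∂unif
  have hI0 : 0 ≤ I := integral_nonneg fun x => abs_nonneg _
  have hz : |zu - zv| ≤ Real.exp a * (2 * β) * I := by
    rw [hzudef, hzvdef, ← integral_sub hbu.integrable hbv.integrable, ← integral_const_mul]
    exact norm_integral_le_of_norm_le
      (f := fun x => boltzmann β V u x - boltzmann β V v x) (hw.integrable.abs.const_mul _) (.of_forall hpt)
  have hinv : zu⁻¹ ≤ Real.exp C := by
    rw [← inv_inv (Real.exp C), ← Real.exp_neg]
    exact inv_anti₀ (Real.exp_pos _) hzu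
  have hdiff : ∀ x, |gibbsDensity β V u x - gibbsDensity β V v x|
      ≤ A * |u x - v x| + M * A * I := by
    intro x
    have e : gibbsDensity β V u x - gibbsDensity β V v x
        = zu⁻¹ * ((boltzmann β V u x - boltzmann β V v x)
          - gibbsDensity β V v x * (zu - zv)) := by
      simp only [gibbsDensity]
      rw [← hzudef, ← hzvdef]
      field_simp
      ring
    rw [e, abs_mul, abs_of_pos (inv_pos.2 hzu0)]
    have h1 : |(boltzmann β V u x - boltzmann β V v x) - gibbsDensity β V v x * (zu - zv)|
        ≤ Real.exp a * (2 * β) * |u x - v x| + M * (Real.exp a * (2 * β) * I) := by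
      refine (abs_sub _ _).trans (add_le_add (hpt x) ?_)
      rw [abs_mul, abs_of_nonneg (hNv.nonneg x)]
      exact mul_le_mul (hNv.le x) hz (abs_nonneg _) hM.le
    refine (mul_le_mul hinv h1 (abs_nonneg _) (Real.exp_pos _).le).trans_eq ?_
    simp only [A]; ring
  have hsq : ∀ x, (gibbsDensity β V u x - gibbsDensity β V v x) ^ 2
      ≤ 2 * A ^ 2 * (u x - v x) ^ 2 + 2 * (M * A) ^ 2 * I ^ 2 := by
    intro x
    have h1 := pow_le_pow_left₀ (abs_nonneg _) (hdiff x) 2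
    rw [sq_abs] at h1
    refine h1.trans ?_
    have h2 : (A * |u x - v x| + M * A * I) ^ 2
        ≤ 2 * (A * |u x - v x|) ^ 2 + 2 * (M * A * I) ^ 2 := by
      nlinarith [sq_nonneg (A * |u x - v x| - M * A * I)]
    refine h2.trans_eq ?_
    rw [mul_pow A, sq_abs]; ring
  have hi2 : Integrable (fun x => 2 * A ^ 2 * (u x - v x) ^ 2) unif :=
    hw.memLp.integrable_sq.const_mul _
  have hI := integral_mono (hNu.isBddMeas.sub hNv.isBddMeas).memLp.integrable_sq
    (hi2.add (integrable_const (2 * (M * A) ^ 2 * I ^ 2))) hsq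
  rw [integral_add' hi2 (integrable_const _), integral_const_mul, integral_const, probReal_univ,
    one_smul] at hI
  have hJ : I ^ 2 ≤ ∫ x, (u x - v x) ^ 2 ∂unif := sq_integral_abs_le hw.memLp
  refine hI.trans ?_
  have := mul_le_mul_of_nonneg_left hJ (show 0 ≤ 2 * (M * A) ^ 2 by positivity)
  linarith

include hβ hV hC in
-- The difference of the log-densities is -2β(u - v) plus a constant. Multiplied by the difference
-- of the densities it is nonnegative, as log increases, and the constant integrates to 0 because
-- both masses are 1.
theorem integral_gibbsDensity_sub_mul_nonpos (hu : IsAdmissible u) (hv : IsAdmissible v) :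
    ∫ x, (gibbsDensity β V u x - gibbsDensity β V v x) * (u x - v x) ∂unif ≤ 0 := by
  have hzu := exp_neg_le_integral_boltzmann hβ hV hC hu.isBddMeas hu.neg_log_two_le hu.integral_eq
  have hzv := exp_neg_le_integral_boltzmann hβ hV hC hv.isBddMeas hv.neg_log_two_le hv.integral_eq
  have hNu := hu.isBddDensity hβ hV hC
  have hNv := hv.isBddDensity hβ hV hC
  set zu := ∫ x, boltzmann β V u x ∂unif with hzudef
  set zv := ∫ x, boltzmann β V v x ∂unif with hzvdef
  have hzu0 : 0 < zu := (Real.exp_pos _).trans_le hzu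
  have hzv0 : 0 < zv := (Real.exp_pos _).trans_le hzv
  have hN := hNu.isBddMeas.sub hNv.isBddMeas
  have hw := hu.isBddMeas.sub hv.isBddMeas
  set c := Real.log zv - Real.log zu
  have hpt : ∀ x, 2 * β * ((gibbsDensity β V u x - gibbsDensity β V v x) * (u x - v x))
      ≤ c * (gibbsDensity β V u x - gibbsDensity β V v x) := by
    intro x
    have hpu : 0 < gibbsDensity β V u x := div_pos (Real.exp_pos _) hzu0
    have hpv : 0 < gibbsDensity β V v x := div_pos (Real.exp_pos _) hzv0
    have hlog : Real.log (gibbsDensity β V u x) - Real.log (gibbsDensity β V v x)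
        = -(2 * β) * (u x - v x) + c := by
      change Real.log (Real.exp _ / zu) - Real.log (Real.exp _ / zv) = _
      rw [Real.log_div (Real.exp_pos _).ne' hzu0.ne', Real.log_div (Real.exp_pos _).ne' hzv0.ne',
        Real.log_exp, Real.log_exp]
      simp only [c]; ring
    have hmono : 0 ≤ (gibbsDensity β V u x - gibbsDensity β V v x)
        * (Real.log (gibbsDensity β V u x) - Real.log (gibbsDensity β V v x)) := by
      rcases le_total (gibbsDensity β V u x) (gibbsDensity β V v x) with h | h
      · exact mul_nonneg_of_nonpos_of_nonpos (sub_nonpos.2 h)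
          (sub_nonpos.2 (Real.log_le_log hpu h))
      · exact mul_nonneg (sub_nonneg.2 h) (sub_nonneg.2 (Real.log_le_log hpv h))
    rw [hlog] at hmono
    linarith
  have h := integral_mono ((hN.mul hw).integrable.const_mul (2 * β)) (hN.integrable.const_mul c) hpt
  rw [integral_const_mul, integral_const_mul,
    integral_sub hNu.isBddMeas.integrable hNv.isBddMeas.integrable, hNu.integral_eq,
    hNv.integral_eq, sub_self, mul_zero] at h
  exact nonpos_of_mul_nonpos_right h (by positivity)

end Boltzmann

/-- Let Q(δ) = ⟨δ, Gδ⟩. The cross term is nonpositive and Q(η) ≤ ‖η‖² ≤ L‖Gδ‖² ≤ L Q(δ), so Q((1-t)δ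
+ tη) ≤ ((1-t)² + Lt²) Q(δ). The choice t = 1/(1+L) minimises this factor, with value L/(1+L) < 1.
-/
theorem logEnergy_contraction {L : ℝ} (hL : 0 < L) {δ η : Torus → ℝ} (hδ : IsBddMeas δ)
    (hη : IsBddMeas η) (h1 : ∫ x, η x * logConv δ x ∂unif ≤ 0)
    (h2 : ∫ x, η x ^ 2 ∂unif ≤ L * ∫ x, logConv δ x ^ 2 ∂unif) :
    ∫ x, ((1 - 1 / (1 + L)) * δ x + 1 / (1 + L) * η x)
        * logConv (fun y => (1 - 1 / (1 + L)) * δ y + 1 / (1 + L) * η y) x ∂unif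
      ≤ L / (1 + L) * ∫ x, δ x * logConv δ x ∂unif := by
  obtain ⟨t, ht⟩ : ∃ t, t = 1 / (1 + L) := ⟨_, rfl⟩
  rw [← ht]
  have ht0 : 0 ≤ t := by rw [ht]; positivity
  have ht1 : t ≤ 1 := by rw [ht, div_le_one (by positivity)]; linarith
  have hGδ := hδ.logConv
  have hGη := hη.logConv
  set Q := ∫ x, δ x * logConv δ x ∂unif
  have e : ∫ x, ((1 - t) * δ x + t * η x) * logConv (fun y => (1 - t) * δ y + t * η y) x ∂unif
      = (1 - t) ^ 2 * Q + 2 * ((1 - t) * t) * ∫ x, η x * logConv δ x ∂unif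
        + t ^ 2 * ∫ x, η x * logConv η x ∂unif := by
    have hc := integral_mul_logConv_comm hδ hη
    have hexp : ∀ x, ((1 - t) * δ x + t * η x) * logConv (fun y => (1 - t) * δ y + t * η y) x
        = (1 - t) ^ 2 * (δ x * logConv δ x) + (1 - t) * t * (δ x * logConv η x)
          + ((1 - t) * t * (η x * logConv δ x) + t ^ 2 * (η x * logConv η x)) := by
      intro x
      rw [logConv_lin hδ hη]; ring
    simp_rw [hexp]
    rw [integral_add (((hδ.mul hGδ).const_mul _).add ((hδ.mul hGη).const_mul _)).integrable
      (((hη.mul hGδ).const_mul _).add ((hη.mul hGη).const_mul _)).integrable,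
      integral_add ((hδ.mul hGδ).const_mul _).integrable ((hδ.mul hGη).const_mul _).integrable,
      integral_add ((hη.mul hGδ).const_mul _).integrable ((hη.mul hGη).const_mul _).integrable,
      integral_const_mul, integral_const_mul, integral_const_mul, integral_const_mul, hc]
    ring
  have h3 := mul_logConv_le hη
  have h4 := sq_logConv_le hδ
  have hQη : ∫ x, η x * logConv η x ∂unif ≤ L * Q :=
    h3.trans (h2.trans (mul_le_mul_of_nonneg_left h4 hL.le))
  have h5 : 2 * ((1 - t) * t) * ∫ x, η x * logConv δ x ∂unif ≤ 0 :=
    mul_nonpos_of_nonneg_of_nonpos (by nlinarith) h1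
  have h6 := mul_le_mul_of_nonneg_left hQη (sq_nonneg t)
  have h7 : (1 - t) ^ 2 * Q + t ^ 2 * (L * Q) = L / (1 + L) * Q := by
    rw [ht]; field_simp; ring
  rw [e]
  linarith

/-! ### Existence of a solution of the Euler-Lagrange equation -/

/-- The damped Picard iteration for the self-consistent equation of the equilibrium density. -/
noncomputable def picard (β t : ℝ) (V : Torus → ℝ) : ℕ → Torus → ℝ
  | 0 => fun _ => 1
  | n + 1 => fun x =>
      (1 - t) * picard β t V n x + t * gibbsDensity β V (logConv (picard β t V n)) x

theorem logConv_sub {f g : Torus → ℝ} (hf : IsBddMeas f) (hg : IsBddMeas g) (x : Torus) :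
    logConv (fun y => f y - g y) x = logConv f x - logConv g x := by
  have h := logConv_lin hf hg 1 (-1) x
  simpa [sub_eq_add_neg] using h

theorem ae_summable_of_summable_integral {α : Type*} [MeasurableSpace α] {μ : Measure α}
    {d : ℕ → α → ℝ} (hd : ∀ n, Integrable (d n) μ) {b : ℕ → ℝ} (hb : Summable b)
    (h : ∀ n, ∫ x, |d n x| ∂μ ≤ b n) : ∀ᵐ x ∂μ, Summable fun n => |d n x| := by
  have h1 : ∫⁻ x, ∑' n, ENNReal.ofReal |d n x| ∂μ ≠ ⊤ := by
    rw [lintegral_tsum fun n => (hd n).abs.aemeasurable.ennreal_ofReal]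
    have hb' : Summable fun n => ∫ x, |d n x| ∂μ :=
      .of_nonneg_of_le (fun n => integral_nonneg fun x => abs_nonneg _) h hb
    simp_rw [← ofReal_integral_eq_lintegral_ofReal (hd _).abs (.of_forall fun x => abs_nonneg _)]
    rw [← ENNReal.ofReal_tsum_of_nonneg (fun n => integral_nonneg fun x => abs_nonneg _) hb']
    exact ENNReal.ofReal_ne_top
  filter_upwards [ae_lt_top' (AEMeasurable.tsum
    fun n => (hd n).abs.aemeasurable.ennreal_ofReal) h1] with x hx
  have := ENNReal.summable_toReal hx.ne
  simpa using this

section Existence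

variable {β C : ℝ} (hβ : 0 < β) {V : Torus → ℝ} (hV : Measurable V) (hC : ∀ x, |V x| ≤ C)

include hβ hV hC in
theorem isBddDensity_picard {t : ℝ} (ht0 : 0 ≤ t) (ht1 : t ≤ 1) (n : ℕ) :
    IsBddDensity (Real.exp (C + 2 * β * Real.log 2) * Real.exp C) (picard β t V n) := by
  have hC0 : 0 ≤ C := (abs_nonneg _).trans (hC 0)
  have hl : 0 < Real.log 2 := Real.log_pos one_lt_two
  induction n with
  | zero =>
    refine ⟨measurable_const, fun _ => zero_le_one, fun _ => ?_, by simp [picard]⟩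
    exact one_le_mul_of_one_le_of_one_le (Real.one_le_exp (by positivity)) (Real.one_le_exp hC0)
  | succ n ih =>
    have hg := ih.isAdmissible.isBddDensity hβ hV hC
    have ht : 0 ≤ 1 - t := sub_nonneg.2 ht1
    refine ⟨(ih.measurable.const_mul _).add (hg.measurable.const_mul _), fun x =>
      add_nonneg (mul_nonneg ht (ih.nonneg x)) (mul_nonneg ht0 (hg.nonneg x)), fun x => ?_, ?_⟩
    · refine (add_le_add (mul_le_mul_of_nonneg_left (ih.le x) ht)
        (mul_le_mul_of_nonneg_left (hg.le x) ht0)).trans_eq ?_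
      ring
    · simp only [picard]
      rw [integral_add (ih.isBddMeas.integrable.const_mul _) (hg.isBddMeas.integrable.const_mul _),
        integral_const_mul, integral_const_mul, ih.integral_eq, hg.integral_eq]
      ring

include hβ hV hC in
-- The energies of successive increments decay geometrically and dominate the squared L² norms of
-- the potential increments. The L¹ norms are therefore summable, which gives convergence almost
-- everywhere of the potentials.
theorem exists_picard_ae_tendsto : ∃ t : ℝ, 0 < t ∧ t ≤ 1 ∧
    ∃ u : Torus → ℝ, Measurable u ∧ (∀ x, -Real.log 2 ≤ u x) ∧
      ∀ᵐ x ∂unif, Filter.Tendsto (fun n => logConv (picard β t V n) x) Filter.atTop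
        (nhds (u x)) := by
  obtain ⟨L, hL, hLip⟩ := exists_lipschitz_gibbsDensity hβ hV hC
  have ht0 : 0 < 1 / (1 + L) := by positivity
  have ht1 : 1 / (1 + L) ≤ 1 := by rw [div_le_one (by positivity)]; linarith
  refine ⟨1 / (1 + L), ht0, ht1, ?_⟩
  have hφ := isBddDensity_picard hβ hV hC ht0.le ht1
  obtain ⟨φ, hφdef⟩ : ∃ φ, φ = picard β (1 / (1 + L)) V := ⟨_, rfl⟩
  rw [← hφdef] at hφ ⊢
  have hu := fun n => (hφ n).isAdmissible
  have hg := fun n => (hu n).isBddDensity hβ hV hC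
  have hδ := fun n => (hφ (n + 1)).isBddMeas.sub (hφ n).isBddMeas
  have hη := fun n => (hg (n + 1)).isBddMeas.sub (hg n).isBddMeas
  have hGδ : ∀ n x, logConv (fun y => φ (n + 1) y - φ n y) x
      = logConv (φ (n + 1)) x - logConv (φ n) x := fun n x =>
    logConv_sub (hφ (n + 1)).isBddMeas (hφ n).isBddMeas x
  have hstep : ∀ n, (fun y => φ (n + 2) y - φ (n + 1) y) = fun y =>
      (1 - 1 / (1 + L)) * (φ (n + 1) y - φ n y) + 1 / (1 + L) *
        (gibbsDensity β V (logConv (φ (n + 1))) y - gibbsDensity β V (logConv (φ n)) y) := by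
    intro n
    funext y
    have h1 : φ (n + 2) y = (1 - 1 / (1 + L)) * φ (n + 1) y
        + 1 / (1 + L) * gibbsDensity β V (logConv (φ (n + 1))) y := by rw [hφdef]; rfl
    have h2 : φ (n + 1) y = (1 - 1 / (1 + L)) * φ n y
        + 1 / (1 + L) * gibbsDensity β V (logConv (φ n)) y := by rw [hφdef]; rfl
    rw [h1]
    nth_rw 2 [h2]
    ring
  obtain ⟨Q, hQ⟩ : ∃ Q : ℕ → ℝ, ∀ n, Q n = ∫ x, (φ (n + 1) x - φ n x)
    * logConv (fun y => φ (n + 1) y - φ n y) x ∂unif := ⟨_, fun _ => rfl⟩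
  have hQstep : ∀ n, Q (n + 1) ≤ L / (1 + L) * Q n := by
    intro n
    rw [hQ, hQ, hstep n]
    have e : ∀ x, φ (n + 1 + 1) x - φ (n + 1) x = (1 - 1 / (1 + L)) * (φ (n + 1) x - φ n x)
      + 1 / (1 + L) * (gibbsDensity β V (logConv (φ (n + 1))) x
        - gibbsDensity β V (logConv (φ n)) x) := congrFun (hstep n)
    simp_rw [e]
    refine logEnergy_contraction hL (hδ n) (hη n) ?_ ?_
    · simp_rw [hGδ]
      exact integral_gibbsDensity_sub_mul_nonpos hβ hV hC (hu (n + 1)) (hu n)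
    · simp_rw [hGδ]
      exact hLip _ _ (hu (n + 1)) (hu n)
  have hθ0 : 0 ≤ L / (1 + L) := by positivity
  have hθ1 : L / (1 + L) < 1 := by rw [div_lt_one (by positivity)]; linarith
  have hQn : ∀ n, Q n ≤ (L / (1 + L)) ^ n * Q 0 := by
    intro n
    induction n with
    | zero => simp
    | succ n ih =>
      refine (hQstep n).trans ((mul_le_mul_of_nonneg_left ih hθ0).trans_eq ?_)
      ring
  have hdi : ∀ n, IsBddMeas fun x => logConv (φ (n + 1)) x - logConv (φ n) x := fun n =>
    (hu (n + 1)).isBddMeas.sub (hu n).isBddMeas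
  have hL1 : ∀ n, ∫ x, |logConv (φ (n + 1)) x - logConv (φ n) x| ∂unif
      ≤ Real.sqrt (Q 0) * Real.sqrt (L / (1 + L)) ^ n := by
    intro n
    have h1 := sq_integral_abs_le (hdi n).memLp
    have h2 := sq_logConv_le (hδ n)
    simp_rw [hGδ] at h2
    have h3 := (h1.trans h2).trans ((le_of_eq (by rw [hQ]; simp_rw [hGδ])).trans (hQn n))
    refine (Real.le_sqrt_of_sq_le h3).trans_eq ?_
    rw [Real.sqrt_mul (by positivity), mul_comm]
    congr 1
    rw [show (L / (1 + L)) ^ n = (Real.sqrt (L / (1 + L)) ^ n) ^ 2 by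
      rw [← pow_mul, mul_comm, pow_mul, Real.sq_sqrt hθ0], Real.sqrt_sq (by positivity)]
  have hsum : Summable fun n => Real.sqrt (Q 0) * Real.sqrt (L / (1 + L)) ^ n :=
    (summable_geometric_of_lt_one (Real.sqrt_nonneg _)
      ((Real.sqrt_lt' one_pos).2 (by simpa using hθ1))).mul_left _
  have hae := ae_summable_of_summable_integral (fun n => (hdi n).integrable) hsum hL1
  have hconv : ∀ᵐ x ∂unif, ∃ l, Filter.Tendsto (fun n => logConv (φ n) x) Filter.atTop
      (nhds l) := by
    filter_upwards [hae] with x hx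
    refine cauchySeq_tendsto_of_complete (cauchySeq_of_summable_dist ?_)
    simpa [Real.dist_eq, abs_sub_comm] using hx
  obtain ⟨u, hum, hlim⟩ := measurable_limit_of_tendsto_metrizable_ae
    (fun n => (hu n).isBddMeas.1.aemeasurable) hconv
  -- The maximum changes u only on a null set and makes the lower bound hold everywhere.
  refine ⟨fun x => max (-Real.log 2) (u x), measurable_const.max hum, fun x => le_max_left _ _, ?_⟩
  filter_upwards [hlim] with x hx
  rwa [max_eq_right (ge_of_tendsto' hx fun n => (hu n).neg_log_two_le x)]

include hβ hV hC in
-- Only the potentials u_n are known to converge, so the solution is the Boltzmann density of their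
-- limit u. It has potential u because the recursion reads G g(u_n) = u_n + (u_{n+1} - u_n)/t, and
-- both sides pass to the limit.
theorem exists_isBddDensity_eq_gibbsDensity : ∃ M : ℝ, 0 ≤ M ∧ ∃ f : Torus → ℝ,
    IsBddDensity M f ∧ f =ᵐ[unif] gibbsDensity β V (logConv f) := by
  obtain ⟨t, ht0, ht1, u, hum, hul, hlim⟩ := exists_picard_ae_tendsto hβ hV hC
  have hφ := isBddDensity_picard hβ hV hC ht0.le ht1
  have hstep : ∀ n y, picard β t V (n + 1) y = (1 - t) * picard β t V n y
    + t * gibbsDensity β V (logConv (picard β t V n)) y := fun _ _ => rfl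
  obtain ⟨φ, hφdef⟩ : ∃ φ, φ = picard β t V := ⟨_, rfl⟩
  rw [← hφdef] at hφ hstep hlim
  have hu := fun n => (hφ n).isAdmissible
  have hg := fun n => (hu n).isBddDensity hβ hV hC
  have hb : ∀ᵐ x ∂unif, Filter.Tendsto (fun n => boltzmann β V (logConv (φ n)) x) Filter.atTop
      (nhds (boltzmann β V u x)) := by
    filter_upwards [hlim] with x hx
    exact (Real.continuous_exp.tendsto _).comp (tendsto_const_nhds.sub (hx.const_mul _))
  have hZ : Filter.Tendsto (fun n => ∫ x, boltzmann β V (logConv (φ n)) x ∂unif) Filter.atTop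
      (nhds (∫ x, boltzmann β V u x ∂unif)) :=
    tendsto_integral_of_dominated_convergence
      (fun _ => Real.exp (C + 2 * β * Real.log 2))
      (fun n => (measurable_boltzmann hV (hu n).isBddMeas.1).aestronglyMeasurable)
      (integrable_const _) (fun n => .of_forall fun x =>
        (abs_of_pos (Real.exp_pos _)).trans_le (boltzmann_le hβ hC ((hu n).neg_log_two_le x))) hb
  have hz : Real.exp (-C) ≤ ∫ x, boltzmann β V u x ∂unif := ge_of_tendsto' hZ fun n =>
    exp_neg_le_integral_boltzmann hβ hV hC (hu n).isBddMeas (hu n).neg_log_two_le (hu n).integral_eq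
  have hf := isBddDensity_gibbsDensity hβ hV hC hum hul hz
  have hglim : ∀ᵐ x ∂unif, Filter.Tendsto (fun n => gibbsDensity β V (logConv (φ n)) x)
      Filter.atTop (nhds (gibbsDensity β V u x)) := by
    filter_upwards [hb] with x hx
    exact hx.div hZ ((Real.exp_pos _).trans_le hz).ne'
  have hGlim : ∀ x, Filter.Tendsto (fun n => logConv (gibbsDensity β V (logConv (φ n))) x)
      Filter.atTop (nhds (logConv (gibbsDensity β V u) x)) := by
    intro x
    refine tendsto_integral_of_dominated_convergence
      (fun y => |logKer (x - y)| * (Real.exp (C + 2 * β * Real.log 2) * Real.exp C))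
      (fun n => (integrable_logKer_mul (hg n).isBddMeas x).aestronglyMeasurable)
      ((integral_abs_logKer_sub_le x).1.abs.mul_const _) (fun n => .of_forall fun y => ?_) ?_
    · rw [norm_mul]
      exact mul_le_mul_of_nonneg_left
        ((abs_of_nonneg ((hg n).nonneg y)).trans_le ((hg n).le y)) (abs_nonneg _)
    · filter_upwards [hglim] with y hy
      exact hy.const_mul _
  refine ⟨_, by positivity, gibbsDensity β V u, hf, ?_⟩
  have hGu : ∀ᵐ x ∂unif, logConv (gibbsDensity β V u) x = u x := by
    filter_upwards [hlim] with x hx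
    have h1 : ∀ n, logConv (gibbsDensity β V (logConv (φ n))) x
        = logConv (φ n) x + (logConv (φ (n + 1)) x - logConv (φ n) x) / t := by
      intro n
      have h2 : φ (n + 1) = fun y => (1 - t) * φ n y + t * gibbsDensity β V (logConv (φ n)) y :=
        funext (hstep n)
      rw [h2, logConv_lin (hφ n).isBddMeas (hg n).isBddMeas]
      field_simp
      ring
    have h3 : Filter.Tendsto
        (fun n => logConv (φ n) x + (logConv (φ (n + 1)) x - logConv (φ n) x) / t) Filter.atTop
        (nhds (u x + (u x - u x) / t)) :=
      hx.add ((((Filter.tendsto_add_atTop_iff_nat 1).2 hx).sub hx).div_const t)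
    simp_rw [← h1, sub_self, zero_div, add_zero] at h3
    exact tendsto_nhds_unique (hGlim x) h3
  have hbe : boltzmann β V u =ᵐ[unif] boltzmann β V (logConv (gibbsDensity β V u)) := by
    filter_upwards [hGu] with x hx
    simp only [boltzmann, hx]
  have hze := integral_congr_ae hbe
  filter_upwards [hbe] with x hx
  rw [gibbsDensity, hx, hze]
  rfl

include hβ hV hC in
theorem exists_eq_tilted_potential : ∃ M : ℝ, 0 ≤ M ∧ ∃ μ : ProbabilityMeasure Torus,
    (μ : Measure Torus) ≤ ENNReal.ofReal M • unif ∧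
      (μ : Measure Torus) = unif.tilted fun x => -V x - 2 * β * potential μ x := by
  obtain ⟨M, hM, f, hf, hfe⟩ := exists_isBddDensity_eq_gibbsDensity hβ hV hC
  have hfi := hf.isBddMeas.integrable
  have hprob : IsProbabilityMeasure (unif.withDensity fun x => ENNReal.ofReal (f x)) := by
    constructor
    rw [withDensity_apply _ .univ, Measure.restrict_univ,
      ← ofReal_integral_eq_lintegral_ofReal hfi (.of_forall hf.nonneg), hf.integral_eq,
      ENNReal.ofReal_one]
  refine ⟨M, hM, ⟨_, hprob⟩, ?_, ?_⟩
  · rw [← withDensity_const]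
    exact withDensity_mono (.of_forall fun x => ENNReal.ofReal_le_ofReal (hf.le x))
  · have hp : ∀ x, potential (unif.withDensity fun x => ENNReal.ofReal (f x)) x = logConv f x := by
      intro x
      rw [potential, integral_withDensity_eq_integral_toReal_smul
        hf.measurable.ennreal_ofReal (.of_forall fun _ => ENNReal.ofReal_lt_top)]
      refine integral_congr_ae (.of_forall fun y => ?_)
      dsimp only
      rw [ENNReal.toReal_ofReal (hf.nonneg y), smul_eq_mul, mul_comm]
    change unif.withDensity (fun x => ENNReal.ofReal (f x)) = unif.tilted fun x =>
      -V x - 2 * β * potential (unif.withDensity fun x => ENNReal.ofReal (f x)) x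
    simp_rw [hp]
    refine withDensity_congr_ae ?_
    filter_upwards [hfe] with x hx
    conv_lhs => rw [hx]
    rfl

end Existence

/-! ### Weak derivatives and boundedness of the external potential -/

theorem integrable_fourier_mul {g : Torus → ℝ} (hg : Integrable g unif) (k : ℤ) :
    Integrable (fun t => fourier k t * (g t : ℂ)) unif :=
  hg.ofReal.bdd_mul (fourier k).continuous.aestronglyMeasurable (c := 1)
    (.of_forall fun _ => (norm_fourier_apply _ _).le)

theorem integral_continuousMap_mul_eq_zero {g : Torus → ℝ} (hg : Integrable g unif)
    (h : ∀ k : ℤ, ∫ t, fourier (-k) t * (g t : ℂ) ∂unif = 0) (f : C(Torus, ℂ)) :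
    ∫ t, f t * (g t : ℂ) ∂unif = 0 := by
  have hi : ∀ f : C(Torus, ℂ), Integrable (fun t => f t * (g t : ℂ)) unif := fun f =>
    hg.ofReal.bdd_mul f.continuous.aestronglyMeasurable (c := ‖f‖)
      (.of_forall fun t => f.norm_coe_le_norm t)
  let Φ : C(Torus, ℂ) →ₗ[ℂ] ℂ :=
    { toFun := fun f => ∫ t, f t * (g t : ℂ) ∂unif
      map_add' := fun f₁ f₂ => by
        simp only [ContinuousMap.add_apply, add_mul]
        exact integral_add (hi f₁) (hi f₂)
      map_smul' := fun c f => by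
        simp only [ContinuousMap.smul_apply, smul_eq_mul, mul_assoc, RingHom.id_apply]
        exact integral_const_mul _ _ }
  have hΦ : Continuous Φ := AddMonoidHomClass.continuous_of_bound Φ (∫ t, ‖(g t : ℂ)‖ ∂unif)
    fun f => by
      refine le_of_le_of_eq ?_ (integral_mul_const ‖f‖ fun t => ‖(g t : ℂ)‖)
      refine norm_integral_le_of_norm_le (f := fun t => f t * (g t : ℂ))
        (hg.ofReal.norm.mul_const _) (.of_forall fun t => ?_)
      rw [norm_mul, mul_comm]
      exact mul_le_mul_of_nonneg_left (f.norm_coe_le_norm t) (norm_nonneg _)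
  have hle : (Submodule.span ℂ (Set.range (fourier (T := 2 * Real.pi)))).topologicalClosure
      ≤ LinearMap.ker Φ := by
    refine Submodule.topologicalClosure_minimal _ (Submodule.span_le.2 ?_)
      (isClosed_singleton.preimage hΦ)
    rintro _ ⟨k, rfl⟩
    have := h (-k)
    rw [neg_neg] at this
    exact this
  rw [span_fourier_closure_eq_top] at hle
  exact hle (Submodule.mem_top (x := f))

/-- Uniqueness of Fourier coefficients in L¹: by density of trigonometric polynomials g annihilates
continuous functions, so its positive and negative parts define the same finite measure. -/
theorem ae_eq_zero_of_fourier_eq_zero {g : Torus → ℝ} (hg : Integrable g unif)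
    (h : ∀ k : ℤ, ∫ t, fourier (-k) t * (g t : ℂ) ∂unif = 0) : g =ᵐ[unif] 0 := by
  wlog hm : Measurable g generalizing g
  · have he := hg.1.ae_eq_mk
    refine he.trans (this (hg.congr he) (fun k => ?_) hg.1.stronglyMeasurable_mk.measurable)
    rw [← h k]
    refine integral_congr_ae ?_
    filter_upwards [he] with t ht
    rw [ht]
  have hm' : Measurable fun t => -g t := hm.neg
  have hp := hg.lintegral_lt_top
  have hn := hg.neg.lintegral_lt_top
  have hfp : IsFiniteMeasure (unif.withDensity fun t => ENNReal.ofReal (g t)) :=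
    isFiniteMeasure_withDensity hp.ne
  have hfn : IsFiniteMeasure (unif.withDensity fun t => ENNReal.ofReal (-g t)) :=
    isFiniteMeasure_withDensity hn.ne
  have heq : unif.withDensity (fun t => ENNReal.ofReal (g t))
      = unif.withDensity fun t => ENNReal.ofReal (-g t) := by
    refine ext_of_forall_integral_eq_of_IsFiniteMeasure fun f => ?_
    have hb : ∀ {w : Torus → ℝ}, Integrable w unif → Integrable (fun t => w t * f t) unif :=
      fun hw => hw.mul_bdd f.continuous.aestronglyMeasurable (c := ‖f‖)
        (.of_forall fun t => f.norm_coe_le_norm t)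
    rw [integral_withDensity_eq_integral_toReal_smul hm.ennreal_ofReal
      (.of_forall fun _ => ENNReal.ofReal_lt_top),
      integral_withDensity_eq_integral_toReal_smul hm'.ennreal_ofReal
      (.of_forall fun _ => ENNReal.ofReal_lt_top), ← sub_eq_zero]
    simp only [ENNReal.toReal_ofReal', smul_eq_mul]
    rw [← integral_sub (hb hg.pos_part) (hb hg.neg_part)]
    have h0 := integral_continuousMap_mul_eq_zero hg h
      ⟨fun t => (f t : ℂ), Complex.continuous_ofReal.comp f.continuous⟩
    have h1 : ∫ t, f t * g t ∂unif = 0 := by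
      have : ∫ t, ((f t * g t : ℝ) : ℂ) ∂unif = 0 := by
        push_cast; exact h0
      rw [integral_complex_ofReal] at this
      exact_mod_cast this
    refine Eq.trans ?_ h1
    refine integral_congr_ae (.of_forall fun t => ?_)
    dsimp only
    have : max (g t) 0 - max (-g t) 0 = g t := by
      rcases le_total 0 (g t) with h3 | h3
      · rw [max_eq_left h3, max_eq_right (neg_nonpos.2 h3), sub_zero]
      · rw [max_eq_right h3, max_eq_left (neg_nonneg.2 h3), zero_sub, neg_neg]
    rw [← sub_mul, this, mul_comm]
  have hae := (withDensity_eq_iff hm.ennreal_ofReal.aemeasurable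
    hm'.ennreal_ofReal.aemeasurable hp.ne).1 heq
  filter_upwards [hae] with t ht
  have h2 := congrArg ENNReal.toReal ht
  simp only [ENNReal.toReal_ofReal'] at h2
  rcases le_total 0 (g t) with h3 | h3
  · rw [max_eq_left h3, max_eq_right (neg_nonpos.2 h3)] at h2
    exact h2
  · rw [max_eq_right h3, max_eq_left (neg_nonneg.2 h3)] at h2
    simpa using h2.symm

theorem integral_fourier_eq_zero {k : ℤ} (hk : k ≠ 0) :
    ∫ t : Torus, fourier (-k) t ∂unif = 0 := by
  have h := congrFun (fourierCoeff_fourier (T := 2 * Real.pi) 0) k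
  rw [Pi.single_eq_of_ne hk] at h
  simpa [fourierCoeff] using h

variable {V W : Torus → ℝ}

theorem HasWeakDeriv.integral_fourier (h : HasWeakDeriv V W) (k : ℤ) :
    Complex.I * k * ∫ t, fourier (-k) t * (V t : ℂ) ∂unif
      = ∫ t, fourier (-k) t * (W t : ℂ) ∂unif := by
  obtain ⟨hV, hW, hVW⟩ := h
  have hF : ∀ x : ℝ, HasDerivAt (fun y : ℝ => (fourier (-k) (y : Torus) : ℂ))
      (-(Complex.I * k) * fourier (-k) (x : Torus)) x := by
    intro x
    convert! hasDerivAt_fourier (2 * Real.pi) (-k) x using 2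
    have : (Real.pi : ℂ) ≠ 0 := Complex.ofReal_ne_zero.2 Real.pi_ne_zero
    push_cast
    field_simp
  have hsm : ContDiff ℝ (⊤ : ℕ∞) fun y : ℝ => (fourier (-k) (y : Torus) : ℂ) := by
    simp_rw [fourier_coe_apply]
    have h1 : ContDiff ℝ (⊤ : ℕ∞) fun y : ℝ => (y : ℂ) := Complex.ofRealCLM.contDiff
    exact ((contDiff_const.mul h1).div_const _).cexp
  -- Test functions are real-valued, so the complex exponential is tested through real-linear
  -- functionals, later the real and imaginary parts.
  have key : ∀ L : ℂ →L[ℝ] ℝ, L (-(Complex.I * k) * ∫ t, fourier (-k) t * (V t : ℂ) ∂unif)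
      = L (-∫ t, fourier (-k) t * (W t : ℂ) ∂unif) := by
    intro L
    have h1 := hVW (fun t => L (fourier (-k) t)) (fun t => L (-(Complex.I * k) * fourier (-k) t))
      (L.contDiff.comp hsm) (fun x => L.hasFDerivAt.comp_hasDerivAt x (hF x))
    have hL : ∀ (v : ℝ) (z : ℂ), v * L z = L (z * (v : ℂ)) := by
      intro v z
      rw [mul_comm z, ← smul_eq_mul v, ← map_smul, Complex.real_smul]
    simp_rw [hL] at h1
    rw [← integral_const_mul, map_neg, ← L.integral_comp_comm
      ((integrable_fourier_mul hV (-k)).const_mul _),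
      ← L.integral_comp_comm (integrable_fourier_mul hW (-k)), ← h1]
    simp_rw [mul_assoc]
  have : -(Complex.I * k) * ∫ t, fourier (-k) t * (V t : ℂ) ∂unif
      = -∫ t, fourier (-k) t * (W t : ℂ) ∂unif :=
    Complex.ext (key Complex.reCLM) (key Complex.imCLM)
  rw [neg_mul, neg_inj] at this
  exact this

/-- The sawtooth is bounded, and for k ≠ 0 its coefficient -i/k inverts the factor ik of the
derivative. Hence ∫ saw(t - a) W(t) is bounded in a and has the nonzero frequencies of V; the
constant c matches the means. -/
theorem HasWeakDeriv.exists_bounded (h : HasWeakDeriv V W) :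
    ∃ U : Torus → ℝ, IsBddMeas U ∧ V =ᵐ[unif] U := by
  have hV := h.1
  have hW := h.2.1
  set B : Torus → ℝ := fun a => ∫ t, saw (t - a) * W t ∂unif
  have hB : IsBddMeas B := by
    constructor
    · have hs : AEStronglyMeasurable W unif := hW.1
      have e : B = fun a => ∫ t, saw (t - a) * hs.mk W t ∂unif := by
        funext a
        refine integral_congr_ae ?_
        filter_upwards [hs.ae_eq_mk] with t ht
        rw [← ht]
      rw [e]
      have : StronglyMeasurable (Function.uncurry fun a t : Torus => saw (t - a) * hs.mk W t) :=
        ((measurable_saw.comp (measurable_snd.sub measurable_fst)).mul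
          (hs.stronglyMeasurable_mk.measurable.comp measurable_snd)).stronglyMeasurable
      exact this.integral_prod_right.measurable
    · refine ⟨2 * Real.pi * ∫ t, |W t| ∂unif, fun a => ?_⟩
      rw [← integral_const_mul]
      refine norm_integral_le_of_norm_le (f := fun t => saw (t - a) * W t)
        (hW.abs.const_mul _) (.of_forall fun t => ?_)
      rw [norm_mul, Real.norm_of_nonneg (saw_mem _).1.le]
      exact mul_le_mul_of_nonneg_right (saw_mem _).2 (abs_nonneg _)
  set c := ∫ t, V t ∂unif - ∫ t, B t ∂unif
  refine ⟨fun x => B x + c, hB.add ⟨measurable_const, |c|, fun _ => le_rfl⟩, ?_⟩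
  have hg : Integrable (fun t => V t - (B t + c)) unif :=
    hV.sub (hB.integrable.add (integrable_const c))
  have h0 := ae_eq_zero_of_fourier_eq_zero hg fun k => ?_
  · filter_upwards [h0] with x hx
    exact sub_eq_zero.1 hx
  have e : ∫ t, fourier (-k) t * ((V t - (B t + c) : ℝ) : ℂ) ∂unif
      = ∫ t, fourier (-k) t * (V t : ℂ) ∂unif - (∫ t, fourier (-k) t * (B t : ℂ) ∂unif
        + (∫ t, fourier (-k) t ∂unif) * c) := by
    have hc : Integrable (fun t => fourier (-k) t * (c : ℂ)) (unif : Measure Torus) :=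
      integrable_fourier_mul (integrable_const c) (-k)
    have hBc : Integrable (fun t => fourier (-k) t * (B t : ℂ) + fourier (-k) t * (c : ℂ)) unif :=
      (integrable_fourier_mul hB.integrable (-k)).add hc
    rw [← integral_mul_const, ← integral_add (integrable_fourier_mul hB.integrable (-k)) hc,
      ← integral_sub (integrable_fourier_mul hV (-k)) hBc]
    refine integral_congr_ae (.of_forall fun t => ?_)
    dsimp only
    push_cast
    ring
  rw [e]
  by_cases hk : k = 0
  · subst hk
    simp only [neg_zero, fourier_zero, one_mul]
    rw [integral_complex_ofReal, integral_complex_ofReal]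
    simp [c]
  · have hk' : (k : ℂ) ≠ 0 := Int.cast_ne_zero.2 hk
    have h1 : ∫ t, fourier (-k) t * (B t : ℂ) ∂unif
        = (∫ b, fourier k b * (saw b : ℂ) ∂unif) * ∫ t, fourier (-k) t * (W t : ℂ) ∂unif :=
      fourierCoeff_sub_mul measurable_saw integrable_saw hW k
    have h2 := integral_fourier_saw (neg_ne_zero.2 hk)
    rw [neg_neg] at h2
    rw [h1, h2, integral_fourier_eq_zero hk, ← h.integral_fourier k]
    push_cast
    field_simp
    ring_nf
    simp

/-! ### Invariance under null sets, the uniform case and the constant -/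

variable {U : Torus → ℝ}

theorem refMeasure_congr (h : V =ᵐ[unif] U) : refMeasure V = refMeasure U :=
  tilted_congr (by filter_upwards [h] with x hx; rw [hx])

theorem gibbs_congr (h : V =ᵐ[unif] U) (N : ℕ) (β : ℝ) : gibbs N β V = gibbs N β U := by
  have hw : (fun x => ENNReal.ofReal (weight N β V x)) =ᵐ[Measure.pi fun _ : Fin N => unif]
      fun x => ENNReal.ofReal (weight N β U x) := by
    have h1 : ∀ i : Fin N, ∀ᵐ x ∂(Measure.pi fun _ : Fin N => (unif : Measure Torus)),
        V (x i) = U (x i) := fun i =>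
      (measurePreserving_eval (fun _ : Fin N => (unif : Measure Torus)) i).quasiMeasurePreserving.ae h
    filter_upwards [ae_all_iff.2 h1] with x hx
    simp only [weight, hx]
  rw [gibbs, gibbs, partitionFunction, partitionFunction, lintegral_congr_ae hw,
    withDensity_congr_ae hw]

theorem potential_unif (x : Torus) : potential unif x = potential unif 0 := by
  rw [potential, potential, integral_sub_left_eq_self logKer, integral_sub_left_eq_self logKer]

theorem unif_eq_tilted_potential (β : ℝ) :
    (unif : Measure Torus) = unif.tilted fun x => -0 - 2 * β * potential unif x := by
  simp_rw [potential_unif]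
  exact (tilted_const _ _).symm

/-- By translation invariance the uniform measure has constant potential and solves the equation for
V = 0. It is then a strict minimiser, and two distinct strict minimisers cannot coexist. -/
theorem eq_unif_of_isEquilibriumMeasure {β : ℝ} (hβ : 0 < β) {μ : ProbabilityMeasure Torus}
    (hμ : IsEquilibriumMeasure β (fun _ => 0) μ) : (μ : Measure Torus) = unif := by
  by_contra hne
  have hle : (unif : Measure Torus) ≤ ENNReal.ofReal 1 • unif := by simp
  have h1 := freeEnergy_lt hle zero_le_one hβ (V := fun _ => 0) (by simp)
    (unif_eq_tilted_potential β) (ν := μ) hne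
  have h2 := hμ ⟨unif, inferInstance⟩ fun h => hne (by rw [← h]; rfl)
  exact lt_asymm h1 h2

/-- C has to be fixed before β and V, which is possible because the estimate involves μ only through
a density bound. That bound M' is chosen once for each μ, independently of the M produced by the
existence proof. -/
theorem exists_concentration_constant : ∃ C : ProbabilityMeasure Torus → ℝ,
    (∀ μ, 0 < C μ) ∧
    (∀ μ : ProbabilityMeasure Torus, ∀ M : ℝ, 0 ≤ M → (μ : Measure Torus) ≤ ENNReal.ofReal M • unif →
      ∃ M' : ℝ, 0 ≤ M' ∧ (μ : Measure Torus) ≤ ENNReal.ofReal M' • unif ∧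
        8 * M' + 2 + Real.log 2 ≤ C μ) ∧
    ∀ μ : ProbabilityMeasure Torus, (μ : Measure Torus) = unif →
      C μ = 2 * Real.log 2 + 3 / 2 + 16 + 1 / Real.pi := by
  have hl : 0 < Real.log 2 := Real.log_pos one_lt_two
  have hpi : 0 < 1 / Real.pi := by have := Real.pi_pos; positivity
  have key : ∀ μ : ProbabilityMeasure Torus, ∃ c : ℝ, 0 < c ∧
      (∀ M : ℝ, 0 ≤ M → (μ : Measure Torus) ≤ ENNReal.ofReal M • unif →
        ∃ M' : ℝ, 0 ≤ M' ∧ (μ : Measure Torus) ≤ ENNReal.ofReal M' • unif ∧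
          8 * M' + 2 + Real.log 2 ≤ c) ∧
      ((μ : Measure Torus) = unif → c = 2 * Real.log 2 + 3 / 2 + 16 + 1 / Real.pi) := by
    intro μ
    by_cases hμ : (μ : Measure Torus) = unif
    -- For the uniform measure M' = 1 requires only 10 + log 2, which the prescribed constant
    -- exceeds.
    · exact ⟨_, by positivity, fun M _ _ => ⟨1, zero_le_one, by simp [hμ], by linarith⟩,
        fun _ => rfl⟩
    by_cases hM : ∃ M : ℝ, 0 ≤ M ∧ (μ : Measure Torus) ≤ ENNReal.ofReal M • unif
    · obtain ⟨M, hM0, hM⟩ := hM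
      exact ⟨8 * M + 2 + Real.log 2, by positivity, fun _ _ _ => ⟨M, hM0, hM, le_rfl⟩,
        fun h => absurd h hμ⟩
    · exact ⟨1, one_pos, fun M h1 h2 => absurd ⟨M, h1, h2⟩ hM, fun h => absurd h hμ⟩
  choose C h1 h2 h3 using key
  exact ⟨C, h1, h2, h3⟩

end CircleGas

theorem mainTheorem2 :
    ∃ C : ProbabilityMeasure CircleGas.Torus → ℝ,
      (∀ μ, 0 < C μ) ∧
      (∀ β : ℝ, 0 < β → ∀ V W : CircleGas.Torus → ℝ,
        CircleGas.HasWeakDeriv V W → MemLp W 2 CircleGas.unif →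
        ∃ μ : ProbabilityMeasure CircleGas.Torus,
          CircleGas.IsEquilibriumMeasure β V μ ∧
          ∀ N : ℕ, 10 ≤ N → ∀ r : ℝ, 0 < r →
            CircleGas.gibbs N β V
                {x | ENNReal.ofReal r
                  < CircleGas.wasserstein (CircleGas.empirical N x)
                      (μ : Measure CircleGas.Torus)}
              ≤ ENNReal.ofReal (Real.exp
                  (-β * (1 / (8 * Real.pi) * N * r ^ 2 - 5 * Real.log N - C μ)))) ∧
      (∀ β : ℝ, 0 < β → ∀ μ : ProbabilityMeasure CircleGas.Torus,
        CircleGas.IsEquilibriumMeasure β (fun _ => 0) μ →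
        C μ = 2 * Real.log 2 + 3 / 2 + 16 + 1 / Real.pi) := by
  obtain ⟨C, hpos, hbound, hunif⟩ := CircleGas.exists_concentration_constant
  refine ⟨C, hpos, fun β hβ V W hVW _ => ?_, fun β hβ μ hμ =>
    hunif μ (CircleGas.eq_unif_of_isEquilibriumMeasure hβ hμ)⟩
  -- The Gibbs law and the free energy see V only up to null sets, so V may be replaced by its
  -- bounded representative U.
  obtain ⟨U, ⟨hU, B, hB⟩, hVU⟩ := hVW.exists_bounded
  obtain ⟨M, hM0, μ, hM, hμ⟩ := CircleGas.exists_eq_tilted_potential hβ hU hB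
  have hexp : Integrable (fun x => Real.exp (-U x)) CircleGas.unif :=
    .of_bound (Real.measurable_exp.comp hU.neg).aestronglyMeasurable (Real.exp B)
      (.of_forall fun x => (abs_of_pos (Real.exp_pos _)).trans_le
        (Real.exp_le_exp.2 (neg_le.1 (abs_le.1 (hB x)).1)))
  refine ⟨μ, fun ν hν => ?_, fun N hN r hr => ?_⟩
  · simp only [CircleGas.freeEnergy, CircleGas.refMeasure_congr hVU]
    exact CircleGas.freeEnergy_lt hM hM0 hβ hexp hμ fun h => hν (Subtype.ext h)
  · obtain ⟨M', hM'0, hM', hC⟩ := hbound μ M hM0 hM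
    rw [CircleGas.gibbs_congr hVU]
    refine (CircleGas.gibbs_wasserstein_le hM' hM'0 hβ hU hμ (by omega) hr).trans
      (ENNReal.ofReal_le_ofReal (Real.exp_le_exp.2 ?_))
    rw [neg_mul, neg_mul]
    exact neg_le_neg (mul_le_mul_of_nonneg_left (by linarith) hβ.le)
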